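/- **Setting.** Let $L=E(5,10)$ be the Lie superalgebra over $\mathbb C$ whose even part is the Lie algebra of divergence-free vector fields $\sum_i f_i\partial_i$, $f_i\in\mathbb C[[x_1,\dots,x_5]]$, whose odd part is the space of closed two-forms in $x_1,\dots,x_5$ with coefficients in $\mathbb C[[x_1,\dots,x_5]]$, where a vector field acts on a form by the Lie derivative and $[f\,dx_i\wedge dx_j,\ g\,dx_k\wedge dx_l]=\varepsilon\, fg\,\partial_t$ if $\{i,j,k,l,t\}=\{1,\dots,5\}$, $\varepsilon$ being the sign of the permutation $(i,j,k,l,t)$, and $0$ if $i,j,k,l$ are not distinct. Write $d_{ij}=dx_i\wedge dx_j$. Grade $L$ by $\deg(x^m\partial_i)=2|m|-2$, $\deg(x^m d_{ij})=2|m|-1$; then $L_0\cong\mathfrak{sl}_5$ via $x_i\partial_j\mapsto E_{ij}$. Let $L_{\ge 0}$ be the subalgebra of elements with components in degrees $\ge 0$ only, $U=U(L)$, $U_-=U(L_{-2}\oplus L_{-1})$, and $(U_-)_d$ the component of $U_-$ of degree $-d$. For a dominant weight $\lambda=(a,b,c,d)\in\mathbb N^4$ (coordinates with respect to the fundamental weights)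 let $F(\lambda)$ be the irreducible $\mathfrak{sl}_5$-module of highest weight $\lambda$, realized as the submodule of $\mathrm{Sym}^a(\mathbb C^5)\otimes \mathrm{Sym}^b(\bigwedge^2\mathbb C^5)\otimes \mathrm{Sym}^c((\bigwedge^2\mathbb C^5)^*)\otimes \mathrm{Sym}^d((\mathbb C^5)^*)$ generated by $x_1^a x_{12}^b (x_{45}^*)^c (x_5^*)^d$, where $x_i$, $x_{ij}=x_i\wedge x_j$, $x_{ij}^*$, $x_i^*$ are the standard bases and their duals. Extend $F(\lambda)$ to $L_{\ge0}$ by letting the components of positive degree act by $0$, and let $M(\lambda)=U\otimes_{U(L_{\ge 0})}F(\lambda)$ (a minimal Verma module). A morphism of $L$-modules $\varphi:M(\lambda)\to M(\mu)$ has degree $d$ if $\varphi(1\otimes v)\in (U_-)_d\otimes F(\mu)$ for all $v\in F(\lambda)$. For all $m,n\ge 0$ there are the following morphisms of degree $1$, each determined by its values on $1\otimes F(\lambda)$: - $\nabla_A:M(m,n+1,0,0)\to M(m,n,0,0)$, $\ 1\otimes v\mapsto \sum_{i<j} d_{ij}\otimes \frac{\partial v}{\partial x_{ij}}$; - $\nabla_B:M(m+1,0,0,n)\to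 M(m,0,0,n+1)$, $\ 1\otimes v\mapsto \sum_{i<j} d_{ij}\otimes \big(x_i^*\frac{\partial v}{\partial x_j}-x_j^*\frac{\partial v}{\partial x_i}\big)$; - $\nabla_C:M(0,0,m,n)\to M(0,0,m+1,n)$, $\ 1\otimes v\mapsto \sum_{i<j} d_{ij}\otimes \pi(x_{ij}^* v)$, where $\pi$ is the $\mathfrak{sl}_5$-equivariant projection of $\mathrm{Sym}^{m+1}((\bigwedge^2\mathbb C^5)^*)\otimes \mathrm{Sym}^n((\mathbb C^5)^*)$ onto $F(0,0,m+1,n)$. **Theorem.** Let $\lambda,\mu\in\mathbb N^4$ and let $\varphi:M(\lambda)\to M(\mu)$ be a nonzero morphism of degree $2$. Then one of the following occurs: 1. $\lambda=(1,0,0,n)$, $\mu=(0,0,1,n+1)$ for some $n\ge 0$ and, up to a scalar, $\varphi=\nabla_C\nabla_B$ (through $M(0,0,0,n+1)$); 2. $\lambda=(n+1,1,0,0)$, $\mu=(n,0,0,1)$ for some $n\ge 0$ and, up to a scalar, $\varphi=\nabla_B\nabla_A$ (through $M(n+1,0,0,0)$); 3. $\lambda=(0,1,0,0)$, $\mu=(0,0,1,0)$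 and, up to a scalar, $\varphi=\nabla_C\nabla_A$ (through $M(0,0,0,0)$). -/

import Mathlib

open scoped TensorProduct

noncomputable section

namespace E510

/-! ### The Lie superalgebra `E(5,10)` -/

/-- Formal power series in five even variables `x_0, ..., x_4` (indices are shifted by one). -/
abbrev PS : Type := MvPowerSeries (Fin 5) ℂ

/-- The formal partial derivative with respect to `x_i`. -/
abbrev D (i : Fin 5) : Derivation ℂ PS PS := MvPowerSeries.pderiv ℂ i

/-- All pairs (vector field `∑ X_i ∂_i`, matrix of functions `ω_ij`). The matrix encodes the
two-form `∑_{i<j} ω_ij dx_i ∧ dx_j` as soon as it is skew-symmetric. -/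
abbrev Ambient : Type := (Fin 5 → PS) × (Fin 5 → Fin 5 → PS)

/-- The divergence of a vector field. -/
def div (X : Fin 5 → PS) : PS := ∑ i, D i (X i)

/-- The coefficient of `dx_i ∧ dx_j ∧ dx_k` in the exterior derivative of a two-form. -/
def extD (ω : Fin 5 → Fin 5 → PS) (i j k : Fin 5) : PS :=
  D i (ω j k) + D j (ω k i) + D k (ω i j)

lemma div_add (X Y : Fin 5 → PS) : div (X + Y) = div X + div Y := by
  simp [div, Finset.sum_add_distrib]

lemma div_smul (c : ℂ) (X : Fin 5 → PS) : div (c • X) = c • div X := by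
  simp [div, Finset.smul_sum]

/-- `L = E(5,10)` as a vector space: divergence-free vector fields plus closed two-forms. -/
def carrierSubmodule : Submodule ℂ Ambient where
  carrier := {x | div x.1 = 0 ∧ (∀ i j, x.2 i j = - x.2 j i) ∧ ∀ i j k, extD x.2 i j k = 0}
  zero_mem' := by simp [div, extD]
  add_mem' := by
    rintro x y ⟨hx1, hx2, hx3⟩ ⟨hy1, hy2, hy3⟩
    refine ⟨?_, ?_, ?_⟩
    · rw [Prod.fst_add, div_add, hx1, hy1, add_zero]
    · intro i j
      simp only [Prod.snd_add, Pi.add_apply]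
      rw [hx2 i j, hy2 i j]; ring
    · intro i j k
      have h1 := hx3 i j k
      have h2 := hy3 i j k
      simp only [extD, Prod.snd_add, Pi.add_apply, map_add] at *
      linear_combination h1 + h2
  smul_mem' := by
    rintro c x ⟨hx1, hx2, hx3⟩
    refine ⟨?_, ?_, ?_⟩
    · rw [Prod.smul_fst, div_smul, hx1, smul_zero]
    · intro i j
      simp only [Prod.smul_snd, Pi.smul_apply]
      rw [hx2 i j, smul_neg]
    · intro i j k
      have h1 := hx3 i j k
      simp only [extD, Prod.smul_snd, Pi.smul_apply] at *
      rw [Derivation.map_smul, Derivation.map_smul, Derivation.map_smul, ← smul_add, ← smul_add,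
        h1, smul_zero]

/-- The underlying vector space of the Lie superalgebra `E(5,10)`. -/
abbrev L : Type := carrierSubmodule

/-- The commutator of two vector fields. -/
def vfBracket (X Y : Fin 5 → PS) : Fin 5 → PS := fun i =>
  ∑ m, (X m * D m (Y i) - Y m * D m (X i))

/-- The Lie derivative of a two-form along a vector field. -/
def lieDeriv (X : Fin 5 → PS) (ω : Fin 5 → Fin 5 → PS) : Fin 5 → Fin 5 → PS := fun i j =>
  ∑ m, (X m * D m (ω i j) + D i (X m) * ω m j + D j (X m) * ω i m)

/-- The bracket of two two-forms: the bilinear extension of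
`[f dx_i ∧ dx_j, g dx_k ∧ dx_l] = ε_{ijkl} f g ∂_{t_{ijkl}}`. Every two-form is
`(1/2) ∑_{i,j} ω_ij dx_i ∧ dx_j`, whence the factor `1/4`; a permutation `σ` stands for the
tuple `(i,j,k,l,t)`. -/
def formBracket (ω η : Fin 5 → Fin 5 → PS) : Fin 5 → PS := fun t =>
  (1 / 4 : ℂ) • ∑ σ : Equiv.Perm (Fin 5),
    if σ 4 = t then ((Equiv.Perm.sign σ : ℤ) : PS) * (ω (σ 0) (σ 1) * η (σ 2) (σ 3)) else 0

/-- The bracket of `E(5,10)`, on the ambient space. -/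
def ambientBracket (x y : Ambient) : Ambient :=
  (vfBracket x.1 y.1 + formBracket x.2 y.2, lieDeriv x.1 y.2 - lieDeriv y.1 x.2)

lemma D_comm (i j : Fin 5) (f : PS) : D i (D j f) = D j (D i f) := by
  ext n
  simp only [MvPowerSeries.coeff_pderiv]
  by_cases h : i = j
  · subst h; rfl
  · simp only [Finsupp.add_apply, Finsupp.single_eq_of_ne h, Finsupp.single_eq_of_ne (Ne.symm h),
      add_zero]
    rw [add_right_comm]; ring

lemma div_vfBracket {X Y : Fin 5 → PS} (hX : div X = 0) (hY : div Y = 0) :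
    div (vfBracket X Y) = 0 := by
  have e : div (vfBracket X Y) = ∑ m, (X m * D m (div Y) - Y m * D m (div X))
      + (∑ i, ∑ m, D i (X m) * D m (Y i) - ∑ i, ∑ m, D i (Y m) * D m (X i)) := by
    simp only [div, vfBracket, map_sum, map_sub, Derivation.leibniz, smul_eq_mul, Finset.mul_sum,
      Finset.sum_sub_distrib, Finset.sum_add_distrib]
    rw [Finset.sum_comm (f := fun m i => X m * D m (D i (Y i))),
      Finset.sum_comm (f := fun m i => Y m * D m (D i (X i)))]
    simp only [fun (i m : Fin 5) (f : PS) => D_comm i m f, mul_comm]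
    ring
  have h2 : ∑ i, ∑ m, D i (Y m) * D m (X i) = ∑ i, ∑ m, D i (X m) * D m (Y i) := by
    rw [Finset.sum_comm]
    simp only [mul_comm]
  rw [e, h2, hX, hY]
  simp

lemma div_formBracket {ω η : Fin 5 → Fin 5 → PS} (hω : ∀ i j k, extD ω i j k = 0)
    (hη : ∀ i j k, extD η i j k = 0) : div (formBracket ω η) = 0 := by
  have key : ∀ (f : Fin 5 → Fin 5 → Fin 5 → PS) (g : Fin 5 → Fin 5 → PS) (a b c d e : Fin 5)
      (s : Equiv.Perm (Fin 5)) (_ : Equiv.Perm.sign s = 1) (_ : s a = b) (_ : s b = c)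
      (_ : s c = a) (_ : s d = d) (_ : s e = e) (_ : ∀ i j k, f i j k + f j k i + f k i j = 0),
      ∑ σ : Equiv.Perm (Fin 5), ((Equiv.Perm.sign σ : ℤ) : PS)
        * (f (σ a) (σ b) (σ c) * g (σ d) (σ e)) = 0 := by
    intro f g a b c d e s hs ha hb hc hd he hf
    have r : ∀ F : Equiv.Perm (Fin 5) → PS, ∑ σ, F σ = ∑ σ, F (σ * s) := fun F =>
      (Fintype.sum_equiv (Equiv.mulRight s) _ _ (fun σ => rfl)).symm
    have h1 := r (fun σ => ((Equiv.Perm.sign σ : ℤ) : PS)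
        * (f (σ a) (σ b) (σ c) * g (σ d) (σ e)))
    have h2 := r (fun σ => ((Equiv.Perm.sign σ : ℤ) : PS)
        * (f (σ b) (σ c) (σ a) * g (σ d) (σ e)))
    simp only [Equiv.Perm.mul_apply, Equiv.Perm.sign_mul, hs, ha, hb, hc, hd, he, mul_one]
      at h1 h2
    have h3 : ∑ σ : Equiv.Perm (Fin 5), ((Equiv.Perm.sign σ : ℤ) : PS)
        * ((f (σ a) (σ b) (σ c) + f (σ b) (σ c) (σ a) + f (σ c) (σ a) (σ b))
          * g (σ d) (σ e)) = 0 := by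
      simp [hf]
    simp only [add_mul, mul_add, Finset.sum_add_distrib] at h3
    rw [← h2, ← h1] at h3
    have h4 : (3 : PS) * ∑ σ : Equiv.Perm (Fin 5), ((Equiv.Perm.sign σ : ℤ) : PS)
        * (f (σ a) (σ b) (σ c) * g (σ d) (σ e)) = 0 := by
      linear_combination h3
    have h5 : ((3 : ℂ)⁻¹ : ℂ) • ((3 : ℂ) • ∑ σ : Equiv.Perm (Fin 5),
        ((Equiv.Perm.sign σ : ℤ) : PS) * (f (σ a) (σ b) (σ c) * g (σ d) (σ e))) = 0 := by
      rw [Algebra.smul_def (3 : ℂ), map_ofNat, h4, smul_zero]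
    rwa [smul_smul, inv_mul_cancel₀ (by norm_num), one_smul] at h5
  have e : div (formBracket ω η) = (1 / 4 : ℂ) • ((∑ σ : Equiv.Perm (Fin 5),
        ((Equiv.Perm.sign σ : ℤ) : PS) * (D (σ 4) (ω (σ 0) (σ 1)) * η (σ 2) (σ 3)))
      + ∑ σ : Equiv.Perm (Fin 5),
        ((Equiv.Perm.sign σ : ℤ) : PS) * (D (σ 4) (η (σ 2) (σ 3)) * ω (σ 0) (σ 1))) := by
    simp only [div, formBracket, Derivation.map_smul, map_sum, ← Finset.smul_sum]
    congr 1
    rw [Finset.sum_comm, ← Finset.sum_add_distrib]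
    refine Finset.sum_congr rfl fun σ _ => ?_
    rw [Finset.sum_eq_single (σ 4)]
    · simp only [if_true, Derivation.leibniz, smul_eq_mul, Derivation.map_intCast]
      ring
    · intro b _ hb
      rw [if_neg (Ne.symm hb), map_zero]
    · simp
  rw [e, key (fun i j k => D k (ω i j)) η 0 1 4 2 3
      (Equiv.swap 0 1 * Equiv.swap 1 4) (by decide) (by decide) (by decide) (by decide)
      (by decide) (by decide), key (fun i j k => D k (η i j)) ω 2 3 4 0 1
      (Equiv.swap 2 3 * Equiv.swap 3 4) (by decide) (by decide) (by decide) (by decide)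
      (by decide) (by decide)]
  · simp
  · intro i j k
    have := hη k i j
    simp only [extD] at this
    linear_combination this
  · intro i j k
    have := hω k i j
    simp only [extD] at this
    linear_combination this

lemma lieDeriv_skew (X : Fin 5 → PS) {ω : Fin 5 → Fin 5 → PS} (ha : ∀ i j, ω i j = - ω j i)
    (i j : Fin 5) : lieDeriv X ω i j = - lieDeriv X ω j i := by
  simp only [lieDeriv, ← Finset.sum_neg_distrib]
  refine Finset.sum_congr rfl fun m _ => ?_
  rw [ha i j, ha m j, ha i m, map_neg]
  ring

lemma extD_lieDeriv (X : Fin 5 → PS) {ω : Fin 5 → Fin 5 → PS} (ha : ∀ i j, ω i j = - ω j i)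
    (hω : ∀ i j k, extD ω i j k = 0) (i j k : Fin 5) : extD (lieDeriv X ω) i j k = 0 := by
  have e : extD (lieDeriv X ω) i j k = ∑ m, (X m * D m (extD ω i j k)
      + D i (X m) * extD ω m j k + D j (X m) * extD ω i m k + D k (X m) * extD ω i j m) := by
    simp only [extD, lieDeriv, map_sum, ← Finset.sum_add_distrib]
    refine Finset.sum_congr rfl fun m _ => ?_
    simp only [map_add, Derivation.leibniz, smul_eq_mul]
    rw [D_comm j i (X m), D_comm k i (X m), D_comm k j (X m), D_comm i m, D_comm j m, D_comm k m,
      ha k m, ha i m, ha j m]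
    simp only [map_neg]
    ring
  rw [e]
  simp [hω]

lemma extD_sub (ω η : Fin 5 → Fin 5 → PS) (i j k : Fin 5) :
    extD (ω - η) i j k = extD ω i j k - extD η i j k := by
  simp only [extD, Pi.sub_apply, map_sub]
  ring

lemma ambientBracket_mem {x y : Ambient} (hx : x ∈ carrierSubmodule) (hy : y ∈ carrierSubmodule) :
    ambientBracket x y ∈ carrierSubmodule := by
  obtain ⟨hx1, hx2, hx3⟩ := hx
  obtain ⟨hy1, hy2, hy3⟩ := hy
  refine ⟨?_, ?_, ?_⟩
  · simp only [ambientBracket]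
    rw [div_add, div_vfBracket hx1 hy1, div_formBracket hx3 hy3, add_zero]
  · intro i j
    simp only [ambientBracket, Pi.sub_apply]
    rw [lieDeriv_skew x.1 hy2 i j, lieDeriv_skew y.1 hx2 i j]
    ring
  · intro i j k
    simp only [ambientBracket]
    rw [extD_sub, extD_lieDeriv x.1 hy2 hy3, extD_lieDeriv y.1 hx2 hx3, sub_zero]

/-- The (super)bracket of `E(5,10)`; for an odd `x` and an even `y` it is
`[x, y] = -[y, x] = -(Lie derivative of x along y)`. -/
def bracket (x y : L) : L := ⟨ambientBracket x.1 y.1, ambientBracket_mem x.2 y.2⟩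

/-- The even elements: vector fields. -/
def IsEven (x : L) : Prop := x.1.2 = 0

/-- The odd elements: two-forms. -/
def IsOdd (x : L) : Prop := x.1.1 = 0

/-- The component `L_j` of the grading in which `x^m ∂_i` has degree `2|m| - 2` and
`x^m dx_i ∧ dx_k` has degree `2|m| - 1`. -/
def gradedPiece (j : ℤ) : Set L :=
  {x | (∀ i m, MvPowerSeries.coeff m (x.1.1 i) ≠ 0 → 2 * (m.degree : ℤ) - 2 = j) ∧
    ∀ i k m, MvPowerSeries.coeff m (x.1.2 i k) ≠ 0 → 2 * (m.degree : ℤ) - 1 = j}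

/-- `L_{≥ 0}`: the elements of `L` all of whose components have degree `≥ 0`. -/
def nonnegPart : Set L :=
  {x | (∀ i m, MvPowerSeries.coeff m (x.1.1 i) ≠ 0 → 0 ≤ 2 * (m.degree : ℤ) - 2) ∧
    ∀ i k m, MvPowerSeries.coeff m (x.1.2 i k) ≠ 0 → 0 ≤ 2 * (m.degree : ℤ) - 1}

section

attribute [local instance] LieRing.ofAssociativeRing

/-- The Lie algebra `sl_5` of complex matrices of trace zero, with the commutator as bracket. -/
def sl5 : Type := LieAlgebra.SpecialLinear.sl (Fin 5) ℂ

instance : LieRing sl5 := inferInstanceAs (LieRing (LieAlgebra.SpecialLinear.sl (Fin 5) ℂ))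

instance : LieAlgebra ℂ sl5 :=
  inferInstanceAs (LieAlgebra ℂ (LieAlgebra.SpecialLinear.sl (Fin 5) ℂ))

/-- The underlying matrix of an element of `sl_5`. -/
def sl5.mat : sl5 →ₗ[ℂ] Matrix (Fin 5) (Fin 5) ℂ :=
  (LieAlgebra.SpecialLinear.sl (Fin 5) ℂ).toSubmodule.subtype

/-- The element of `sl_5` given by a matrix of trace zero. -/
def sl5.mk (A : Matrix (Fin 5) (Fin 5) ℂ) (h : A.trace = 0) : sl5 :=
  ⟨A, h⟩

lemma sl5.mat_mk (A : Matrix (Fin 5) (Fin 5) ℂ) (h : A.trace = 0) : (sl5.mk A h).mat = A := rfl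

lemma sl5.ext {A B : sl5} (h : A.mat = B.mat) : A = B := Subtype.ext h

lemma sl5.mat_lie (A B : sl5) : ⁅A, B⁆.mat = A.mat * B.mat - B.mat * A.mat := rfl

end

/-- The projection of `L` onto `L_0`, which is identified with `sl_5` by sending `x_i ∂_j` to the
matrix unit `E_ij`. -/
def linPart : L →ₗ[ℂ] sl5 where
  toFun x := sl5.mk (Matrix.of fun i j => MvPowerSeries.coeff (Finsupp.single i 1) (x.1.1 j)) (by
    have h := congrArg (MvPowerSeries.coeff (0 : Fin 5 →₀ ℕ)) x.2.1
    simp only [div, map_sum, MvPowerSeries.coeff_pderiv] at h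
    simpa [Matrix.trace] using h)
  map_add' x y := by
    refine sl5.ext ?_
    rw [map_add]
    ext i j
    simp [sl5.mat_mk]
  map_smul' c x := by
    refine sl5.ext ?_
    rw [map_smul]
    ext i j
    simp [sl5.mat_mk]

/-- The constant two-form `d_ij = dx_i ∧ dx_j`. -/
def dForm (i j : Fin 5) : L :=
  ⟨(0, fun a b => MvPowerSeries.C
    ((if a = i ∧ b = j then (1 : ℂ) else 0) - (if a = j ∧ b = i then 1 else 0))), by
    refine ⟨by simp [div], fun a b => ?_, fun a b c => ?_⟩
    · simp only [← map_neg, neg_sub]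
      simp only [and_comm]
    · simp only [extD, MvPowerSeries.pderiv_C, add_zero]⟩

/-! ### The universal enveloping algebra -/

/-- The defining relations `x y - (-1)^{|x||y|} y x = [x, y]` of `U(L)`. -/
inductive EnvRel : TensorAlgebra ℂ L → TensorAlgebra ℂ L → Prop
  | even_left (x y : L) (hx : IsEven x) :
      EnvRel (TensorAlgebra.ι ℂ x * TensorAlgebra.ι ℂ y)
        (TensorAlgebra.ι ℂ y * TensorAlgebra.ι ℂ x + TensorAlgebra.ι ℂ (bracket x y))
  | odd_odd (x y : L) (hx : IsOdd x) (hy : IsOdd y) :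
      EnvRel (TensorAlgebra.ι ℂ x * TensorAlgebra.ι ℂ y + TensorAlgebra.ι ℂ y * TensorAlgebra.ι ℂ x)
        (TensorAlgebra.ι ℂ (bracket x y))

/-- The universal enveloping algebra `U = U(L)`. -/
def U : Type := RingQuot EnvRel

instance : Ring U := inferInstanceAs (Ring (RingQuot EnvRel))

instance : Algebra ℂ U := inferInstanceAs (Algebra ℂ (RingQuot EnvRel))

/-- The canonical map `L → U`. -/
def toU : L →ₗ[ℂ] U := (RingQuot.mkAlgHom ℂ EnvRel).toLinearMap ∘ₗ TensorAlgebra.ι ℂ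

/-- The component `(U_-)_d` of `U_- = U(L_{-1} ⊕ L_{-2})`, with the sign of the degree inverted:
it is spanned by the products `y_1 ⋯ y_r` with `y_s ∈ L_{-j_s}`, `j_s > 0`, `∑ j_s = d`. -/
def UMinus (d : ℕ) : Submodule ℂ U :=
  Submodule.span ℂ {u | ∃ l : List (ℕ × L),
    (∀ p ∈ l, 0 < p.1 ∧ p.2 ∈ gradedPiece (-(p.1 : ℤ))) ∧ (l.map Prod.fst).sum = d ∧
      u = (l.map fun p => toU p.2).prod}

/-! ### Generalized Verma modules -/

section Verma

/-- The `U`-submodule of `U ⊗ V` generated by all `x ⊗ v - 1 ⊗ x v` with `x ∈ L_{≥ 0}`, where `x`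
acts on `V` through its component in `L_0`. -/
def vermaRel (V : Type) [AddCommGroup V] [Module ℂ V] [LieRingModule sl5 V] :
    Submodule U (U ⊗[ℂ] V) :=
  Submodule.span U {z | ∃ x ∈ nonnegPart, ∃ v : V, z = toU x ⊗ₜ[ℂ] v - 1 ⊗ₜ[ℂ] ⁅linPart x, v⁆}

/-- The generalized Verma module `M(V) = U ⊗_{U(L_{≥ 0})} V`. -/
abbrev Verma (V : Type) [AddCommGroup V] [Module ℂ V] [LieRingModule sl5 V] : Type :=
  (U ⊗[ℂ] V) ⧸ vermaRel V

/-- The element `u ⊗ v` of `M(V)`. -/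
def vmk {V : Type} [AddCommGroup V] [Module ℂ V] [LieRingModule sl5 V] (u : U) (v : V) : Verma V :=
  (vermaRel V).mkQ (u ⊗ₜ[ℂ] v)

/-- The subspace `(U_-)_d ⊗ V` of `M(V)`. -/
def vermaDeg (V : Type) [AddCommGroup V] [Module ℂ V] [LieRingModule sl5 V] (d : ℕ) :
    Submodule ℂ (Verma V) :=
  Submodule.span ℂ {z | ∃ u ∈ UMinus d, ∃ v : V, z = vmk u v}

/-- A morphism of degree `d`: it is given by `u ⊗ v ↦ u Φ(v)` with `Φ(v) ∈ (U_-)_d ⊗ W`. -/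
def HasDegree {V W : Type} [AddCommGroup V] [Module ℂ V] [LieRingModule sl5 V]
    [AddCommGroup W] [Module ℂ W] [LieRingModule sl5 W] (φ : Verma V →ₗ[U] Verma W) (d : ℕ) :
    Prop :=
  ∀ v : V, φ (vmk 1 v) ∈ vermaDeg W d

end Verma

/-! ### The irreducible `sl_5`-modules `F(λ)` -/

/-- Pairs `i < j` of indices. -/
abbrev Pair : Type := {p : Fin 5 × Fin 5 // p.1 < p.2}

/-- Names for the bases `x_i` of `ℂ^5`, `x_ij` of `⋀²ℂ^5`, `x_ij^*` of `(⋀²ℂ^5)^*`, `x_i^*` of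
`(ℂ^5)^*`. -/
inductive Var : Type
  | x (i : Fin 5) : Var
  | xx (p : Pair) : Var
  | xxd (p : Pair) : Var
  | xd (i : Fin 5) : Var

/-- The algebra `Sym(ℂ^5) ⊗ Sym(⋀²ℂ^5) ⊗ Sym((⋀²ℂ^5)^*) ⊗ Sym((ℂ^5)^*)`. -/
abbrev P : Type := MvPolynomial Var ℂ

/-- `x_ij = x_i ∧ x_j` for arbitrary `i`, `j`. -/
def xx (i j : Fin 5) : P :=
  if h : i < j then MvPolynomial.X (Var.xx ⟨(i, j), h⟩)
  else if h : j < i then - MvPolynomial.X (Var.xx ⟨(j, i), h⟩) else 0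

/-- `x_ij^*` for arbitrary `i`, `j`. -/
def xxd (i j : Fin 5) : P :=
  if h : i < j then MvPolynomial.X (Var.xxd ⟨(i, j), h⟩)
  else if h : j < i then - MvPolynomial.X (Var.xxd ⟨(j, i), h⟩) else 0

/-- The action of a matrix `A` on the four spaces of variables: the standard representation
`A x_k = ∑ A_ik x_i`, its exterior square, and the two dual representations. -/
def actVar (A : Matrix (Fin 5) (Fin 5) ℂ) : Var → P
  | Var.x k => ∑ i, A i k • MvPolynomial.X (Var.x i)
  | Var.xx p => ∑ i, (A i p.1.1 • xx i p.1.2 + A i p.1.2 • xx p.1.1 i)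
  | Var.xxd p => - ∑ i, (A p.1.1 i • xxd i p.1.2 + A p.1.2 i • xxd p.1.1 i)
  | Var.xd k => - ∑ i, A k i • MvPolynomial.X (Var.xd i)

/-- The action of a matrix on `P` by derivations. -/
def actDer (A : Matrix (Fin 5) (Fin 5) ℂ) : Derivation ℂ P P :=
  MvPolynomial.mkDerivation ℂ (actVar A)

lemma actDer_X (A : Matrix (Fin 5) (Fin 5) ℂ) (v : Var) :
    actDer A (MvPolynomial.X v) = actVar A v :=
  MvPolynomial.mkDerivation_X ℂ _ v

lemma xx_skew (i j : Fin 5) : xx i j = - xx j i := by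
  rcases lt_trichotomy i j with h | h | h
  · simp [xx, h, h.not_gt]
  · subst h; simp [xx]
  · simp [xx, h, h.not_gt]

lemma xxd_skew (i j : Fin 5) : xxd i j = - xxd j i := by
  rcases lt_trichotomy i j with h | h | h
  · simp [xxd, h, h.not_gt]
  · subst h; simp [xxd]
  · simp [xxd, h, h.not_gt]

lemma actDer_xx (A : Matrix (Fin 5) (Fin 5) ℂ) (i j : Fin 5) :
    actDer A (xx i j) = ∑ k, (A k i • xx k j + A k j • xx i k) := by
  rcases lt_trichotomy i j with h | h | h
  · simp only [xx, h, dite_true]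
    rw [actDer_X]
    rfl
  · subst h
    have : xx i i = 0 := by simp [xx]
    rw [this, map_zero]
    symm
    refine Finset.sum_eq_zero fun k _ => ?_
    rw [xx_skew i k, smul_neg, add_neg_cancel]
  · rw [xx_skew i j, map_neg]
    conv_lhs => rw [xx, dif_pos h, actDer_X]
    simp only [actVar, ← Finset.sum_neg_distrib]
    refine Finset.sum_congr rfl fun k _ => ?_
    rw [xx_skew k j, xx_skew i k, smul_neg, smul_neg]
    abel

lemma actDer_xxd (A : Matrix (Fin 5) (Fin 5) ℂ) (i j : Fin 5) :
    actDer A (xxd i j) = - ∑ k, (A i k • xxd k j + A j k • xxd i k) := by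
  rcases lt_trichotomy i j with h | h | h
  · simp only [xxd, h, dite_true]
    rw [actDer_X]
    rfl
  · subst h
    have : xxd i i = 0 := by simp [xxd]
    rw [this, map_zero]
    symm
    rw [neg_eq_zero]
    refine Finset.sum_eq_zero fun k _ => ?_
    rw [xxd_skew i k, smul_neg, add_neg_cancel]
  · rw [xxd_skew i j, map_neg]
    conv_lhs => rw [xxd, dif_pos h, actDer_X]
    simp only [actVar, neg_neg, ← Finset.sum_neg_distrib]
    refine Finset.sum_congr rfl fun k _ => ?_
    rw [xxd_skew k j, xxd_skew i k, smul_neg, smul_neg]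
    abel

lemma actVar_comm (A B : Matrix (Fin 5) (Fin 5) ℂ) (v : Var) :
    actVar (A * B - B * A) v = actDer A (actVar B v) - actDer B (actVar A v) := by
  cases v with
  | x k =>
    simp only [actVar, map_sum, Derivation.map_smul, actDer_X, Matrix.sub_apply, sub_smul,
      Finset.sum_sub_distrib, Matrix.mul_apply, Finset.sum_smul, Finset.smul_sum, smul_smul]
    congr 1
    · rw [Finset.sum_comm]; simp only [mul_comm]
    · rw [Finset.sum_comm]; simp only [mul_comm]
  | xd k =>
    simp only [actVar, map_sum, map_neg, Derivation.map_smul, actDer_X, Matrix.sub_apply, sub_smul,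
      Finset.sum_sub_distrib, Matrix.mul_apply, Finset.sum_smul, Finset.smul_sum, smul_smul,
      smul_neg, Finset.sum_neg_distrib, neg_neg, neg_sub]
    congr 1
    · rw [Finset.sum_comm]
    · rw [Finset.sum_comm]
  | xx p =>
    obtain ⟨⟨a, b⟩, h⟩ := p
    have e : ∀ A B : Matrix (Fin 5) (Fin 5) ℂ, actDer A (actVar B (Var.xx ⟨(a, b), h⟩)) =
        (∑ k, ((A * B) k a • xx k b + (A * B) k b • xx a k)) +
          ∑ i, ∑ k, ((B i a * A k b) • xx i k + (B k b * A i a) • xx i k) := by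
      intro A B
      simp only [actVar, map_sum, map_add, Derivation.map_smul, actDer_xx, Matrix.mul_apply,
        Finset.sum_smul, Finset.smul_sum, smul_smul, smul_add, Finset.sum_add_distrib]
      rw [Finset.sum_comm (f := fun i k => (B i a * A k i) • xx k b),
        Finset.sum_comm (f := fun i k => (B i b * A k a) • xx k i),
        Finset.sum_comm (f := fun i k => (B i b * A k i) • xx a k)]
      simp only [mul_comm (B _ _) (A _ _)]
      abel
    rw [e, e]
    simp only [actVar, Matrix.sub_apply, sub_smul, Finset.sum_sub_distrib, Finset.sum_add_distrib,
      mul_comm (A _ _) (B _ _)]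
    abel
  | xxd p =>
    obtain ⟨⟨a, b⟩, h⟩ := p
    have e : ∀ A B : Matrix (Fin 5) (Fin 5) ℂ, actDer A (actVar B (Var.xxd ⟨(a, b), h⟩)) =
        (∑ k, ((B * A) a k • xxd k b + (B * A) b k • xxd a k)) +
          ∑ i, ∑ k, ((B a i * A b k) • xxd i k + (B b k * A a i) • xxd i k) := by
      intro A B
      simp only [actVar, map_sum, map_add, map_neg, Derivation.map_smul, actDer_xxd,
        Matrix.mul_apply, Finset.sum_smul, Finset.smul_sum, smul_smul, smul_add, smul_neg,
        Finset.sum_add_distrib, Finset.sum_neg_distrib, neg_add, neg_neg]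
      rw [Finset.sum_comm (f := fun i k => (B a i * A i k) • xxd k b),
        Finset.sum_comm (f := fun i k => (B b i * A a k) • xxd k i),
        Finset.sum_comm (f := fun i k => (B b i * A i k) • xxd a k)]
      abel
    rw [e, e]
    simp only [actVar, Matrix.sub_apply, sub_smul, Finset.sum_sub_distrib, Finset.sum_add_distrib,
      mul_comm (A _ _) (B _ _)]
    abel

/-- The representation of `sl_5` on `P`, as a homomorphism of Lie algebras. -/
def slRep : sl5 →ₗ⁅ℂ⁆ Derivation ℂ P P where
  toFun A := actDer A.mat
  map_add' A B := by
    refine MvPolynomial.derivation_ext fun v => ?_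
    rw [Derivation.add_apply]
    simp only [actDer_X, map_add]
    cases v <;>
      simp only [actVar, Matrix.add_apply, add_smul, Finset.sum_add_distrib] <;> abel
  map_smul' c A := by
    refine MvPolynomial.derivation_ext fun v => ?_
    rw [Derivation.smul_apply]
    simp only [actDer_X, map_smul]
    cases v <;>
      simp only [actVar, Matrix.smul_apply, smul_eq_mul, mul_smul, Finset.smul_sum, smul_add,
        smul_neg, RingHom.id_apply]
  map_lie' := by
    intro A B
    refine MvPolynomial.derivation_ext fun v => ?_
    rw [Derivation.commutator_apply, sl5.mat_lie]
    simp only [actDer_X]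
    exact actVar_comm A.mat B.mat v

instance : LieRingModule sl5 P := LieRingModule.compLieHom P slRep

instance : LieModule ℂ sl5 P := LieModule.compLieHom P slRep

/-- The highest weight vector `x_1^a x_12^b (x_45^*)^c (x_5^*)^d`, where `λ = (a,b,c,d)`. -/
def hw (lam : Fin 4 → ℕ) : P :=
  MvPolynomial.X (Var.x 0) ^ lam 0 * xx 0 1 ^ lam 1 * xxd 3 4 ^ lam 2 *
    MvPolynomial.X (Var.xd 4) ^ lam 3

/-- The irreducible `sl_5`-module `F(λ)`: the submodule of
`Sym^a(ℂ^5) ⊗ Sym^b(⋀²ℂ^5) ⊗ Sym^c((⋀²ℂ^5)^*) ⊗ Sym^d((ℂ^5)^*)` generated by the highest weight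
vector. -/
def F (lam : Fin 4 → ℕ) : LieSubmodule ℂ sl5 P := LieSubmodule.lieSpan ℂ sl5 {hw lam}

/-- The minimal Verma module `M(λ) = M(F(λ))`. -/
abbrev M (lam : Fin 4 → ℕ) : Type := Verma (F lam)

/-! ### The morphisms of degree one -/

/-- `φ : M(λ) → M(μ)` is the morphism associated with
`Φ = ∑_{i<j} d_ij ⊗ θ_ij`, `θ_ij ∈ Hom(F(λ), F(μ))`. -/
def IsAssociated {lam mu : Fin 4 → ℕ} (θ : Pair → (F lam →ₗ[ℂ] F mu)) (φ : M lam →ₗ[U] M mu) :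
    Prop :=
  ∀ v : F lam, φ (vmk 1 v) = ∑ p : Pair, vmk (toU (dForm p.1.1 p.1.2)) (θ p v)

/-- `φ` is `∇_A : M(m,n+1,0,0) → M(m,n,0,0)`, the morphism associated with
`∑_{i<j} d_ij ⊗ ∂/∂x_ij`. -/
def IsNablaA {lam mu : Fin 4 → ℕ} (φ : M lam →ₗ[U] M mu) : Prop :=
  ∃ m n : ℕ, lam = ![m, n + 1, 0, 0] ∧ mu = ![m, n, 0, 0] ∧
    ∃ θ : Pair → (F lam →ₗ[ℂ] F mu),
      (∀ p v, (θ p v : P) = MvPolynomial.pderiv (Var.xx p) (v : P)) ∧ IsAssociated θ φ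

/-- `φ` is `∇_B : M(m+1,0,0,n) → M(m,0,0,n+1)`, the morphism associated with
`∑_{i<j} d_ij ⊗ (x_i^* ∂/∂x_j - x_j^* ∂/∂x_i)`. -/
def IsNablaB {lam mu : Fin 4 → ℕ} (φ : M lam →ₗ[U] M mu) : Prop :=
  ∃ m n : ℕ, lam = ![m + 1, 0, 0, n] ∧ mu = ![m, 0, 0, n + 1] ∧
    ∃ θ : Pair → (F lam →ₗ[ℂ] F mu),
      (∀ p v, (θ p v : P) =
        MvPolynomial.X (Var.xd p.1.1) * MvPolynomial.pderiv (Var.x p.1.2) (v : P) -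
          MvPolynomial.X (Var.xd p.1.2) * MvPolynomial.pderiv (Var.x p.1.1) (v : P)) ∧
        IsAssociated θ φ

/-- `φ` is `∇_C : M(0,0,m,n) → M(0,0,m+1,n)`, the morphism associated with
`∑_{i<j} d_ij ⊗ x_ij^*`. Here `x_ij^*` acts by multiplication followed by the `sl_5`-equivariant
projection `π` of the symmetric tensors onto their irreducible component `F(0,0,m+1,n)`; this
amounts to multiplying in the quotient `F(n,m+1,0,0)^*` of
`Sym^{m+1}((⋀²ℂ^5)^*) ⊗ Sym^n((ℂ^5)^*)`. -/
def IsNablaC {lam mu : Fin 4 → ℕ} (φ : M lam →ₗ[U] M mu) : Prop :=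
  ∃ m n : ℕ, lam = ![0, 0, m, n] ∧ mu = ![0, 0, m + 1, n] ∧
    ∃ π : P →ₗ⁅ℂ, sl5⁆ F mu, (∀ v : F mu, π (v : P) = v) ∧
      ∃ θ : Pair → (F lam →ₗ[ℂ] F mu),
        (∀ p v, θ p v = π (MvPolynomial.X (Var.xxd p) * (v : P))) ∧ IsAssociated θ φ

end E510

end

set_option linter.unusedSimpArgs false
set_option linter.unusedSectionVars false

open scoped TensorProduct

noncomputable section

namespace E510

/-! A morphism out of `M(λ)` is determined by the image of the highest weight vector, and this image
is a singular vector: raising operators kill it, it has weight `λ`, and the forms `x_i d_jk + x_j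
d_ik` of `L_1` kill it. The theorem is therefore a classification of singular vectors of degree two,
followed by the identification of each one with a composite of the known morphisms of degree one.

Since two elements of `L_{-1}` anticommute up to `L_{-2}`, a vector of degree two can be written as
`∑ d_ab d_cd ⊗ w_abcd + ∑ ∂_t ⊗ u_t` with `w` alternating in its two pairs (`mem_vermaDeg_two`), and
`w`, `u` are then unique (`vec2_injective`). Uniqueness is a fragment of the Poincaré–Birkhoff–Witt
theorem. It is obtained by letting `L` act on `NegAlg ⊗ V`, where `NegAlg` is presented by
generators and relations: `Hom(L, NegAlg ⊗ V)` is made into a `NegAlg`-module, the orbit maps `x ↦ x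
n` are obtained by extending their values at `1 ⊗ v` linearly over `NegAlg`, and the relations of
`U(L)` are propagated by Jacobi identities (`mem_relSubmodule`). A representation of `NegAlg` on its
truncation in degrees at most two then separates the coefficients.

The equations for `w` and `u` have values in `F(μ)`. They become numerical after pairing with the
highest weight vector of `F(μ)` in the Fischer form, which is contravariant: lowering operators
disappear, diagonal ones give the weight `μ`, and raising ones can be shifted to the indices because
the vector is singular (`hwForm_actDer_single`). What remains is a linear system for numbers
`c_abcd`, `u_t` with coefficients depending on `μ` (`isSingular_hwForm`). Nothing is lost: if these
numbers vanish, so does the vector (`eq_zero_of_hwForm`).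

The system forces everything to vanish once the three numbers `c_0434`, `c_0104`, `c_0134` do
(`IsSingular.eq_zero`). If one of the three is nonzero, the equations fix `μ` up to at most one free
parameter, and comparison of weights fixes `λ` (`IsSingular.repeated_four`,
`IsSingular.repeated_zero`, `IsSingular.without_two`, `IsSingular.weights`). These are the three
cases. In each of them the other two distinguished numbers vanish, so morphisms of degree two form a
space of dimension at most one.

It remains to produce a nonzero element. An equivariant family `θ_ab` defines a morphism of degree
one as soon as its `obstruction` is alternating on the highest weight vector
(`exists_isAssociated`). This is checked for the three families; for `∇_C` it uses the Plücker
relations satisfied by the elements of `F(μ)`. The composite has a nonzero distinguished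
coefficient, and subtracting a suitable multiple of it from `φ` leaves zero (`eq_smul_of_coeff`). -/

/-! ### The Levi-Civita symbol and explicit brackets -/

/-- The Levi-Civita symbol in five indices, as a product of signs of differences. -/
def levi (i j k l t : Fin 5) : ℤ :=
  let s : Fin 5 → Fin 5 → ℤ := fun a b => if a < b then 1 else if b < a then -1 else 0
  s i j * s i k * s i l * s i t * s j k * s j l * s j t * s k l * s k t * s l t

set_option maxRecDepth 100000 in
lemma levi_skew_left : ∀ i j k l t : Fin 5, levi i j k l t = - levi j i k l t := by decide

set_option maxRecDepth 100000 in
lemma levi_skew_right : ∀ i j k l t : Fin 5, levi i j k l t = - levi i j l k t := by decide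

set_option maxRecDepth 100000 in
lemma levi_symm : ∀ i j k l t : Fin 5, levi i j k l t = levi k l i j t := by decide

set_option maxRecDepth 100000 in
lemma levi_perm : ∀ σ : Equiv.Perm (Fin 5),
    levi (σ 0) (σ 1) (σ 2) (σ 3) (σ 4) = (Equiv.Perm.sign σ : ℤ) := by decide

set_option maxRecDepth 100000 in
lemma levi_eq_zero : ∀ i j k l t : Fin 5, (i = j ∨ i = k ∨ i = l ∨ i = t ∨ j = k ∨ j = l ∨ j = t ∨
    k = l ∨ k = t ∨ l = t) → levi i j k l t = 0 := by decide

lemma levi_of_not_injective (f : Fin 5 → Fin 5) (hf : ¬ Function.Injective f) :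
    levi (f 0) (f 1) (f 2) (f 3) (f 4) = 0 := by
  apply levi_eq_zero
  by_contra h
  apply hf
  intro a b hab
  fin_cases a <;> fin_cases b <;> simp_all

/-- The symbol vanishes on repeated indices, so a signed sum over permutations extends to all index
maps. Nested sums can then be handled one index at a time. -/
lemma sum_perm_eq_sum_levi {R : Type*} [CommRing R] (g : (Fin 5 → Fin 5) → R) :
    ∑ σ : Equiv.Perm (Fin 5), ((Equiv.Perm.sign σ : ℤ) : R) * g σ =
      ∑ f : Fin 5 → Fin 5, (levi (f 0) (f 1) (f 2) (f 3) (f 4) : R) * g f := by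
  refine Finset.sum_of_injOn (fun σ => (σ : Fin 5 → Fin 5)) ?_ ?_ ?_ ?_
  · intro a _ b _ h
    exact DFunLike.coe_injective h
  · intro _ _; simp
  · intro f _ hf
    rw [levi_of_not_injective f, Int.cast_zero, zero_mul]
    intro hinj
    apply hf
    refine ⟨Equiv.ofBijective f (Finite.injective_iff_bijective.mp hinj), by simp, rfl⟩
  · intro σ _
    rw [levi_perm]

lemma sum_fin_fun_five {M : Type*} [AddCommMonoid M] (g : Fin 5 → Fin 5 → Fin 5 → Fin 5 → Fin 5 → M) :
    ∑ f : Fin 5 → Fin 5, g (f 0) (f 1) (f 2) (f 3) (f 4) =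
      ∑ t, ∑ i, ∑ j, ∑ k, ∑ l, g i j k l t := by
  let e : (Fin 5 → Fin 5) ≃ Fin 5 × Fin 5 × Fin 5 × Fin 5 × Fin 5 :=
    { toFun := fun f => (f 4, f 0, f 1, f 2, f 3)
      invFun := fun p => ![p.2.1, p.2.2.1, p.2.2.2.1, p.2.2.2.2, p.1]
      left_inv := fun f => by ext i; fin_cases i <;> rfl
      right_inv := fun p => rfl }
  refine (Fintype.sum_equiv e _ (fun p => g p.2.1 p.2.2.1 p.2.2.2.1 p.2.2.2.2 p.1)
    (fun f => rfl)).trans ?_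
  simp only [Fintype.sum_prod_type]

lemma formBracket_eq_sum_levi (ω η : Fin 5 → Fin 5 → PS) (t : Fin 5) :
    formBracket ω η t =
      (1 / 4 : ℂ) • ∑ i, ∑ j, ∑ k, ∑ l, (levi i j k l t : PS) * (ω i j * η k l) := by
  rw [formBracket]
  congr 1
  have h := sum_perm_eq_sum_levi (R := PS)
    (fun f => if f 4 = t then ω (f 0) (f 1) * η (f 2) (f 3) else 0)
  simp only [mul_ite, mul_zero] at h
  rw [h, sum_fin_fun_five (fun i j k l s => if s = t then
    (levi i j k l s : PS) * (ω i j * η k l) else 0), Finset.sum_eq_single t]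
  · simp
  · intro b _ hb
    simp [hb]
  · simp

lemma sum_sum_of_symm {R : Type*} [CommRing R] (g : Fin 5 → Fin 5 → R) (h : ∀ i j, g i j = g j i)
    (h0 : ∀ i, g i i = 0) : ∑ i, ∑ j, g i j = 2 * (g 0 1 + g 0 2 + g 0 3 + g 0 4 + g 1 2 + g 1 3 +
      g 1 4 + g 2 3 + g 2 4 + g 3 4) := by
  simp only [Fin.sum_univ_five, h0, h 1 0, h 2 0, h 3 0, h 4 0, h 2 1, h 3 1, h 4 1, h 3 2, h 4 2,
    h 4 3]
  ring

lemma quarter_smul_four_mul (x : PS) : (1 / 4 : ℂ) • (4 * x) = x := by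
  rw [← map_ofNat (MvPowerSeries.C : ℂ →+* PS) 4, ← MvPowerSeries.smul_eq_C_mul, smul_smul]
  norm_num

lemma self_eq_zero_of_skew {ω : Fin 5 → Fin 5 → PS} (hω : ∀ i j, ω i j = - ω j i) (i : Fin 5) :
    ω i i = 0 := by
  have h := hω i i
  have h2 : (2 : ℂ) • ω i i = 0 := by rw [two_smul]; nth_rewrite 1 [h]; simp
  simpa using h2

/-- Each unordered pair is counted twice in either form, and the resulting 4 cancels the factor 1/4
of the definition. -/
lemma formBracket_eq_sum_levi_pairs {ω η : Fin 5 → Fin 5 → PS} (hω : ∀ i j, ω i j = - ω j i)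
    (hη : ∀ i j, η i j = - η j i) (t : Fin 5) :
    let s : (Fin 5 → Fin 5 → PS) → PS := fun g => g 0 1 + g 0 2 + g 0 3 + g 0 4 + g 1 2 + g 1 3 +
      g 1 4 + g 2 3 + g 2 4 + g 3 4
    formBracket ω η t = s fun i j => s fun k l => (levi i j k l t : PS) * (ω i j * η k l) := by
  intro s
  rw [formBracket_eq_sum_levi]
  have h2 : ∀ i j, ∑ k, ∑ l, (levi i j k l t : PS) * (ω i j * η k l) =
      2 * s fun k l => (levi i j k l t : PS) * (ω i j * η k l) := fun i j =>
    sum_sum_of_symm _ (fun k l => by rw [hη k l, levi_skew_right]; push_cast; ring)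
      (fun k => by rw [self_eq_zero_of_skew hη]; ring)
  rw [sum_sum_of_symm]
  · simp only [h2]
    refine Eq.trans ?_ (quarter_smul_four_mul _)
    congr 1
    simp only [s]
    ring
  · intro i j
    refine Finset.sum_congr rfl fun k _ => Finset.sum_congr rfl fun l _ => ?_
    rw [hω i j, levi_skew_left]; push_cast; ring
  · intro i
    simp [self_eq_zero_of_skew hω]

/-- Up to the sign `(-1)^t`, component `t` is the coefficient of `ω ∧ η` on the four indices other
than `t`. The expansion turns the Jacobi identities into polynomial identities. -/
lemma formBracket_explicit {ω η : Fin 5 → Fin 5 → PS} (hω : ∀ i j, ω i j = - ω j i)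
    (hη : ∀ i j, η i j = - η j i) :
    formBracket ω η 0 = ω 1 2 * η 3 4 - ω 1 3 * η 2 4 + ω 1 4 * η 2 3 + ω 2 3 * η 1 4
      - ω 2 4 * η 1 3 + ω 3 4 * η 1 2 ∧
    formBracket ω η 1 = -(ω 0 2 * η 3 4 - ω 0 3 * η 2 4 + ω 0 4 * η 2 3 + ω 2 3 * η 0 4
      - ω 2 4 * η 0 3 + ω 3 4 * η 0 2) ∧
    formBracket ω η 2 = ω 0 1 * η 3 4 - ω 0 3 * η 1 4 + ω 0 4 * η 1 3 + ω 1 3 * η 0 4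
      - ω 1 4 * η 0 3 + ω 3 4 * η 0 1 ∧
    formBracket ω η 3 = -(ω 0 1 * η 2 4 - ω 0 2 * η 1 4 + ω 0 4 * η 1 2 + ω 1 2 * η 0 4
      - ω 1 4 * η 0 2 + ω 2 4 * η 0 1) ∧
    formBracket ω η 4 = ω 0 1 * η 2 3 - ω 0 2 * η 1 3 + ω 0 3 * η 1 2 + ω 1 2 * η 0 3
      - ω 1 3 * η 0 2 + ω 2 3 * η 0 1 := by
  refine ⟨?_, ?_, ?_, ?_, ?_⟩ <;>
  · rw [formBracket_eq_sum_levi_pairs hω hη]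
    simp [levi]
    try ring

/-! ### Bilinearity of the bracket -/

lemma vfBracket_add_left (X Y Z : Fin 5 → PS) :
    vfBracket (X + Y) Z = vfBracket X Z + vfBracket Y Z := by
  ext1 i
  simp only [vfBracket, Pi.add_apply, map_add, ← Finset.sum_add_distrib]
  exact Finset.sum_congr rfl fun m _ => by ring

lemma vfBracket_smul_left (c : ℂ) (X Z : Fin 5 → PS) :
    vfBracket (c • X) Z = c • vfBracket X Z := by
  ext1 i
  simp only [vfBracket, Pi.smul_apply, Derivation.map_smul, Finset.smul_sum, smul_sub,
    smul_mul_assoc, mul_smul_comm]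

lemma vfBracket_skew (X Y : Fin 5 → PS) : vfBracket X Y = - vfBracket Y X := by
  ext1 i
  simp only [vfBracket, Pi.neg_apply, ← Finset.sum_neg_distrib, neg_sub]

lemma sum_four_comm {M : Type*} [AddCommMonoid M] (g : Fin 5 → Fin 5 → Fin 5 → Fin 5 → M) :
    ∑ i, ∑ j, ∑ k, ∑ l, g i j k l = ∑ k, ∑ l, ∑ i, ∑ j, g i j k l := by
  have h := Finset.sum_comm (s := Finset.univ) (t := Finset.univ)
    (f := fun (p q : Fin 5 × Fin 5) => g p.1 p.2 q.1 q.2)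
  simpa only [Fintype.sum_prod_type] using h

lemma formBracket_comm (ω η : Fin 5 → Fin 5 → PS) : formBracket ω η = formBracket η ω := by
  refine funext fun t => ?_
  rw [formBracket_eq_sum_levi, formBracket_eq_sum_levi η ω t]
  have h := sum_four_comm fun i j k l => (levi i j k l t : PS) * (ω i j * η k l)
  rw [h]
  have h2 : ∀ i j k l, (levi k l i j t : PS) * (ω k l * η i j) =
    (levi i j k l t : PS) * (η i j * ω k l) := fun i j k l => by
    rw [levi_symm, mul_comm (ω _ _)]
  simp only [h2]

lemma formBracket_add_left (ω η ξ : Fin 5 → Fin 5 → PS) :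
    formBracket (ω + η) ξ = formBracket ω ξ + formBracket η ξ := by
  ext1 t
  simp only [formBracket, Pi.add_apply, ← smul_add, ← Finset.sum_add_distrib]
  congr 1
  refine Finset.sum_congr rfl fun σ _ => ?_
  split_ifs
  · ring
  · simp

lemma formBracket_smul_left (c : ℂ) (ω ξ : Fin 5 → Fin 5 → PS) :
    formBracket (c • ω) ξ = c • formBracket ω ξ := by
  ext1 t
  simp only [formBracket, Pi.smul_apply, smul_comm c, Finset.smul_sum, smul_ite, smul_zero,
    smul_mul_assoc, mul_smul_comm]

lemma lieDeriv_add_left (X Y : Fin 5 → PS) (ω : Fin 5 → Fin 5 → PS) :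
    lieDeriv (X + Y) ω = lieDeriv X ω + lieDeriv Y ω := by
  ext1 i; ext1 j
  simp only [lieDeriv, Pi.add_apply, map_add, ← Finset.sum_add_distrib]
  exact Finset.sum_congr rfl fun m _ => by ring

lemma lieDeriv_smul_left (c : ℂ) (X : Fin 5 → PS) (ω : Fin 5 → Fin 5 → PS) :
    lieDeriv (c • X) ω = c • lieDeriv X ω := by
  ext1 i; ext1 j
  simp only [lieDeriv, Pi.smul_apply, Derivation.map_smul, Finset.smul_sum, smul_add,
    smul_mul_assoc]

lemma lieDeriv_add_right (X : Fin 5 → PS) (ω η : Fin 5 → Fin 5 → PS) :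
    lieDeriv X (ω + η) = lieDeriv X ω + lieDeriv X η := by
  ext1 i; ext1 j
  simp only [lieDeriv, Pi.add_apply, map_add, ← Finset.sum_add_distrib]
  exact Finset.sum_congr rfl fun m _ => by ring

lemma lieDeriv_smul_right (c : ℂ) (X : Fin 5 → PS) (ω : Fin 5 → Fin 5 → PS) :
    lieDeriv X (c • ω) = c • lieDeriv X ω := by
  ext1 i; ext1 j
  simp only [lieDeriv, Pi.smul_apply, Derivation.map_smul, Finset.smul_sum, smul_add,
    mul_smul_comm]

lemma vfBracket_add_right (X Y Z : Fin 5 → PS) :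
    vfBracket X (Y + Z) = vfBracket X Y + vfBracket X Z := by
  rw [vfBracket_skew, vfBracket_add_left, vfBracket_skew Y, vfBracket_skew Z]; abel

lemma vfBracket_smul_right (c : ℂ) (X Z : Fin 5 → PS) :
    vfBracket X (c • Z) = c • vfBracket X Z := by
  rw [vfBracket_skew, vfBracket_smul_left, vfBracket_skew Z, smul_neg, neg_neg]

lemma formBracket_add_right (ω η ξ : Fin 5 → Fin 5 → PS) :
    formBracket ω (η + ξ) = formBracket ω η + formBracket ω ξ := by
  rw [formBracket_comm, formBracket_add_left, formBracket_comm η, formBracket_comm ξ]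

lemma formBracket_smul_right (c : ℂ) (ω ξ : Fin 5 → Fin 5 → PS) :
    formBracket ω (c • ξ) = c • formBracket ω ξ := by
  rw [formBracket_comm, formBracket_smul_left, formBracket_comm ω]

/-- The bracket of `E(5,10)` as a bilinear map. -/
def bracketL : L →ₗ[ℂ] L →ₗ[ℂ] L :=
  LinearMap.mk₂ ℂ bracket
    (fun x y z => Subtype.ext (by
      simp only [bracket, ambientBracket, Submodule.coe_add, Prod.fst_add, Prod.snd_add,
        vfBracket_add_left, formBracket_add_left, lieDeriv_add_left, lieDeriv_add_right,
        Prod.mk_add_mk]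
      congr 1 <;> abel))
    (fun c x y => Subtype.ext (by
      simp only [bracket, ambientBracket, Submodule.coe_smul, Prod.smul_fst, Prod.smul_snd,
        vfBracket_smul_left, formBracket_smul_left, lieDeriv_smul_left, lieDeriv_smul_right,
        Prod.smul_mk, smul_add, smul_sub]))
    (fun x y z => Subtype.ext (by
      simp only [bracket, ambientBracket, Submodule.coe_add, Prod.fst_add, Prod.snd_add,
        vfBracket_add_right, formBracket_add_right, lieDeriv_add_left, lieDeriv_add_right,
        Prod.mk_add_mk]
      congr 1 <;> abel))
    (fun c x y => Subtype.ext (by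
      simp only [bracket, ambientBracket, Submodule.coe_smul, Prod.smul_fst, Prod.smul_snd,
        vfBracket_smul_right, formBracket_smul_right, lieDeriv_smul_left, lieDeriv_smul_right,
        Prod.smul_mk, smul_add, smul_sub]))

lemma bracket_add_left (x y z : L) : bracket (x + y) z = bracket x z + bracket y z :=
  bracketL.map_add₂ x y z

lemma bracket_smul_left (c : ℂ) (x z : L) : bracket (c • x) z = c • bracket x z :=
  bracketL.map_smul₂ c x z

lemma bracket_add_right (x y z : L) : bracket x (y + z) = bracket x y + bracket x z :=
  (bracketL x).map_add y z

lemma bracket_smul_right (c : ℂ) (x z : L) : bracket x (c • z) = c • bracket x z :=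
  (bracketL x).map_smul c z

/-! ### Jacobi identities on components -/

lemma lieDeriv_vfBracket (X Y : Fin 5 → PS) (ω : Fin 5 → Fin 5 → PS) :
    lieDeriv (vfBracket X Y) ω = lieDeriv X (lieDeriv Y ω) - lieDeriv Y (lieDeriv X ω) := by
  ext1 i; ext1 j
  simp only [lieDeriv, vfBracket, Pi.sub_apply, map_add, map_sub, Derivation.leibniz,
    smul_eq_mul, Fin.sum_univ_five]
  simp only [D_comm i 0, D_comm i 1, D_comm i 2, D_comm i 3, D_comm i 4, D_comm j 0, D_comm j 1,
    D_comm j 2, D_comm j 3, D_comm j 4, D_comm 1 0, D_comm 2 0, D_comm 3 0, D_comm 4 0, D_comm 2 1,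
    D_comm 3 1, D_comm 4 1, D_comm 3 2, D_comm 4 2, D_comm 4 3]
  ring

-- The bracket of two forms is the vector field dual to the four-form `ω ∧ η` under the volume form.
-- The Lie derivative respects this duality up to a multiple of the divergence of `X`, which is why
-- `X` has to be divergence-free.
set_option linter.unusedSimpArgs false in
lemma vfBracket_formBracket {X : Fin 5 → PS} (hX : div X = 0) {ω η : Fin 5 → Fin 5 → PS}
    (hω : ∀ i j, ω i j = - ω j i) (hη : ∀ i j, η i j = - η j i) :
    vfBracket X (formBracket ω η) =
      formBracket (lieDeriv X ω) η + formBracket ω (lieDeriv X η) := by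
  obtain ⟨a0, a1, a2, a3, a4⟩ := formBracket_explicit hω hη
  obtain ⟨b0, b1, b2, b3, b4⟩ := formBracket_explicit (lieDeriv_skew X hω) hη
  obtain ⟨c0, c1, c2, c3, c4⟩ := formBracket_explicit hω (lieDeriv_skew X hη)
  have w0 := self_eq_zero_of_skew hω
  have e0 := self_eq_zero_of_skew hη
  simp only [div, Fin.sum_univ_five] at hX
  -- With the divergence term added, the identity holds for arbitrary `X` and is purely polynomial.
  have key : ∀ t, formBracket ω η t * (D 0 (X 0) + D 1 (X 1) + D 2 (X 2) + D 3 (X 3) + D 4 (X 4)) +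
      vfBracket X (formBracket ω η) t =
      formBracket (lieDeriv X ω) η t + formBracket ω (lieDeriv X η) t := by
    intro t
    fin_cases t <;>
    · simp only [vfBracket, Fin.sum_univ_five, Fin.zero_eta, Fin.mk_one, Fin.reduceFinMk, a0, a1,
        a2, a3, a4, b0, b1, b2, b3, b4, c0, c1, c2, c3, c4, lieDeriv, w0, e0, map_add, map_sub,
        map_neg, Derivation.leibniz, smul_eq_mul, hω 1 0, hω 2 0, hω 3 0, hω 4 0, hω 2 1, hω 3 1,
        hω 4 1, hω 3 2, hω 4 2, hω 4 3, hη 1 0, hη 2 0, hη 3 0, hη 4 0, hη 2 1, hη 3 1, hη 4 1,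
        hη 3 2, hη 4 2, hη 4 3]
      ring
  ext1 t
  have := key t
  rw [hX, mul_zero, zero_add] at this
  rw [this, Pi.add_apply]

lemma formBracket_contract {ω η ξ : Fin 5 → Fin 5 → PS} (hω : ∀ i j, ω i j = - ω j i)
    (hη : ∀ i j, η i j = - η j i) (hξ : ∀ i j, ξ i j = - ξ j i) (j : Fin 5) :
    ∑ t, formBracket ω η t * ξ t j + ∑ t, formBracket η ξ t * ω t j +
      ∑ t, formBracket ξ ω t * η t j = 0 := by
  obtain ⟨a0, a1, a2, a3, a4⟩ := formBracket_explicit hω hη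
  obtain ⟨b0, b1, b2, b3, b4⟩ := formBracket_explicit hη hξ
  obtain ⟨c0, c1, c2, c3, c4⟩ := formBracket_explicit hξ hω
  have w0 := self_eq_zero_of_skew hω
  have e0 := self_eq_zero_of_skew hη
  have x0 := self_eq_zero_of_skew hξ
  fin_cases j <;>
  · simp only [Fin.sum_univ_five, Fin.zero_eta, Fin.mk_one, Fin.reduceFinMk, a0, a1,
      a2, a3, a4, b0, b1, b2, b3, b4, c0, c1, c2, c3, c4, w0, e0, x0, hω 1 0, hω 2 0, hω 3 0,
      hω 4 0, hω 2 1, hω 3 1, hω 4 1, hω 3 2, hω 4 2, hω 4 3, hη 1 0, hη 2 0, hη 3 0, hη 4 0,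
      hη 2 1, hη 3 1, hη 4 1, hη 3 2, hη 4 2, hη 4 3, hξ 1 0, hξ 2 0, hξ 3 0, hξ 4 0, hξ 2 1,
      hξ 3 1, hξ 4 1, hξ 3 2, hξ 4 2, hξ 4 3]
    ring

/-- Cartan's formula: of `d ι_X + ι_X d` only the first term survives on a closed form. -/
lemma lieDeriv_eq_of_closed (X : Fin 5 → PS) {ω : Fin 5 → Fin 5 → PS}
    (ha : ∀ i j, ω i j = - ω j i) (hω : ∀ i j k, extD ω i j k = 0) (i j : Fin 5) :
    lieDeriv X ω i j = D i (∑ m, X m * ω m j) - D j (∑ m, X m * ω m i) := by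
  simp only [lieDeriv, map_sum, Derivation.leibniz, smul_eq_mul, ← Finset.sum_sub_distrib]
  refine Finset.sum_congr rfl fun m _ => ?_
  have h := hω m i j
  simp only [extD] at h
  rw [ha j m, map_neg] at h
  rw [ha i m]
  linear_combination X m * h

/-- By Cartan's formula this is the exterior derivative of the one-form identity
`formBracket_contract`. -/
lemma lieDeriv_formBracket_cyclic {ω η ξ : Fin 5 → Fin 5 → PS} (hω : ∀ i j, ω i j = - ω j i)
    (hη : ∀ i j, η i j = - η j i) (hξ : ∀ i j, ξ i j = - ξ j i)
    (cω : ∀ i j k, extD ω i j k = 0) (cη : ∀ i j k, extD η i j k = 0)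
    (cξ : ∀ i j k, extD ξ i j k = 0) :
    lieDeriv (formBracket ω η) ξ + lieDeriv (formBracket η ξ) ω + lieDeriv (formBracket ξ ω) η
      = 0 := by
  ext1 i; ext1 j
  simp only [Pi.add_apply, lieDeriv_eq_of_closed _ hξ cξ, lieDeriv_eq_of_closed _ hω cω,
    lieDeriv_eq_of_closed _ hη cη, Pi.zero_apply]
  have h1 := congrArg (D i) (formBracket_contract hω hη hξ j)
  have h2 := congrArg (D j) (formBracket_contract hω hη hξ i)
  rw [map_add, map_add, map_zero] at h1 h2
  linear_combination h1 - h2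

/-! ### Special elements and the Jacobi identity -/

lemma skew_snd (x : L) (i j : Fin 5) : x.1.2 i j = - x.1.2 j i := x.2.2.1 i j

/-- The constant vector field `∂_t`. -/
def dV (t : Fin 5) : L :=
  ⟨(fun i => MvPowerSeries.C (if i = t then 1 else 0), 0), by
    refine ⟨Finset.sum_eq_zero fun i _ => MvPowerSeries.pderiv_C, by simp, by simp [extD]⟩⟩

/-- The parity automorphism of `L`. -/
def parity : L →ₗ[ℂ] L where
  toFun x := ⟨(x.1.1, - x.1.2), x.2.1, fun i j => by
      simp only [Pi.neg_apply]; rw [x.2.2.1 i j], fun i j k => by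
      have := x.2.2.2 i j k
      simp only [extD, Pi.neg_apply, map_neg] at *
      linear_combination -this⟩
  map_add' x y := Subtype.ext (Prod.ext rfl (neg_add _ _))
  map_smul' c x := Subtype.ext (Prod.ext rfl (smul_neg _ _).symm)

/-- The even part of an element of `L`. -/
def evenPart : L →ₗ[ℂ] L where
  toFun x := ⟨(x.1.1, 0), x.2.1, by simp, by simp [extD]⟩
  map_add' x y := Subtype.ext (Prod.ext rfl (add_zero _).symm)
  map_smul' c x := Subtype.ext (Prod.ext rfl (smul_zero _).symm)

/-- The odd part of an element of `L`. -/
def oddPart : L →ₗ[ℂ] L where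
  toFun x := ⟨(0, x.1.2), by simp [div], x.2.2.1, x.2.2.2⟩
  map_add' x y := Subtype.ext (Prod.ext (add_zero _).symm rfl)
  map_smul' c x := Subtype.ext (Prod.ext (smul_zero _).symm rfl)

lemma evenPart_add_oddPart (x : L) : evenPart x + oddPart x = x :=
  Subtype.ext (Prod.ext (by simp [evenPart, oddPart]) (by simp [evenPart, oddPart]))

lemma isEven_evenPart (x : L) : IsEven (evenPart x) := rfl

lemma isOdd_oddPart (x : L) : IsOdd (oddPart x) := rfl

lemma isOdd_dForm (i j : Fin 5) : IsOdd (dForm i j) := rfl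

lemma isEven_dV (t : Fin 5) : IsEven (dV t) := rfl

lemma IsEven.parity {x : L} (h : IsEven x) : parity x = x := by
  refine Subtype.ext (Prod.ext rfl ?_)
  change -x.1.2 = x.1.2
  rw [show x.1.2 = 0 from h, neg_zero]

lemma IsOdd.parity {x : L} (h : IsOdd x) : parity x = -x := by
  refine Subtype.ext (Prod.ext ?_ rfl)
  change x.1.1 = -x.1.1
  rw [show x.1.1 = 0 from h, neg_zero]

lemma vfBracket_zero_left (X : Fin 5 → PS) : vfBracket 0 X = 0 := by
  ext1 i; simp [vfBracket]

lemma vfBracket_zero_right (X : Fin 5 → PS) : vfBracket X 0 = 0 := by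
  ext1 i; simp [vfBracket]

lemma formBracket_zero_left (ω : Fin 5 → Fin 5 → PS) : formBracket 0 ω = 0 := by
  ext1 i; simp [formBracket]

lemma formBracket_zero_right (ω : Fin 5 → Fin 5 → PS) : formBracket ω 0 = 0 := by
  ext1 i; simp [formBracket]

lemma lieDeriv_zero_left (ω : Fin 5 → Fin 5 → PS) : lieDeriv 0 ω = 0 := by
  ext1 i; ext1 j; simp [lieDeriv]

lemma lieDeriv_zero_right (X : Fin 5 → PS) : lieDeriv X 0 = 0 := by
  ext1 i; ext1 j; simp [lieDeriv]

/-- Extensionality by components. -/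
lemma L_ext {x y : L} (h1 : x.1.1 = y.1.1) (h2 : x.1.2 = y.1.2) : x = y :=
  Subtype.ext (Prod.ext h1 h2)

lemma bracket_fst (x y : L) :
    (bracket x y).1.1 = vfBracket x.1.1 y.1.1 + formBracket x.1.2 y.1.2 := rfl

lemma bracket_snd (x y : L) :
    (bracket x y).1.2 = lieDeriv x.1.1 y.1.2 - lieDeriv y.1.1 x.1.2 := rfl

lemma IsEven.bracket_isEven {x y : L} (hx : IsEven x) (hy : IsEven y) : IsEven (bracket x y) := by
  unfold IsEven at *
  rw [bracket_snd, hx, hy, lieDeriv_zero_right, lieDeriv_zero_right, sub_zero]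

lemma IsEven.bracket_isOdd {x y : L} (hx : IsEven x) (hy : IsOdd y) : IsOdd (bracket x y) := by
  unfold IsEven at hx
  unfold IsOdd at *
  rw [bracket_fst, hx, hy, vfBracket_zero_right, formBracket_zero_left, add_zero]

lemma IsOdd.bracket_isEven {x y : L} (hx : IsOdd x) (hy : IsOdd y) : IsEven (bracket x y) := by
  unfold IsOdd at *
  unfold IsEven
  rw [bracket_snd, hx, hy, lieDeriv_zero_left, lieDeriv_zero_left, sub_zero]

lemma IsEven.bracket_skew {x : L} (hx : IsEven x) (y : L) : bracket x y = - bracket y x := by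
  unfold IsEven at hx
  refine L_ext ?_ ?_
  · change _ = -(bracket y x).1.1
    rw [bracket_fst, bracket_fst, hx, formBracket_zero_left, formBracket_zero_right,
      vfBracket_skew, add_zero, add_zero]
  · change _ = -(bracket y x).1.2
    rw [bracket_snd, bracket_snd, neg_sub]

lemma IsOdd.bracket_isOdd {x y : L} (hx : IsOdd x) (hy : IsEven y) : IsOdd (bracket x y) := by
  have h := hy.bracket_isOdd hx
  rw [hy.bracket_skew] at h
  unfold IsOdd at *
  change -(bracket x y).1.1 = 0 at h
  exact neg_eq_zero.mp h

lemma IsOdd.bracket_comm {x y : L} (hx : IsOdd x) (hy : IsOdd y) : bracket x y = bracket y x := by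
  unfold IsOdd at *
  refine L_ext ?_ ?_
  · rw [bracket_fst, bracket_fst, hx, hy, formBracket_comm]
  · rw [bracket_snd, bracket_snd, hx, hy, lieDeriv_zero_left, lieDeriv_zero_left]

/-- The Jacobi identity is needed only when the third argument is odd or constant, because the
action of `L` is built by recursion over words in the `d_ab` and `∂_t`. -/
lemma jacobi_even_even_odd {x y d : L} (hx : IsEven x) (hy : IsEven y) (hd : IsOdd d) :
    bracket (bracket x y) d = bracket x (bracket y d) - bracket y (bracket x d) := by
  unfold IsEven at hx hy
  unfold IsOdd at hd
  refine L_ext ?_ ?_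
  · change _ = (bracket x (bracket y d)).1.1 - (bracket y (bracket x d)).1.1
    simp only [bracket_fst, bracket_snd, hx, hy, hd, vfBracket_zero_right, formBracket_zero_left,
      lieDeriv_zero_right, lieDeriv_zero_left, add_zero, sub_zero]
  · change _ = (bracket x (bracket y d)).1.2 - (bracket y (bracket x d)).1.2
    simp only [bracket_fst, bracket_snd, hx, hy, hd, vfBracket_zero_right, formBracket_zero_left,
      lieDeriv_zero_left, add_zero, sub_zero, lieDeriv_vfBracket]

lemma jacobi_even_odd_odd {x y d : L} (hx : IsEven x) (hy : IsOdd y) (hd : IsOdd d) :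
    bracket (bracket x y) d = bracket x (bracket y d) - bracket (bracket x d) y := by
  unfold IsEven at hx
  unfold IsOdd at hd hy
  refine L_ext ?_ ?_
  · change _ = (bracket x (bracket y d)).1.1 - (bracket (bracket x d) y).1.1
    simp only [bracket_fst, bracket_snd, hx, hy, hd, vfBracket_zero_right, vfBracket_zero_left,
      formBracket_zero_left, lieDeriv_zero_right, lieDeriv_zero_left, add_zero, zero_add, sub_zero,
      vfBracket_formBracket x.2.1 (skew_snd y) (skew_snd d)]
    rw [formBracket_comm (lieDeriv x.1.1 d.1.2)]
    abel
  · change _ = (bracket x (bracket y d)).1.2 - (bracket (bracket x d) y).1.2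
    simp only [bracket_fst, bracket_snd, hx, hy, hd, vfBracket_zero_right, vfBracket_zero_left,
      formBracket_zero_left, lieDeriv_zero_right, lieDeriv_zero_left, add_zero, sub_zero]

lemma jacobi_odd_odd_odd {x y d : L} (hx : IsOdd x) (hy : IsOdd y) (hd : IsOdd d) :
    bracket (bracket x y) d = - bracket (bracket x d) y - bracket (bracket y d) x := by
  unfold IsOdd at hd hy hx
  refine L_ext ?_ ?_
  · change _ = -(bracket (bracket x d) y).1.1 - (bracket (bracket y d) x).1.1
    simp only [bracket_fst, bracket_snd, hx, hy, hd, vfBracket_zero_right, vfBracket_zero_left,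
      formBracket_zero_left, lieDeriv_zero_left, add_zero, zero_add, sub_zero, neg_zero]
  · change _ = -(bracket (bracket x d) y).1.2 - (bracket (bracket y d) x).1.2
    simp only [bracket_fst, bracket_snd, hx, hy, hd, vfBracket_zero_right,
      lieDeriv_zero_right, lieDeriv_zero_left, zero_add, sub_zero]
    have h := lieDeriv_formBracket_cyclic (skew_snd x) (skew_snd y) (skew_snd d) x.2.2.2 y.2.2.2
      d.2.2.2
    rw [formBracket_comm d.1.2 x.1.2] at h
    rw [eq_sub_iff_add_eq, eq_neg_iff_add_eq_zero]
    exact h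

lemma D_dV_fst (t m i : Fin 5) : D m ((dV t).1.1 i) = 0 := MvPowerSeries.pderiv_C

lemma bracket_dV_fst (x : L) (t i : Fin 5) : (bracket x (dV t)).1.1 i = - D t (x.1.1 i) := by
  rw [bracket_fst, show (dV t).1.2 = 0 from rfl, formBracket_zero_right, add_zero]
  simp only [vfBracket, D_dV_fst, mul_zero, zero_sub]
  rw [Finset.sum_eq_single t]
  · simp [dV]
  · intro b _ hb; simp [dV, hb]
  · simp

lemma bracket_dV_snd (x : L) (t i j : Fin 5) :
    (bracket x (dV t)).1.2 i j = - D t (x.1.2 i j) := by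
  rw [bracket_snd, show (dV t).1.2 = 0 from rfl, lieDeriv_zero_right, zero_sub]
  simp only [lieDeriv, D_dV_fst, zero_mul, add_zero, Pi.neg_apply]
  rw [Finset.sum_eq_single t]
  · simp [dV]
  · intro b _ hb; simp [dV, hb]
  · simp

/-- Bracketing with `∂_t` differentiates all coefficients, up to sign. The identity is thus the
Leibniz rule for a bilinear differential operator with constant coefficients, uniformly in the
parities. -/
lemma jacobi_dV (x y : L) (t : Fin 5) :
    bracket (bracket x y) (dV t) = bracket (bracket x (dV t)) y + bracket x (bracket y (dV t)) := by
  have hx1 := bracket_dV_fst x t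
  have hx2 := bracket_dV_snd x t
  have hy1 := bracket_dV_fst y t
  have hy2 := bracket_dV_snd y t
  have h1 := bracket_dV_fst (bracket x y) t
  have h2 := bracket_dV_snd (bracket x y) t
  generalize bracket (bracket x y) (dV t) = w at h1 h2 ⊢
  generalize bracket x (dV t) = u at hx1 hx2 ⊢
  generalize bracket y (dV t) = v at hy1 hy2 ⊢
  refine L_ext ?_ ?_
  · ext1 i
    change _ = (bracket u y).1.1 i + (bracket x v).1.1 i
    rw [h1]
    simp only [bracket_fst, Pi.add_apply, vfBracket, formBracket, hx1, hy1, hx2, hy2, map_add,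
      map_sum, map_sub, map_neg, Derivation.leibniz, smul_eq_mul, Derivation.map_smul, neg_add]
    rw [add_add_add_comm, ← Finset.sum_neg_distrib, ← Finset.sum_add_distrib, ← smul_neg, ← smul_add,
      ← Finset.sum_neg_distrib, ← Finset.sum_add_distrib]
    congr 1
    · refine Finset.sum_congr rfl fun m _ => ?_
      rw [D_comm t m, D_comm t m]
      ring
    · refine congrArg _ (Finset.sum_congr rfl fun σ _ => ?_)
      split_ifs
      · rw [Derivation.leibniz, Derivation.leibniz, Derivation.map_intCast]
        simp only [smul_eq_mul]
        ring
      · simp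
  · ext1 i; ext1 j
    change _ = (bracket u y).1.2 i j + (bracket x v).1.2 i j
    rw [h2]
    simp only [bracket_snd, Pi.sub_apply, lieDeriv, hx1, hy1, hx2, hy2, map_add, map_sum, map_sub,
      map_neg, Derivation.leibniz, smul_eq_mul, ← Finset.sum_sub_distrib]
    rw [← Finset.sum_neg_distrib, ← Finset.sum_add_distrib]
    refine Finset.sum_congr rfl fun m _ => ?_
    rw [D_comm t m, D_comm t m, D_comm t i, D_comm t i, D_comm t j, D_comm t j]
    ring

lemma levi_skew_right' (i j k l t : Fin 5) : levi i j l k t = - levi i j k l t := by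
  rw [levi_skew_right]

lemma dForm_snd (a b k l : Fin 5) : (dForm a b).1.2 k l =
    (if k = a ∧ l = b then (1 : PS) else 0) - (if k = b ∧ l = a then 1 else 0) := by
  change MvPowerSeries.C _ = _
  rw [map_sub, apply_ite (MvPowerSeries.C : ℂ →+* PS), apply_ite (MvPowerSeries.C : ℂ →+* PS),
    map_one, map_zero]

lemma formBracket_dForm (ω : Fin 5 → Fin 5 → PS) (a b t : Fin 5) :
    formBracket ω (dForm a b).1.2 t =
      (1 / 2 : ℂ) • ∑ i, ∑ j, (levi i j a b t : PS) * ω i j := by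
  rw [formBracket_eq_sum_levi]
  have h : ∀ i j, ∑ k, ∑ l, (levi i j k l t : PS) * (ω i j * (dForm a b).1.2 k l) =
      2 * ((levi i j a b t : PS) * ω i j) := by
    intro i j
    have e : ∀ k l, (levi i j k l t : PS) * (ω i j * (dForm a b).1.2 k l) =
        (if k = a then (if l = b then (levi i j k l t : PS) * ω i j else 0) else 0) -
        (if k = b then (if l = a then (levi i j k l t : PS) * ω i j else 0) else 0) := by
      intro k l
      simp only [dForm_snd, ite_and, mul_sub, mul_ite, mul_one, mul_zero]
    simp only [e, Finset.sum_sub_distrib, Finset.sum_ite_eq', Finset.mem_univ, if_true,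
      Finset.sum_ite_irrel, Finset.sum_const_zero]
    rw [levi_skew_right i j b a]
    push_cast
    ring
  simp only [h, ← Finset.mul_sum]
  rw [← map_ofNat (MvPowerSeries.C : ℂ →+* PS) 2, ← MvPowerSeries.smul_eq_C_mul, smul_smul]
  norm_num

/-- The bracket `[d_ab, d_cd] = ∑ ε_{abcdt} ∂_t`. -/
lemma bracket_dForm_dForm (a b c d : Fin 5) :
    bracket (dForm a b) (dForm c d) = ∑ t, (levi a b c d t : ℂ) • dV t := by
  refine L_ext ?_ ?_
  · ext1 s
    rw [bracket_fst, show (dForm a b).1.1 = 0 from rfl, vfBracket_zero_left, zero_add,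
      formBracket_dForm]
    have e : ∀ i j, (levi i j c d s : PS) * (dForm a b).1.2 i j =
        (if i = a then (if j = b then (levi i j c d s : PS) else 0) else 0) -
        (if i = b then (if j = a then (levi i j c d s : PS) else 0) else 0) := by
      intro k l
      simp only [dForm_snd, ite_and, mul_sub, mul_ite, mul_one, mul_zero]
    simp only [e, Finset.sum_sub_distrib, Finset.sum_ite_eq', Finset.mem_univ, if_true,
      Finset.sum_ite_irrel, Finset.sum_const_zero]
    rw [levi_skew_left b a]
    have h2 : (∑ t, (levi a b c d t : ℂ) • dV t).1.1 s = (levi a b c d s : PS) := by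
      have : ∀ t, ((levi a b c d t : ℂ) • dV t).1.1 s =
          if t = s then (levi a b c d t : PS) else 0 := by
        intro t
        change (levi a b c d t : ℂ) • MvPowerSeries.C (if s = t then (1 : ℂ) else 0) = _
        rw [MvPowerSeries.smul_eq_C_mul]
        by_cases h : t = s
        · simp [h]
        · simp [h, Ne.symm h]
      rw [AddSubmonoidClass.coe_finsetSum, Prod.fst_sum, Finset.sum_apply]
      simp only [this]
      simp
    rw [h2, Int.cast_neg, sub_neg_eq_add, ← two_mul, ← map_ofNat (MvPowerSeries.C : ℂ →+* PS) 2,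
      ← MvPowerSeries.smul_eq_C_mul, smul_smul]
    norm_num
  · rw [bracket_snd, show (dForm a b).1.1 = 0 from rfl, show (dForm c d).1.1 = 0 from rfl,
      lieDeriv_zero_left, lieDeriv_zero_left, AddSubmonoidClass.coe_finsetSum, Prod.snd_sum]
    simp [dV]

lemma bracket_dForm_dV (a b t : Fin 5) : bracket (dForm a b) (dV t) = 0 := by
  refine L_ext ?_ ?_
  · ext1 i; rw [bracket_dV_fst]; simp [dForm]
  · ext1 i; ext1 j; rw [bracket_dV_snd]
    exact neg_eq_zero.mpr MvPowerSeries.pderiv_C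

lemma bracket_dV_dV (s t : Fin 5) : bracket (dV s) (dV t) = 0 := by
  refine L_ext ?_ ?_
  · ext1 i; rw [bracket_dV_fst]
    exact neg_eq_zero.mpr MvPowerSeries.pderiv_C
  · ext1 i; ext1 j; rw [bracket_dV_snd]; simp [dV]

lemma dForm_skew (a b : Fin 5) : dForm a b = - dForm b a := by
  refine L_ext neg_zero.symm ?_
  ext1 i; ext1 j
  change MvPowerSeries.C _ = - MvPowerSeries.C _
  rw [← map_neg, neg_sub]

/-! ### Constant and linear terms -/

/-- The constant term of a power series. -/
abbrev c0 : PS →+* ℂ := MvPowerSeries.constantCoeff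

lemma c0_smul (c : ℂ) (f : PS) : c0 (c • f) = c * c0 f := by
  rw [MvPowerSeries.smul_eq_C_mul, map_mul, MvPowerSeries.constantCoeff_C]

lemma coeff_single_eq (i : Fin 5) (f : PS) :
    MvPowerSeries.coeff (Finsupp.single i 1) f = c0 (D i f) := by
  rw [← MvPowerSeries.coeff_zero_eq_constantCoeff_apply, MvPowerSeries.coeff_pderiv]
  simp

lemma linPart_mat (x : L) (i j : Fin 5) : (linPart x).mat i j = c0 (D i (x.1.1 j)) :=
  coeff_single_eq i _

/-- Degrees are negative only for constant coefficients: −2 for vector fields and −1 for forms. -/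
lemma mem_nonnegPart {x : L} :
    x ∈ nonnegPart ↔ (∀ i, c0 (x.1.1 i) = 0) ∧ ∀ i j, c0 (x.1.2 i j) = 0 := by
  have hdeg : ∀ m : Fin 5 →₀ ℕ, m ≠ 0 → 1 ≤ m.degree := fun m hm =>
    Nat.one_le_iff_ne_zero.mpr (by simpa [Finsupp.degree_eq_zero_iff] using hm)
  constructor
  · rintro ⟨h1, h2⟩
    refine ⟨fun i => ?_, fun i j => ?_⟩
    · by_contra h
      have := h1 i 0 (by rwa [MvPowerSeries.coeff_zero_eq_constantCoeff_apply])
      simp at this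
    · by_contra h
      have := h2 i j 0 (by rwa [MvPowerSeries.coeff_zero_eq_constantCoeff_apply])
      simp at this
  · rintro ⟨h1, h2⟩
    refine ⟨fun i m hm => ?_, fun i j m hm => ?_⟩
    · have := hdeg m (by
        rintro rfl
        exact hm (by rw [MvPowerSeries.coeff_zero_eq_constantCoeff_apply]; exact h1 i))
      omega
    · have := hdeg m (by
        rintro rfl
        exact hm (by rw [MvPowerSeries.coeff_zero_eq_constantCoeff_apply]; exact h2 i j))
      omega

lemma c0_formBracket_left {ω : Fin 5 → Fin 5 → PS} (η : Fin 5 → Fin 5 → PS)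
    (h : ∀ i j, c0 (ω i j) = 0) (t : Fin 5) : c0 (formBracket ω η t) = 0 := by
  rw [formBracket, c0_smul, map_sum, Finset.sum_eq_zero, mul_zero]
  intro σ _
  split_ifs
  · rw [map_mul, map_mul, h]; ring
  · exact map_zero _

lemma bracket_mem_nonnegPart {x y : L} (hx : x ∈ nonnegPart) (hy : y ∈ nonnegPart) :
    bracket x y ∈ nonnegPart := by
  rw [mem_nonnegPart] at *
  refine ⟨fun i => ?_, fun i j => ?_⟩
  · rw [bracket_fst, Pi.add_apply, map_add, c0_formBracket_left _ hx.2, vfBracket, map_sum]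
    simp [hx.1, hy.1]
  · rw [bracket_snd]
    simp only [Pi.sub_apply, lieDeriv, map_sub, map_sum, map_add, map_mul, hx.1, hy.1, hx.2, hy.2]
    simp

/-- For fields vanishing at the origin, the linear part of the commutator involves only the linear
parts. The bracket of two forms vanishing at the origin starts in order two and does not contribute.
-/
lemma linPart_bracket {x y : L} (hx : x ∈ nonnegPart) (hy : y ∈ nonnegPart) :
    linPart (bracket x y) = ⁅linPart x, linPart y⁆ := by
  rw [mem_nonnegPart] at *
  refine sl5.ext ?_
  rw [sl5.mat_lie]
  ext i j
  rw [linPart_mat, bracket_fst, Pi.add_apply, map_add, map_add, Matrix.sub_apply, Matrix.mul_apply,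
    Matrix.mul_apply]
  have h1 : c0 (D i (formBracket x.1.2 y.1.2 j)) = 0 := by
    rw [formBracket, Derivation.map_smul, c0_smul, map_sum, map_sum, Finset.sum_eq_zero, mul_zero]
    intro σ _
    split_ifs
    · rw [Derivation.leibniz, Derivation.leibniz]
      simp [hx.2, hy.2]
    · simp
  rw [h1, add_zero, vfBracket, map_sum, map_sum, ← Finset.sum_sub_distrib]
  refine Finset.sum_congr rfl fun m _ => ?_
  simp only [map_sub, Derivation.leibniz, smul_eq_mul, map_add, map_mul, hx.1, hy.1, linPart_mat]
  ring

lemma linPart_of_isOdd {x : L} (hx : IsOdd x) : linPart x = 0 := by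
  refine sl5.ext ?_
  ext i j
  rw [linPart_mat, show x.1.1 = 0 from hx]
  simp

lemma linPart_dV (t : Fin 5) : linPart (dV t) = 0 := by
  refine sl5.ext ?_
  ext i j
  rw [linPart_mat, D_dV_fst]
  simp

/-- The component of an element of `L` in `L_{-2} ⊕ L_{-1}`. -/
def constPart : L →ₗ[ℂ] L where
  toFun x := ∑ t, c0 (x.1.1 t) • dV t + (1 / 2 : ℂ) • ∑ a, ∑ b, c0 (x.1.2 a b) • dForm a b
  map_add' x y := by
    simp only [Submodule.coe_add, Prod.fst_add, Prod.snd_add, Pi.add_apply, map_add, add_smul,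
      Finset.sum_add_distrib, smul_add]
    abel
  map_smul' c x := by
    simp only [Submodule.coe_smul, Prod.smul_fst, Prod.smul_snd, Pi.smul_apply, c0_smul, mul_smul,
      ← Finset.smul_sum, smul_add, RingHom.id_apply, smul_comm c (1 / 2 : ℂ)]

lemma constPart_apply (x : L) : constPart x =
    ∑ t, c0 (x.1.1 t) • dV t + (1 / 2 : ℂ) • ∑ a, ∑ b, c0 (x.1.2 a b) • dForm a b := rfl

lemma coe_sum_fst {ι : Type*} (s : Finset ι) (f : ι → L) :
    (∑ i ∈ s, f i).1.1 = ∑ i ∈ s, (f i).1.1 := by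
  rw [AddSubmonoidClass.coe_finsetSum, Prod.fst_sum]

lemma coe_sum_snd {ι : Type*} (s : Finset ι) (f : ι → L) :
    (∑ i ∈ s, f i).1.2 = ∑ i ∈ s, (f i).1.2 := by
  rw [AddSubmonoidClass.coe_finsetSum, Prod.snd_sum]

lemma constPart_fst (x : L) (i : Fin 5) :
    (constPart x).1.1 i = MvPowerSeries.C (c0 (x.1.1 i)) := by
  rw [constPart_apply]
  change (∑ t, c0 (x.1.1 t) • dV t).1.1 i +
    (1 / 2 : ℂ) • (∑ a, ∑ b, c0 (x.1.2 a b) • dForm a b).1.1 i = _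
  simp only [coe_sum_fst, Finset.sum_apply]
  have h1 : ∀ t, (c0 (x.1.1 t) • dV t).1.1 i =
      if i = t then MvPowerSeries.C (c0 (x.1.1 t)) else 0 := by
    intro t
    change c0 (x.1.1 t) • MvPowerSeries.C (if i = t then (1 : ℂ) else 0) = _
    split_ifs
    · rw [map_one, MvPowerSeries.smul_eq_C_mul, mul_one]
    · simp
  have h2 : ∀ a b, (c0 (x.1.2 a b) • dForm a b).1.1 i = 0 := fun a b =>
    smul_zero (A := PS) (c0 (x.1.2 a b))
  simp only [h1, h2, Finset.sum_const_zero, smul_zero, add_zero, Finset.sum_ite_eq,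
    Finset.mem_univ, if_true]

lemma constPart_snd (x : L) (i j : Fin 5) :
    (constPart x).1.2 i j = MvPowerSeries.C (c0 (x.1.2 i j)) := by
  rw [constPart_apply]
  change (∑ t, c0 (x.1.1 t) • dV t).1.2 i j +
    (1 / 2 : ℂ) • (∑ a, ∑ b, c0 (x.1.2 a b) • dForm a b).1.2 i j = _
  simp only [coe_sum_snd, Finset.sum_apply]
  have h1 : ∀ t, (c0 (x.1.1 t) • dV t).1.2 i j = 0 := fun t =>
    smul_zero (A := PS) (c0 (x.1.1 t))
  have h2 : ∀ a b, (c0 (x.1.2 a b) • dForm a b).1.2 i j =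
      (if i = a then (if j = b then MvPowerSeries.C (c0 (x.1.2 a b)) else 0) else 0) -
      (if i = b then (if j = a then MvPowerSeries.C (c0 (x.1.2 a b)) else 0) else 0) := by
    intro a b
    change c0 (x.1.2 a b) • (dForm a b).1.2 i j = _
    simp only [dForm_snd, MvPowerSeries.smul_eq_C_mul, ite_and, mul_sub, mul_ite, mul_one, mul_zero]
  simp only [h1, h2, Finset.sum_const_zero, zero_add, Finset.sum_sub_distrib, Finset.sum_ite_eq,
    Finset.mem_univ, if_true, Finset.sum_ite_irrel]
  rw [skew_snd x j i, map_neg, map_neg, sub_neg_eq_add, ← two_mul,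
    ← map_ofNat (MvPowerSeries.C : ℂ →+* PS) 2, ← MvPowerSeries.smul_eq_C_mul, smul_smul]
  norm_num

lemma sub_constPart_mem (x : L) : x - constPart x ∈ nonnegPart := by
  rw [mem_nonnegPart]
  refine ⟨fun i => ?_, fun i j => ?_⟩
  · change c0 (x.1.1 i - (constPart x).1.1 i) = 0
    rw [constPart_fst, map_sub, MvPowerSeries.constantCoeff_C, sub_self]
  · change c0 (x.1.2 i j - (constPart x).1.2 i j) = 0
    rw [constPart_snd, map_sub, MvPowerSeries.constantCoeff_C, sub_self]

/-- Every linear subspace of `L` containing `L_{≥ 0}` and all `d_ab`, `∂_t` is `L`. -/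
lemma L_induction {p : L → Prop} (hadd : ∀ x y, p x → p y → p (x + y))
    (hsmul : ∀ (c : ℂ) x, p x → p (c • x)) (hn : ∀ x ∈ nonnegPart, p x)
    (hd : ∀ a b, p (dForm a b)) (hv : ∀ t, p (dV t)) (x : L) : p x := by
  have h0 : p 0 := hn 0 (by rw [mem_nonnegPart]; simp)
  have hs : ∀ (f : Fin 5 → L), (∀ i, p (f i)) → p (∑ i, f i) := fun f hf =>
    Finset.sum_induction f p hadd h0 fun i _ => hf i
  have h := hadd _ _ (hn _ (sub_constPart_mem x)) (show p (constPart x) from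
    hadd _ _ (hs _ fun t => hsmul _ _ (hv t))
      (hsmul _ _ (hs _ fun a => hs _ fun b => hsmul _ _ (hd a b))))
  rwa [sub_add_cancel] at h

/-! ### The enveloping algebra of `L_{-2} ⊕ L_{-1}` -/

/-- The relations between the `d_ab` and `∂_t`. -/
inductive NegRel : FreeAlgebra ℂ (Fin 5 × Fin 5 ⊕ Fin 5) →
    FreeAlgebra ℂ (Fin 5 × Fin 5 ⊕ Fin 5) → Prop
  | skew (a b : Fin 5) : NegRel (FreeAlgebra.ι ℂ (Sum.inl (a, b)))
      (- FreeAlgebra.ι ℂ (Sum.inl (b, a)))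
  | odd_odd (a b c d : Fin 5) :
      NegRel (FreeAlgebra.ι ℂ (Sum.inl (a, b)) * FreeAlgebra.ι ℂ (Sum.inl (c, d)) +
        FreeAlgebra.ι ℂ (Sum.inl (c, d)) * FreeAlgebra.ι ℂ (Sum.inl (a, b)))
        (∑ t, (levi a b c d t : ℂ) • FreeAlgebra.ι ℂ (Sum.inr t))
  | even_odd (a b t : Fin 5) :
      NegRel (FreeAlgebra.ι ℂ (Sum.inr t) * FreeAlgebra.ι ℂ (Sum.inl (a, b)))
        (FreeAlgebra.ι ℂ (Sum.inl (a, b)) * FreeAlgebra.ι ℂ (Sum.inr t))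
  | even_even (s t : Fin 5) :
      NegRel (FreeAlgebra.ι ℂ (Sum.inr t) * FreeAlgebra.ι ℂ (Sum.inr s))
        (FreeAlgebra.ι ℂ (Sum.inr s) * FreeAlgebra.ι ℂ (Sum.inr t))

/-- The enveloping algebra of `L_{-2} ⊕ L_{-1}`, given by generators and relations. -/
def NegAlg : Type := RingQuot NegRel

instance : Ring NegAlg := inferInstanceAs (Ring (RingQuot NegRel))

instance : Algebra ℂ NegAlg := inferInstanceAs (Algebra ℂ (RingQuot NegRel))

/-- The generator `d_ab` of `NegAlg`. -/
def nd (a b : Fin 5) : NegAlg := RingQuot.mkAlgHom ℂ NegRel (FreeAlgebra.ι ℂ (Sum.inl (a, b)))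

/-- The generator `∂_t` of `NegAlg`. -/
def nv (t : Fin 5) : NegAlg := RingQuot.mkAlgHom ℂ NegRel (FreeAlgebra.ι ℂ (Sum.inr t))

lemma nd_skew (a b : Fin 5) : nd a b = - nd b a :=
  (RingQuot.mkAlgHom_rel ℂ (NegRel.skew a b)).trans (map_neg _ _)

lemma nd_mul_nd (a b c d : Fin 5) :
    nd a b * nd c d + nd c d * nd a b = ∑ t, (levi a b c d t : ℂ) • nv t := by
  have h := RingQuot.mkAlgHom_rel ℂ (NegRel.odd_odd a b c d)
  rw [map_add, map_mul, map_mul, map_sum] at h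
  refine h.trans (Finset.sum_congr rfl fun t _ => ?_)
  rw [map_smul]
  rfl

lemma nv_mul_nd (t a b : Fin 5) : nv t * nd a b = nd a b * nv t := by
  have h := RingQuot.mkAlgHom_rel ℂ (NegRel.even_odd a b t)
  rwa [map_mul, map_mul] at h

/-- The universal property of `NegAlg`. -/
def NegAlg.lift {B : Type*} [Ring B] [Algebra ℂ B] (d : Fin 5 → Fin 5 → B) (v : Fin 5 → B)
    (h1 : ∀ a b, d a b = - d b a)
    (h2 : ∀ a b c e, d a b * d c e + d c e * d a b = ∑ t, (levi a b c e t : ℂ) • v t)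
    (h3 : ∀ a b t, v t * d a b = d a b * v t) (h4 : ∀ s t, v t * v s = v s * v t) :
    NegAlg →ₐ[ℂ] B :=
  RingQuot.liftAlgHom ℂ ⟨FreeAlgebra.lift ℂ (Sum.elim (fun p => d p.1 p.2) v), by
    intro x y h
    cases h with
    | skew a b => simpa using h1 a b
    | odd_odd a b c d => simpa using h2 a b c d
    | even_odd a b t => simpa using h3 a b t
    | even_even s t => simpa using h4 s t⟩

lemma NegAlg.lift_nd {B : Type*} [Ring B] [Algebra ℂ B] (d : Fin 5 → Fin 5 → B) (v : Fin 5 → B)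
    (h1) (h2) (h3) (h4) (a b : Fin 5) : NegAlg.lift d v h1 h2 h3 h4 (nd a b) = d a b := by
  refine (RingQuot.liftAlgHom_mkAlgHom_apply ℂ _ _ _).trans ?_
  simp

lemma NegAlg.lift_nv {B : Type*} [Ring B] [Algebra ℂ B] (d : Fin 5 → Fin 5 → B) (v : Fin 5 → B)
    (h1) (h2) (h3) (h4) (t : Fin 5) : NegAlg.lift d v h1 h2 h3 h4 (nv t) = v t := by
  refine (RingQuot.liftAlgHom_mkAlgHom_apply ℂ _ _ _).trans ?_
  simp

lemma NegAlg.induction {p : NegAlg → Prop} (hc : ∀ c : ℂ, p (algebraMap ℂ NegAlg c))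
    (hd : ∀ a b, p (nd a b)) (hv : ∀ t, p (nv t)) (hadd : ∀ x y, p x → p y → p (x + y))
    (hmul : ∀ x y, p x → p y → p (x * y)) (x : NegAlg) : p x := by
  obtain ⟨y, rfl⟩ := RingQuot.mkAlgHom_surjective ℂ NegRel x
  induction y using FreeAlgebra.induction with
  | grade0 r => rw [AlgHom.commutes]; exact hc r
  | grade1 s =>
    rcases s with ⟨a, b⟩ | t
    · exact hd a b
    · exact hv t
  | mul a b ha hb => rw [map_mul]; exact hmul _ _ ha hb
  | add a b ha hb => rw [map_add]; exact hadd _ _ ha hb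

lemma bracket_sum_right {ι : Type*} (s : Finset ι) (x : L) (f : ι → L) :
    bracket x (∑ i ∈ s, f i) = ∑ i ∈ s, bracket x (f i) := map_sum (bracketL x) f s

lemma bracket_neg_right (x y : L) : bracket x (-y) = - bracket x y := (bracketL x).map_neg y

lemma bracket_neg_left (x y : L) : bracket (-x) y = - bracket x y := bracketL.map_neg₂ x y

/-! ### The `NegAlg`-module of linear maps from `L` to `NegAlg ⊗ V`. -/

section NegModule

variable (V : Type) [AddCommGroup V] [Module ℂ V]

/-- The space `U(L_{-2} ⊕ L_{-1}) ⊗ V`, on which `L` will act. -/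
abbrev NegMod : Type := NegAlg ⊗[ℂ] V

instance : AddCommGroup (NegMod V) := inferInstance

instance : AddCommGroup (L →ₗ[ℂ] NegMod V) := inferInstance

variable {V}

lemma NegMod.induction (p : Submodule ℂ (NegMod V)) (h1 : ∀ v : V, (1 : NegAlg) ⊗ₜ[ℂ] v ∈ p)
    (hd : ∀ a b, ∀ n ∈ p, nd a b • n ∈ p) (hv : ∀ t, ∀ n ∈ p, nv t • n ∈ p) (n : NegMod V) :
    n ∈ p := by
  have key : ∀ a : NegAlg, ∀ n ∈ p, a • n ∈ p := by
    intro a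
    induction a using NegAlg.induction with
    | hc c => intro n hn; rw [algebraMap_smul]; exact p.smul_mem c hn
    | hd a b => exact hd a b
    | hv t => exact hv t
    | hadd x y hx hy => intro n hn; rw [add_smul]; exact p.add_mem (hx n hn) (hy n hn)
    | hmul x y hx hy => intro n hn; rw [mul_smul]; exact hx _ (hy n hn)
  induction n using TensorProduct.induction_on with
  | zero => exact p.zero_mem
  | add x y hx hy => exact p.add_mem hx hy
  | tmul a v =>
    have := key a _ (h1 v)
    rwa [TensorProduct.smul_tmul', smul_eq_mul, mul_one] at this

lemma NegMod.hom_ext (f g : Module.End ℂ (NegMod V)) (h1 : ∀ v : V, f (1 ⊗ₜ[ℂ] v) = g (1 ⊗ₜ[ℂ] v))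
    (hd : ∀ a b n, f n = g n → f (nd a b • n) = g (nd a b • n))
    (hv : ∀ t n, f n = g n → f (nv t • n) = g (nv t • n)) : f = g := by
  ext1
  refine LinearMap.ext fun a => LinearMap.ext fun v => ?_
  exact NegMod.induction (LinearMap.eqLocus f g) h1 hd hv (a ⊗ₜ v)

/-- The action of `d_ab` on `Hom(L, NegMod V)`. -/
def homD (a b : Fin 5) : Module.End ℂ (L →ₗ[ℂ] NegMod V) where
  toFun h := Algebra.lsmul ℂ ℂ (NegMod V) (nd a b) ∘ₗ h ∘ₗ parity +
    h ∘ₗ bracketL.flip (dForm a b)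
  map_add' h h' := by
    ext x
    simp only [LinearMap.add_apply, LinearMap.comp_apply, map_add]
    abel
  map_smul' c h := by
    ext x
    simp only [LinearMap.add_apply, LinearMap.comp_apply, map_smul, LinearMap.smul_apply, smul_add,
      RingHom.id_apply]

/-- The action of `∂_t` on `Hom(L, NegMod V)`. -/
def homV (t : Fin 5) : Module.End ℂ (L →ₗ[ℂ] NegMod V) where
  toFun h := Algebra.lsmul ℂ ℂ (NegMod V) (nv t) ∘ₗ h + h ∘ₗ bracketL.flip (dV t)
  map_add' h h' := by
    ext x
    simp only [LinearMap.add_apply, LinearMap.comp_apply, map_add]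
    abel
  map_smul' c h := by
    ext x
    simp only [LinearMap.add_apply, LinearMap.comp_apply, map_smul, LinearMap.smul_apply, smul_add,
      RingHom.id_apply]

/-- The formula is dictated by `x d n = d (±x) n + [x, d] n`: with it, `n ↦ (x ↦ x n)` is linear
over `NegAlg`. The sign is supplied by `parity`. -/
lemma homD_apply (a b : Fin 5) (h : L →ₗ[ℂ] NegMod V) (x : L) :
    homD a b h x = nd a b • h (parity x) + h (bracket x (dForm a b)) := rfl

lemma homV_apply (t : Fin 5) (h : L →ₗ[ℂ] NegMod V) (x : L) :
    homV t h x = nv t • h x + h (bracket x (dV t)) := rfl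

lemma parity_parity (x : L) : parity (parity x) = x :=
  Subtype.ext (Prod.ext rfl (neg_neg _))

lemma L_parity_induction {p : L → Prop} (hadd : ∀ x y, p x → p y → p (x + y))
    (he : ∀ x, IsEven x → p x) (ho : ∀ x, IsOdd x → p x) (x : L) : p x := by
  rw [← evenPart_add_oddPart x]
  exact hadd _ _ (he _ (isEven_evenPart x)) (ho _ (isOdd_oddPart x))

lemma parity_bracket_dForm (x : L) (a b : Fin 5) :
    parity (bracket x (dForm a b)) = - bracket (parity x) (dForm a b) := by
  induction x using L_parity_induction with
  | hadd x y hx hy => rw [bracket_add_left, map_add, map_add, bracket_add_left, hx, hy, neg_add]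
  | he x hx => rw [hx.parity, (hx.bracket_isOdd (isOdd_dForm a b)).parity]
  | ho x hx =>
    rw [hx.parity, (hx.bracket_isEven (isOdd_dForm a b)).parity, bracket_neg_left, neg_neg]

lemma parity_bracket_dV (x : L) (t : Fin 5) :
    parity (bracket x (dV t)) = bracket (parity x) (dV t) := by
  induction x using L_parity_induction with
  | hadd x y hx hy => rw [bracket_add_left, map_add, map_add, bracket_add_left, hx, hy]
  | he x hx => rw [hx.parity, (hx.bracket_isEven (isEven_dV t)).parity]
  | ho x hx =>
    rw [hx.parity, (hx.bracket_isOdd (isEven_dV t)).parity, bracket_neg_left]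

/-- This is the compatibility of `homD` with the anticommutation relations. With `jacobi_dV` it
makes `Hom(L, NegAlg ⊗ V)` a module over `NegAlg`. -/
lemma jacobi_dForm_dForm (x : L) (a b c d : Fin 5) :
    bracket (bracket x (dForm a b)) (dForm c d) + bracket (bracket x (dForm c d)) (dForm a b) =
      bracket x (bracket (dForm a b) (dForm c d)) := by
  induction x using L_parity_induction with
  | hadd x y hx hy =>
    simp only [bracket_add_left]
    rw [← hx, ← hy]
    abel
  | he x hx =>
    rw [jacobi_even_odd_odd hx (isOdd_dForm a b) (isOdd_dForm c d)]
    abel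
  | ho x hx =>
    have h := (isOdd_dForm a b).bracket_isEven (isOdd_dForm c d)
    rw [jacobi_odd_odd_odd hx (isOdd_dForm a b) (isOdd_dForm c d), h.bracket_skew]
    abel

/-- `Hom(L, NegMod V)` as a representation of `NegAlg`. -/
def homRep : NegAlg →ₐ[ℂ] Module.End ℂ (L →ₗ[ℂ] NegMod V) :=
  NegAlg.lift (B := Module.End ℂ (L →ₗ[ℂ] NegMod V)) homD homV
    (fun a b => by
      ext h x
      rw [LinearMap.neg_apply, LinearMap.neg_apply, homD_apply, homD_apply, nd_skew, dForm_skew,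
        bracket_neg_right, map_neg, neg_smul, neg_add])
    (fun a b c e => by
      ext h x
      rw [LinearMap.add_apply, LinearMap.add_apply, LinearMap.sum_apply, LinearMap.sum_apply]
      simp only [Module.End.mul_apply, homD_apply, LinearMap.smul_apply, homV_apply,
        parity_parity, parity_bracket_dForm, map_neg, smul_add, Finset.sum_add_distrib, smul_smul]
      have h1 : nd a b • nd c e • h x + nd c e • nd a b • h x =
          ∑ t, (levi a b c e t : ℂ) • nv t • h x := by
        rw [smul_smul, smul_smul, ← add_smul, nd_mul_nd, Finset.sum_smul]
        simp only [smul_assoc]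
      have h2 : h (bracket (bracket x (dForm a b)) (dForm c e)) +
          h (bracket (bracket x (dForm c e)) (dForm a b)) =
          ∑ t, (levi a b c e t : ℂ) • h (bracket x (dV t)) := by
        rw [← map_add, jacobi_dForm_dForm, bracket_dForm_dForm, bracket_sum_right, map_sum]
        simp only [bracket_smul_right, map_smul]
      simp only [smul_smul] at h1 
      simp only [smul_smul, smul_neg]
      rw [← h1, ← h2]
      abel)
    (fun a b t => by
      ext h x
      have hJ := jacobi_dV x (dForm a b) t
      rw [bracket_dForm_dV, show bracket x 0 = 0 from (bracketL x).map_zero, add_zero] at hJ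
      simp only [Module.End.mul_apply, homD_apply, homV_apply, smul_add, smul_smul, nv_mul_nd,
        parity_bracket_dV, hJ]
      abel)
    (fun s t => by
      ext h x
      have hJ := jacobi_dV x (dV s) t
      rw [bracket_dV_dV, show bracket x 0 = 0 from (bracketL x).map_zero, add_zero] at hJ
      have hvv : nv t * nv s = nv s * nv t := by
        have h := RingQuot.mkAlgHom_rel ℂ (NegRel.even_even s t)
        rwa [map_mul, map_mul] at h
      simp only [Module.End.mul_apply, homV_apply, smul_add, smul_smul, hvv, hJ]
      abel)

end NegModule

/-- The image in `NegAlg` of the component in `L_{-2} ⊕ L_{-1}`. -/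
def negElt : L →ₗ[ℂ] NegAlg where
  toFun x := ∑ t, c0 (x.1.1 t) • nv t + (1 / 2 : ℂ) • ∑ a, ∑ b, c0 (x.1.2 a b) • nd a b
  map_add' x y := by
    simp only [Submodule.coe_add, Prod.fst_add, Prod.snd_add, Pi.add_apply, map_add, add_smul,
      Finset.sum_add_distrib, smul_add]
    abel
  map_smul' c x := by
    simp only [Submodule.coe_smul, Prod.smul_fst, Prod.smul_snd, Pi.smul_apply, c0_smul, mul_smul,
      ← Finset.smul_sum, smul_add, RingHom.id_apply, smul_comm c (1 / 2 : ℂ)]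

lemma negElt_apply (x : L) : negElt x =
    ∑ t, c0 (x.1.1 t) • nv t + (1 / 2 : ℂ) • ∑ a, ∑ b, c0 (x.1.2 a b) • nd a b := rfl

lemma negElt_of_mem {x : L} (hx : x ∈ nonnegPart) : negElt x = 0 := by
  rw [mem_nonnegPart] at hx
  simp [negElt_apply, hx.1, hx.2]

lemma negElt_dV (t : Fin 5) : negElt (dV t) = nv t := by
  have h1 : ∀ s, c0 ((dV t).1.1 s) = if s = t then 1 else 0 := fun s =>
    MvPowerSeries.constantCoeff_C _
  have h2 : ∀ a b, c0 ((dV t).1.2 a b) = 0 := fun a b => map_zero _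
  simp [negElt_apply, h1, h2]

lemma negElt_dForm (a b : Fin 5) : negElt (dForm a b) = nd a b := by
  have h1 : ∀ s, c0 ((dForm a b).1.1 s) = 0 := fun s => map_zero _
  have h2 : ∀ i j, c0 ((dForm a b).1.2 i j) • nd i j =
      (if i = a then if j = b then nd i j else 0 else 0) -
      (if i = b then if j = a then nd i j else 0 else 0) := fun i j => by
    rw [dForm_snd]
    simp only [map_sub, apply_ite c0, map_one, map_zero, sub_smul, ite_smul, one_smul, zero_smul,
      ite_and]
  simp only [negElt_apply, h1, h2, zero_smul, Finset.sum_const_zero, zero_add,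
    Finset.sum_sub_distrib, Finset.sum_ite_eq', Finset.mem_univ, if_true, Finset.sum_ite_irrel]
  rw [nd_skew b a, sub_neg_eq_add, ← two_smul ℂ, smul_smul]
  norm_num

/-! ### The action of `L` on `NegAlg ⊗ V`. -/

section Action

variable {V : Type} [AddCommGroup V] [Module ℂ V] [LieRingModule sl5 V] [LieModule ℂ sl5 V]

/-- The value of the action of `L` on `1 ⊗ v`. -/
def actBase : V →ₗ[ℂ] L →ₗ[ℂ] NegMod V :=
  LinearMap.mk₂ ℂ (fun v x => negElt x ⊗ₜ[ℂ] v + 1 ⊗ₜ[ℂ] ⁅linPart x, v⁆)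
    (fun v w x => by rw [lie_add, TensorProduct.tmul_add, TensorProduct.tmul_add]; abel)
    (fun c v x => by rw [lie_smul, TensorProduct.tmul_smul, TensorProduct.tmul_smul, smul_add])
    (fun v x y => by
      rw [map_add, map_add, add_lie, TensorProduct.tmul_add, TensorProduct.add_tmul]; abel)
    (fun c v x => by
      rw [map_smul, map_smul, smul_lie, TensorProduct.tmul_smul, ← TensorProduct.smul_tmul',
        smul_add])

/-- The action of `L` on `NegMod V`. -/
def act : L →ₗ[ℂ] Module.End ℂ (NegMod V) :=
  LinearMap.flip (TensorProduct.lift (LinearMap.mk₂ ℂ (fun (a : NegAlg) (v : V) =>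
    homRep a (actBase v))
    (fun a b v => by rw [map_add, LinearMap.add_apply])
    (fun c a v => by rw [map_smul, LinearMap.smul_apply])
    (fun a v w => by rw [map_add, map_add])
    (fun c a v => by rw [map_smul, map_smul])))

lemma act_tmul (x : L) (a : NegAlg) (v : V) :
    act x (a ⊗ₜ[ℂ] v) = homRep a (actBase v) x := rfl

lemma act_one_tmul (x : L) (v : V) :
    act x ((1 : NegAlg) ⊗ₜ[ℂ] v) = negElt x ⊗ₜ[ℂ] v + 1 ⊗ₜ[ℂ] ⁅linPart x, v⁆ := by
  rw [act_tmul, map_one]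
  rfl

/-- The orbit map is `NegAlg`-linear by construction; unfolded, this is the recursion that moves `x`
past `d_ab`. -/
lemma act_nd_smul (x : L) (a b : Fin 5) (n : NegMod V) :
    act x (nd a b • n) = nd a b • act (parity x) n + act (bracket x (dForm a b)) n := by
  induction n using TensorProduct.induction_on with
  | zero => simp
  | add n m hn hm => rw [smul_add, map_add, hn, hm, map_add, map_add, smul_add]; abel
  | tmul c v =>
    rw [TensorProduct.smul_tmul', smul_eq_mul, act_tmul, map_mul, Module.End.mul_apply, homRep,
      NegAlg.lift_nd, homD_apply]
    rfl

lemma act_nv_smul (x : L) (t : Fin 5) (n : NegMod V) :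
    act x (nv t • n) = nv t • act x n + act (bracket x (dV t)) n := by
  induction n using TensorProduct.induction_on with
  | zero => simp
  | add n m hn hm => rw [smul_add, map_add, hn, hm, map_add, map_add, smul_add]; abel
  | tmul c v =>
    rw [TensorProduct.smul_tmul', smul_eq_mul, act_tmul, map_mul, Module.End.mul_apply, homRep,
      NegAlg.lift_nv, homV_apply]
    rfl

/-- The action was defined by recursion, so its agreement with left multiplication on the negative
part has to be proved. Both endomorphisms agree on `1 ⊗ v` and obey the same recursion. -/
lemma act_dV (t : Fin 5) (n : NegMod V) : act (dV t) n = nv t • n := by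
  have : act (dV t) = Algebra.lsmul ℂ ℂ (NegMod V) (nv t) := by
    refine NegMod.hom_ext _ _ (fun v => ?_) (fun a b n hn => ?_) (fun s n hn => ?_)
    · rw [act_one_tmul, negElt_dV, linPart_dV, zero_lie, TensorProduct.tmul_zero, add_zero]
      change nv t ⊗ₜ[ℂ] v = nv t • ((1 : NegAlg) ⊗ₜ[ℂ] v)
      rw [TensorProduct.smul_tmul', smul_eq_mul, mul_one]
    · rw [act_nd_smul, (isEven_dV t).parity, hn, (isEven_dV t).bracket_skew, bracket_dForm_dV,
        neg_zero, map_zero, LinearMap.zero_apply, add_zero]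
      simp only [Algebra.lsmul_coe, smul_smul, nv_mul_nd]
    · have hvv : nv t * nv s = nv s * nv t := by
        have h := RingQuot.mkAlgHom_rel ℂ (NegRel.even_even s t)
        rwa [map_mul, map_mul] at h
      rw [act_nv_smul, hn, bracket_dV_dV, map_zero, LinearMap.zero_apply, add_zero]
      simp only [Algebra.lsmul_coe, smul_smul, hvv]
  rw [this, Algebra.lsmul_coe]

lemma act_dForm (a b : Fin 5) (n : NegMod V) : act (dForm a b) n = nd a b • n := by
  have : act (dForm a b) = Algebra.lsmul ℂ ℂ (NegMod V) (nd a b) := by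
    refine NegMod.hom_ext _ _ (fun v => ?_) (fun c d n hn => ?_) (fun s n hn => ?_)
    · rw [act_one_tmul, negElt_dForm, linPart_of_isOdd (isOdd_dForm a b), zero_lie,
        TensorProduct.tmul_zero, add_zero]
      change nd a b ⊗ₜ[ℂ] v = nd a b • ((1 : NegAlg) ⊗ₜ[ℂ] v)
      rw [TensorProduct.smul_tmul', smul_eq_mul, mul_one]
    · rw [act_nd_smul, (isOdd_dForm a b).parity, map_neg, LinearMap.neg_apply, hn,
        bracket_dForm_dForm, map_sum, LinearMap.sum_apply]
      simp only [map_smul, LinearMap.smul_apply, act_dV, Algebra.lsmul_coe]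
      have h1 : nd a b • nd c d • n + nd c d • nd a b • n =
          ∑ t, (levi a b c d t : ℂ) • nv t • n := by
        rw [smul_smul, smul_smul, ← add_smul, nd_mul_nd, Finset.sum_smul]
        simp only [smul_assoc]
      rw [← h1, smul_neg]
      abel
    · rw [act_nv_smul, hn, bracket_dForm_dV, map_zero, LinearMap.zero_apply, add_zero]
      simp only [Algebra.lsmul_coe, smul_smul, nv_mul_nd]
  rw [this, Algebra.lsmul_coe]

end Action

lemma linPart_evenPart (x : L) : linPart (evenPart x) = linPart x := rfl

lemma evenPart_mem {x : L} (hx : x ∈ nonnegPart) : evenPart x ∈ nonnegPart := by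
  rw [mem_nonnegPart] at *
  exact ⟨hx.1, fun i j => map_zero _⟩

lemma oddPart_mem {x : L} (hx : x ∈ nonnegPart) : oddPart x ∈ nonnegPart := by
  rw [mem_nonnegPart] at *
  exact ⟨fun i => map_zero _, hx.2⟩

/-! ### The relations of `U(L)` on `NegAlg ⊗ V`, and the map from the Verma module. -/

section Relations

variable {V : Type} [AddCommGroup V] [Module ℂ V] [LieRingModule sl5 V] [LieModule ℂ sl5 V]

lemma act_one_tmul_of_mem {x : L} (hx : x ∈ nonnegPart) (v : V) :
    act x ((1 : NegAlg) ⊗ₜ[ℂ] v) = 1 ⊗ₜ[ℂ] ⁅linPart x, v⁆ := by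
  rw [act_one_tmul, negElt_of_mem hx, TensorProduct.zero_tmul, zero_add]

lemma parity_mem {x : L} (hx : x ∈ nonnegPart) : parity x ∈ nonnegPart := by
  rw [mem_nonnegPart] at *
  refine ⟨hx.1, fun i j => ?_⟩
  change c0 (-(x.1.2 i j)) = 0
  rw [map_neg, hx.2, neg_zero]

/-- Splitting `y` by parity and twisting `x` covers all sign cases in one formula. If `x` or `y` is
a negative generator, it is the defining recursion; if both lie in `L_{≥0}`, it is the homomorphism
property of `linPart`. -/
lemma act_act_one_tmul (x y : L) (v : V) : act x (act y ((1 : NegAlg) ⊗ₜ[ℂ] v)) =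
    act (evenPart y) (act x (1 ⊗ₜ v)) + act (oddPart y) (act (parity x) (1 ⊗ₜ v)) +
      act (bracket x y) (1 ⊗ₜ v) := by
  induction x using L_induction with
  | hadd x x' h h' =>
    simp only [map_add, LinearMap.add_apply, bracket_add_left, h, h']
    abel
  | hsmul c x h =>
    simp only [map_smul, LinearMap.smul_apply, bracket_smul_left, h, smul_add]
  | hd a b =>
    have e1 : act (evenPart y) (nd a b • (1 : NegAlg) ⊗ₜ[ℂ] v) = _ := act_nd_smul _ a b _
    have e2 : act (oddPart y) (nd a b • (1 : NegAlg) ⊗ₜ[ℂ] v) = _ := act_nd_smul _ a b _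
    rw [(isOdd_dForm a b).parity, map_neg, LinearMap.neg_apply, map_neg, act_dForm, act_dForm,
      e1, e2, (isEven_evenPart y).parity, (isOdd_oddPart y).parity]
    have e3 : act y ((1 : NegAlg) ⊗ₜ[ℂ] v) =
        act (evenPart y) (1 ⊗ₜ v) + act (oddPart y) (1 ⊗ₜ v) := by
      rw [← LinearMap.add_apply, ← map_add, evenPart_add_oddPart]
    have e4 : bracket (dForm a b) y =
        - bracket (evenPart y) (dForm a b) + bracket (oddPart y) (dForm a b) := by
      rw [(isEven_evenPart y).bracket_skew, neg_neg, (isOdd_oddPart y).bracket_comm (isOdd_dForm a b),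
        ← bracket_add_right, evenPart_add_oddPart]
    rw [e3, e4]
    simp only [map_add, map_neg, LinearMap.add_apply, LinearMap.neg_apply, smul_add, smul_neg]
    abel
  | hv t =>
    rw [(isEven_dV t).parity, ← LinearMap.add_apply, ← map_add, evenPart_add_oddPart, act_dV,
      act_dV, act_nv_smul, (isEven_dV t).bracket_skew, map_neg, LinearMap.neg_apply]
    abel
  | hn x hx =>
    induction y using L_induction with
    | hadd y y' h h' =>
      simp only [map_add, LinearMap.add_apply, bracket_add_right, h, h']
      abel
    | hsmul c y h =>
      simp only [map_smul, LinearMap.smul_apply, bracket_smul_right, h, smul_add]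
    | hd a b =>
      have e1 : evenPart (dForm a b) = 0 := rfl
      have e2 : oddPart (dForm a b) = dForm a b := rfl
      rw [e1, e2, map_zero, LinearMap.zero_apply, zero_add, act_dForm, act_nd_smul, act_dForm]
    | hv t =>
      have e1 : evenPart (dV t) = dV t := rfl
      have e2 : oddPart (dV t) = 0 := rfl
      rw [e1, e2, map_zero, LinearMap.zero_apply, add_zero, act_dV, act_nv_smul, act_dV]
    | hn y hy =>
      rw [act_one_tmul_of_mem hy, act_one_tmul_of_mem hx, act_one_tmul_of_mem hx,
        act_one_tmul_of_mem (evenPart_mem hy), act_one_tmul_of_mem (parity_mem hx),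
        act_one_tmul_of_mem (oddPart_mem hy), act_one_tmul_of_mem (bracket_mem_nonnegPart hx hy),
        linPart_of_isOdd (isOdd_oddPart y), linPart_evenPart, zero_lie, TensorProduct.tmul_zero,
        add_zero, ← TensorProduct.tmul_add, linPart_bracket hx hy, lie_lie]
      abel_nf

/-- The subspace on which the defining relations of `U(L)` hold. -/
def relSubmodule (V : Type) [AddCommGroup V] [Module ℂ V] [LieRingModule sl5 V]
    [LieModule ℂ sl5 V] : Submodule ℂ (NegMod V) where
  carrier := {n | (∀ x y, IsEven x → IsEven y →
      act x (act y n) = act y (act x n) + act (bracket x y) n) ∧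
    (∀ x y, IsEven x → IsOdd y → act x (act y n) = act y (act x n) + act (bracket x y) n) ∧
    ∀ x y, IsOdd x → IsOdd y → act x (act y n) = - act y (act x n) + act (bracket x y) n}
  zero_mem' := by simp
  add_mem' := by
    rintro n m ⟨h1, h2, h3⟩ ⟨k1, k2, k3⟩
    refine ⟨fun x y hx hy => ?_, fun x y hx hy => ?_, fun x y hx hy => ?_⟩
    · simp only [map_add]; rw [h1 x y hx hy, k1 x y hx hy]; abel
    · simp only [map_add]; rw [h2 x y hx hy, k2 x y hx hy]; abel
    · simp only [map_add]; rw [h3 x y hx hy, k3 x y hx hy]; abel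
  smul_mem' := by
    rintro c n ⟨h1, h2, h3⟩
    refine ⟨fun x y hx hy => ?_, fun x y hx hy => ?_, fun x y hx hy => ?_⟩
    · simp only [map_smul]; rw [h1 x y hx hy, smul_add]
    · simp only [map_smul]; rw [h2 x y hx hy, smul_add]
    · simp only [map_smul]; rw [h3 x y hx hy, smul_add, smul_neg]

/-- Passing from `n` to `d n` brings in brackets of `x` and `y` with `d`, of the opposite parity, so
the parity cases have to be propagated together. The Jacobi identities close the induction. -/
lemma mem_relSubmodule (n : NegMod V) : n ∈ relSubmodule V := by
  refine NegMod.induction _ (fun v => ?_) (fun a b n hn => ?_) (fun t n hn => ?_) n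
  · have eE : ∀ y : L, IsEven y → evenPart y = y ∧ oddPart y = 0 := fun y hy =>
      ⟨L_ext rfl (show 0 = y.1.2 from hy.symm), L_ext rfl hy⟩
    have eO : ∀ y : L, IsOdd y → evenPart y = 0 ∧ oddPart y = y := fun y hy =>
      ⟨L_ext hy rfl, L_ext (show 0 = y.1.1 from hy.symm) rfl⟩
    refine ⟨fun x y hx hy => ?_, fun x y hx hy => ?_, fun x y hx hy => ?_⟩
    · rw [act_act_one_tmul, (eE y hy).1, (eE y hy).2, map_zero, LinearMap.zero_apply, add_zero]
    · rw [act_act_one_tmul, (eO y hy).1, (eO y hy).2, hx.parity, map_zero, LinearMap.zero_apply,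
        zero_add]
    · rw [act_act_one_tmul, (eO y hy).1, (eO y hy).2, hx.parity, map_zero, LinearMap.zero_apply,
        zero_add, map_neg, LinearMap.neg_apply, map_neg]
  · obtain ⟨h1, h2, h3⟩ := hn
    have od := isOdd_dForm a b
    refine ⟨fun x y hx hy => ?_, fun x y hx hy => ?_, fun x y hx hy => ?_⟩
    · simp only [act_nd_smul, map_add, hx.parity, hy.parity, (hx.bracket_isEven hy).parity,
        jacobi_even_even_odd hx hy od, map_sub, LinearMap.sub_apply]
      rw [h1 x y hx hy, h2 x _ hx (hy.bracket_isOdd od), h2 y _ hy (hx.bracket_isOdd od), smul_add]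
      abel
    · simp only [act_nd_smul, map_add, hx.parity, hy.parity, (hx.bracket_isOdd hy).parity,
        jacobi_even_odd_odd hx hy od, map_sub, LinearMap.sub_apply, map_neg, LinearMap.neg_apply]
      rw [h2 x y hx hy, h1 x _ hx (hy.bracket_isEven od), h3 _ y (hx.bracket_isOdd od) hy]
      simp only [smul_add, smul_neg]
      abel
    · have hyd := hy.bracket_isEven od
      have hxd := hx.bracket_isEven od
      simp only [act_nd_smul, map_add, hx.parity, hy.parity, (hx.bracket_isEven hy).parity,
        jacobi_odd_odd_odd hx hy od, map_sub, LinearMap.sub_apply, map_neg, LinearMap.neg_apply]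
      rw [h3 x y hx hy, h2 _ y hxd hy, h2 _ x hyd hx]
      simp only [smul_add, smul_neg]
      abel
  · obtain ⟨h1, h2, h3⟩ := hn
    have ev := isEven_dV t
    refine ⟨fun x y hx hy => ?_, fun x y hx hy => ?_, fun x y hx hy => ?_⟩
    · simp only [act_nv_smul, map_add, jacobi_dV x y, LinearMap.add_apply]
      rw [h1 x y hx hy, h1 x _ hx (hy.bracket_isEven ev), h1 _ y (hx.bracket_isEven ev) hy]
      simp only [smul_add]
      abel
    · simp only [act_nv_smul, map_add, jacobi_dV x y, LinearMap.add_apply]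
      rw [h2 x y hx hy, h2 x _ hx (hy.bracket_isOdd ev), h2 _ y (hx.bracket_isEven ev) hy]
      simp only [smul_add]
      abel
    · simp only [act_nv_smul, map_add, jacobi_dV x y, LinearMap.add_apply]
      rw [h3 x y hx hy, h3 x _ hx (hy.bracket_isOdd ev), h3 _ y (hx.bracket_isOdd ev) hy]
      simp only [smul_add, smul_neg]
      abel

instance : Ring (Module.End ℂ (NegMod V)) := Module.End.instRing

/-- `NegMod V` as a representation of `U(L)`. -/
def negRep (V : Type) [AddCommGroup V] [Module ℂ V] [LieRingModule sl5 V] [LieModule ℂ sl5 V] :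
    U →ₐ[ℂ] Module.End ℂ (NegMod V) :=
  RingQuot.liftAlgHom ℂ ⟨TensorAlgebra.lift ℂ act, by
    intro x y h
    cases h with
    | even_left x y hx =>
      simp only [map_add, map_mul, TensorAlgebra.lift_ι_apply]
      refine LinearMap.ext fun n => ?_
      have h := mem_relSubmodule n
      simp only [LinearMap.add_apply, Module.End.mul_apply]
      rw [← evenPart_add_oddPart y, bracket_add_right]
      simp only [map_add, LinearMap.add_apply]
      rw [h.1 x _ hx (isEven_evenPart y), h.2.1 x _ hx (isOdd_oddPart y)]
      abel
    | odd_odd x y hx hy =>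
      simp only [map_add, map_mul, TensorAlgebra.lift_ι_apply]
      refine LinearMap.ext fun n => ?_
      have h := (mem_relSubmodule n).2.2 x y hx hy
      simp only [LinearMap.add_apply, Module.End.mul_apply]
      rw [h]
      abel⟩

lemma negRep_toU (x : L) : negRep V (toU x) = act x := by
  refine (RingQuot.liftAlgHom_mkAlgHom_apply ℂ _ _ _).trans ?_
  simp

/-- The map `U ⊗ V → NegMod V`. -/
def toNegMod (V : Type) [AddCommGroup V] [Module ℂ V] [LieRingModule sl5 V] [LieModule ℂ sl5 V] :
    U ⊗[ℂ] V →ₗ[ℂ] NegMod V :=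
  TensorProduct.lift (LinearMap.mk₂ ℂ (fun (u : U) (v : V) => negRep V u (1 ⊗ₜ v))
    (fun a b v => by rw [map_add, LinearMap.add_apply])
    (fun c a v => by rw [map_smul, LinearMap.smul_apply])
    (fun a v w => by rw [TensorProduct.tmul_add, map_add])
    (fun c a v => by rw [TensorProduct.tmul_smul, map_smul]))

lemma toNegMod_tmul (u : U) (v : V) : toNegMod V (u ⊗ₜ v) = negRep V u (1 ⊗ₜ v) := rfl

lemma toNegMod_smul (u : U) (z : U ⊗[ℂ] V) : toNegMod V (u • z) = negRep V u (toNegMod V z) := by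
  induction z using TensorProduct.induction_on with
  | zero => simp
  | tmul a v =>
    rw [TensorProduct.smul_tmul', smul_eq_mul, toNegMod_tmul, map_mul, toNegMod_tmul]
    rfl
  | add x y hx hy => rw [smul_add, map_add, hx, hy, map_add, map_add]

/-- The defining relations of the Verma module hold in `NegAlg ⊗ V`. Hence a linear relation between
vectors of the Verma module yields one in `NegAlg ⊗ V`; only this half of Poincaré–Birkhoff–Witt is
used. -/
lemma toNegMod_of_mem {z : U ⊗[ℂ] V} (hz : z ∈ vermaRel V) : toNegMod V z = 0 := by
  induction hz using Submodule.span_induction with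
  | mem z hz =>
    obtain ⟨x, hx, v, rfl⟩ := hz
    rw [map_sub, toNegMod_tmul, toNegMod_tmul, negRep_toU, map_one, act_one_tmul_of_mem hx,
      Module.End.one_apply, sub_self]
  | zero => exact map_zero _
  | add x y _ _ hx hy => rw [map_add, hx, hy, add_zero]
  | smul u x _ hx => rw [toNegMod_smul, hx, map_zero]

end Relations

/-! ### Independence in degrees one and two -/

/-- The coordinates of `dx_a ∧ dx_b`. -/
def elem (a b i j : Fin 5) : ℂ := (if i = a ∧ j = b then 1 else 0) - (if i = b ∧ j = a then 1 else 0)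

lemma elem_skew (a b i j : Fin 5) : elem a b i j = - elem b a i j := by
  rw [elem, elem, neg_sub]

lemma sum_elem_smul {W : Type*} [AddCommGroup W] [Module ℂ W] (f : Fin 5 → Fin 5 → W)
    (hf : ∀ a b, f a b = - f b a) (i j : Fin 5) :
    ∑ a, ∑ b, elem a b i j • f a b = (2 : ℂ) • f i j := by
  simp only [elem, sub_smul, ite_smul, one_smul, zero_smul, Finset.sum_sub_distrib, ite_and,
    Finset.sum_ite_eq, Finset.mem_univ, if_true, Finset.sum_ite_irrel, Finset.sum_const_zero]
  rw [hf j i, sub_neg_eq_add, two_smul]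

lemma sum_smul_elem {W : Type*} [AddCommGroup W] [Module ℂ W] (f : Fin 5 → Fin 5 → W)
    (hf : ∀ a b, f a b = - f b a) (a b : Fin 5) :
    ∑ i, ∑ j, elem a b i j • f i j = (2 : ℂ) • f a b := by
  have : ∀ i j, elem a b i j = elem i j a b := fun i j => by
    simp only [elem, eq_comm, and_comm]
  simp only [this]
  exact sum_elem_smul f hf a b

/-- The truncation of `NegAlg` in degrees at most two. -/
abbrev Trunc : Type :=
  ℂ × (Fin 5 → Fin 5 → ℂ) × ((Fin 5 → Fin 5 → Fin 5 → Fin 5 → ℂ) × (Fin 5 → ℂ))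

/-- The action of `d_ab` on the truncation. -/
def truncD (a b : Fin 5) : Module.End ℂ Trunc where
  toFun s := (0, s.1 • elem a b,
    (fun i j k l => (1 / 2) * (elem a b i j * s.2.1 k l - s.2.1 i j * elem a b k l),
      fun t => (1 / 4) * ∑ k, ∑ l, (levi a b k l t : ℂ) * s.2.1 k l))
  map_add' s r := by
    refine Prod.ext (by simp) (Prod.ext (by simp [add_smul]) (Prod.ext ?_ ?_))
    · ext i j k l
      simp only [Prod.snd_add, Prod.fst_add, Pi.add_apply]
      ring
    · ext t
      simp only [Prod.snd_add, Prod.fst_add, Pi.add_apply, mul_add, Finset.sum_add_distrib]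
  map_smul' c s := by
    refine Prod.ext (by simp) (Prod.ext (by simp [mul_smul]) (Prod.ext ?_ ?_))
    · ext i j k l
      simp only [Prod.smul_snd, Prod.smul_fst, Pi.smul_apply, smul_eq_mul, RingHom.id_apply]
      ring
    · ext t
      simp only [Prod.smul_snd, Prod.smul_fst, Pi.smul_apply, smul_eq_mul, RingHom.id_apply,
        Finset.mul_sum]
      refine Finset.sum_congr rfl fun k _ => Finset.sum_congr rfl fun l _ => by ring

/-- The action of `∂_t` on the truncation. -/
def truncV (t : Fin 5) : Module.End ℂ Trunc where
  toFun s := (0, 0, (0, fun r => if r = t then s.1 else 0))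
  map_add' s r := by
    refine Prod.ext (by simp) (Prod.ext (by simp) (Prod.ext (by simp) ?_))
    ext t'
    simp only [Prod.snd_add, Prod.fst_add, Pi.add_apply]
    split_ifs <;> simp
  map_smul' c s := by
    refine Prod.ext (by simp) (Prod.ext (by simp) (Prod.ext (by simp) ?_))
    ext t'
    simp only [Prod.smul_snd, Prod.smul_fst, Pi.smul_apply, RingHom.id_apply]
    split_ifs <;> simp

lemma sum_levi_elem (a b c d t : Fin 5) :
    ∑ k, ∑ l, (levi a b k l t : ℂ) * elem c d k l = 2 * (levi a b c d t : ℂ) := by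
  have h := sum_smul_elem (fun k l => (levi a b k l t : ℂ))
    (fun k l => by rw [levi_skew_right]; push_cast; ring) c d
  simp only [smul_eq_mul] at h
  rw [← h]
  exact Finset.sum_congr rfl fun k _ => Finset.sum_congr rfl fun l _ => mul_comm _ _

/-- The truncation as a representation. -/
def truncRep : NegAlg →ₐ[ℂ] Module.End ℂ Trunc :=
  NegAlg.lift truncD truncV
    (fun a b => LinearMap.ext fun s => by
      rw [LinearMap.neg_apply]
      refine Prod.ext neg_zero.symm (Prod.ext ?_ (Prod.ext ?_ ?_))
      · ext i j
        change s.1 * elem a b i j = -(s.1 * elem b a i j)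
        rw [elem_skew]; ring
      · ext i j k l
        change (1 / 2) * (elem a b i j * s.2.1 k l - s.2.1 i j * elem a b k l) =
          -((1 / 2) * (elem b a i j * s.2.1 k l - s.2.1 i j * elem b a k l))
        rw [elem_skew a b i j, elem_skew a b k l]; ring
      · ext t
        change (1 / 4) * ∑ k, ∑ l, (levi a b k l t : ℂ) * s.2.1 k l =
          -((1 / 4) * ∑ k, ∑ l, (levi b a k l t : ℂ) * s.2.1 k l)
        simp only [levi_skew_left a b]
        push_cast
        simp only [neg_mul, Finset.sum_neg_distrib]
        ring)
    (fun a b c e => LinearMap.ext fun s => by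
      rw [LinearMap.add_apply, LinearMap.sum_apply]
      refine Prod.ext ?_ (Prod.ext ?_ (Prod.ext ?_ ?_))
      · rw [Prod.fst_sum]
        simp [truncD, truncV]
      · rw [Prod.snd_sum, Prod.fst_sum]
        simp [truncD, truncV]
      · rw [Prod.snd_sum, Prod.snd_sum, Prod.fst_sum]
        ext i j k l
        simp [truncD, truncV]
        ring
      · rw [Prod.snd_sum, Prod.snd_sum, Prod.snd_sum]
        ext t
        rw [Finset.sum_apply]
        change (1 / 4) * ∑ k, ∑ l, (levi a b k l t : ℂ) * (s.1 * elem c e k l) +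
          (1 / 4) * ∑ k, ∑ l, (levi c e k l t : ℂ) * (s.1 * elem a b k l) =
          ∑ r, (levi a b c e r : ℂ) * (if t = r then s.1 else 0)
        simp only [mul_left_comm _ s.1, ← Finset.mul_sum, sum_levi_elem, mul_ite, mul_zero,
          Finset.sum_ite_eq, Finset.mem_univ, if_true]
        rw [levi_symm c e a b]
        ring)
    (fun a b t => LinearMap.ext fun s => by
      simp [truncD, truncV, Module.End.mul_apply]
      rfl)
    (fun s t => LinearMap.ext fun s => by
      simp [truncV, Module.End.mul_apply])

/-- The image of `a` in the truncation of `NegAlg`. -/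
def truncOf : NegAlg →ₗ[ℂ] Trunc where
  toFun a := truncRep a (1, 0, 0, 0)
  map_add' a b := by rw [map_add, LinearMap.add_apply]
  map_smul' c a := by rw [map_smul, LinearMap.smul_apply]; rfl

lemma truncOf_nd (a b : Fin 5) : truncOf (nd a b) = (0, elem a b, (0, 0)) := by
  change truncRep (nd a b) (1, 0, 0, 0) = _
  rw [truncRep, NegAlg.lift_nd]
  refine Prod.ext rfl (Prod.ext (one_smul _ _) (Prod.ext ?_ ?_))
  · ext i j k l; simp [truncD]
  · ext t; simp [truncD]

/-- This encodes `d d' = ½ (d d' − d' d) + ½ [d, d']`: the tensor slot records the alternating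
product and the vector slot the bracket. -/
lemma truncOf_nd_mul_nd (a b c d : Fin 5) : truncOf (nd a b * nd c d) = (0, 0,
    (fun i j k l => (1 / 2) * (elem a b i j * elem c d k l - elem c d i j * elem a b k l),
      fun t => (1 / 2) * (levi a b c d t : ℂ))) := by
  change truncRep (nd a b * nd c d) (1, 0, 0, 0) = _
  rw [map_mul, Module.End.mul_apply]
  have h : truncRep (nd c d) (1, 0, 0, 0) = _ := truncOf_nd c d
  rw [h, truncRep, NegAlg.lift_nd]
  refine Prod.ext rfl (Prod.ext (zero_smul _ _) (Prod.ext rfl ?_))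
  ext t
  change (1 / 4) * ∑ k, ∑ l, (levi a b k l t : ℂ) * elem c d k l = _
  rw [sum_levi_elem]
  ring

lemma truncOf_nv (t : Fin 5) : truncOf (nv t) = (0, 0, (0, fun r => if r = t then 1 else 0)) := by
  change truncRep (nv t) (1, 0, 0, 0) = _
  rw [truncRep, NegAlg.lift_nv]
  rfl

section

variable {V : Type} [AddCommGroup V] [Module ℂ V]

/-- Contraction of `NegAlg ⊗ V` with a linear form on the truncation. -/
def contract (f : Trunc →ₗ[ℂ] ℂ) : NegMod V →ₗ[ℂ] V :=
  (TensorProduct.lid ℂ V).toLinearMap ∘ₗ LinearMap.rTensor V (f ∘ₗ truncOf)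

lemma contract_tmul (f : Trunc →ₗ[ℂ] ℂ) (a : NegAlg) (v : V) :
    contract f (a ⊗ₜ v) = f (truncOf a) • v := by
  simp [contract]

lemma nd_tmul_independent (v : Fin 5 → Fin 5 → V) (hv : ∀ a b, v a b = - v b a)
    (h : ∑ a, ∑ b, nd a b ⊗ₜ[ℂ] v a b = 0) (i j : Fin 5) : v i j = 0 := by
  have h' := congrArg (contract (LinearMap.proj j ∘ₗ LinearMap.proj i ∘ₗ LinearMap.fst ℂ _ _ ∘ₗ
    LinearMap.snd ℂ _ _)) h
  simp only [map_sum, contract_tmul, truncOf_nd, map_zero] at h'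
  change ∑ a, ∑ b, elem a b i j • v a b = 0 at h'
  rw [sum_elem_smul v hv] at h'
  simpa using h'

/-- Tensors in `⋀²(⋀² ℂ^5) ⊗ W`. -/
structure IsSkew {W : Type*} [AddCommGroup W] (w : Fin 5 → Fin 5 → Fin 5 → Fin 5 → W) : Prop where
  left : ∀ a b c d, w a b c d = - w b a c d
  swap : ∀ a b c d, w a b c d = - w c d a b

lemma IsSkew.right {W : Type*} [AddCommGroup W] {w : Fin 5 → Fin 5 → Fin 5 → Fin 5 → W}
    (h : IsSkew w) (a b c d : Fin 5) : w a b c d = - w a b d c := by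
  rw [h.swap, h.left, h.swap d c a b, neg_neg]

/-- The `∂_t` are invisible in the tensor slot, and by skewness reading off `(i, j, k, l)` there
returns `4 w_ijkl`. Once `w = 0`, the vector slot returns `u`. -/
lemma nd_mul_nd_tmul_independent (w : Fin 5 → Fin 5 → Fin 5 → Fin 5 → V) (hw : IsSkew w)
    (u : Fin 5 → V) (h : ∑ a, ∑ b, ∑ c, ∑ d, (nd a b * nd c d) ⊗ₜ[ℂ] w a b c d +
      ∑ t, nv t ⊗ₜ[ℂ] u t = 0) : (∀ i j k l, w i j k l = 0) ∧ ∀ t, u t = 0 := by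
  have hw0 : ∀ i j k l, w i j k l = 0 := by
    intro i j k l
    have h' := congrArg (contract (LinearMap.proj l ∘ₗ LinearMap.proj k ∘ₗ LinearMap.proj j ∘ₗ
      LinearMap.proj i ∘ₗ LinearMap.fst ℂ _ _ ∘ₗ LinearMap.snd ℂ _ _ ∘ₗ LinearMap.snd ℂ _ _)) h
    simp only [map_add, map_sum, contract_tmul, truncOf_nd_mul_nd, truncOf_nv, map_zero] at h'
    change ∑ a, ∑ b, ∑ c, ∑ d, ((1 / 2) * (elem a b i j * elem c d k l -
      elem c d i j * elem a b k l)) • w a b c d + ∑ t, (0 : ℂ) • u t = 0 at h'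
    have e : ∀ a b c d, ((1 / 2) * (elem a b i j * elem c d k l -
        elem c d i j * elem a b k l)) • w a b c d = (1 / 2 : ℂ) • (elem a b i j • elem c d k l •
          w a b c d) - (1 / 2 : ℂ) • (elem a b k l • elem c d i j • w a b c d) := by
      intro a b c d
      simp only [smul_smul, ← sub_smul]
      congr 1
      ring
    simp only [e, zero_smul, Finset.sum_const_zero, add_zero, Finset.sum_sub_distrib,
      ← Finset.smul_sum, sum_elem_smul _ (hw.right _ _)] at h'
    rw [sum_elem_smul (fun a b => (2 : ℂ) • w a b k l) (fun a b => by rw [hw.left, smul_neg]),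
      sum_elem_smul (fun a b => (2 : ℂ) • w a b i j) (fun a b => by rw [hw.left, smul_neg]),
      hw.swap k l i j] at h'
    simp only [smul_neg, sub_neg_eq_add, smul_smul, ← add_smul] at h'
    exact (smul_eq_zero.mp h').resolve_left (by norm_num)
  -- With `w = 0` the projection to the vector slot isolates `u_s`.
  refine ⟨hw0, fun s => ?_⟩
  have h' := congrArg (contract (LinearMap.proj s ∘ₗ LinearMap.snd ℂ _ _ ∘ₗ LinearMap.snd ℂ _ _ ∘ₗ
    LinearMap.snd ℂ _ _)) h
  simp only [hw0, TensorProduct.tmul_zero, Finset.sum_const_zero, zero_add, map_sum, contract_tmul,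
    truncOf_nv, map_zero] at h'
  change ∑ t, (if s = t then (1 : ℂ) else 0) • u t = 0 at h'
  simpa using h'

end

section

variable {V : Type} [AddCommGroup V] [Module ℂ V] [LieRingModule sl5 V]

lemma vmk_add_right (u : U) (v w : V) : vmk u (v + w) = vmk u v + vmk u w := by
  simp only [vmk, TensorProduct.tmul_add, map_add]

lemma vmk_add_left (u u' : U) (v : V) : vmk (u + u') v = vmk u v + vmk u' v := by
  simp only [vmk, TensorProduct.add_tmul, map_add]

lemma vmk_smul_right (c : ℂ) (u : U) (v : V) : vmk u (c • v) = c • vmk u v := by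
  rw [vmk, TensorProduct.tmul_smul]
  rfl

lemma vmk_smul_left (c : ℂ) (u : U) (v : V) : vmk (c • u) v = c • vmk u v := by
  rw [vmk, ← TensorProduct.smul_tmul']
  rfl

lemma smul_vmk (u u' : U) (v : V) : u • vmk u' v = vmk (u * u') v := rfl

/-- `vmk` as a bilinear map. -/
def vmkL : U →ₗ[ℂ] V →ₗ[ℂ] Verma V :=
  LinearMap.mk₂ ℂ vmk vmk_add_left vmk_smul_left vmk_add_right vmk_smul_right

lemma mkQ_tmul (u : U) (v : V) : (vermaRel V).mkQ (u ⊗ₜ[ℂ] v) = vmk u v := rfl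

lemma vmkL_apply (u : U) (v : V) : vmkL u v = vmk u v := rfl

lemma vmk_mul_of_mem (u : U) {x : L} (hx : x ∈ nonnegPart) (v : V) :
    vmk (u * toU x) v = vmk u ⁅linPart x, v⁆ := by
  have h : (vermaRel V).mkQ (toU x ⊗ₜ[ℂ] v - 1 ⊗ₜ[ℂ] ⁅linPart x, v⁆) = 0 := by
    rw [Submodule.mkQ_apply, Submodule.Quotient.mk_eq_zero]
    exact Submodule.subset_span ⟨x, hx, v, rfl⟩
  rw [map_sub, sub_eq_zero] at h
  have h2 := congrArg (fun z => u • z) h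
  have h3 : u • vmk (toU x) v = u • vmk 1 ⁅linPart x, v⁆ := h2
  rwa [smul_vmk, smul_vmk, mul_one] at h3

variable [LieModule ℂ sl5 V]

lemma negRep_dForm (a b : Fin 5) (n : NegMod V) : negRep V (toU (dForm a b)) n = nd a b • n := by
  rw [negRep_toU, act_dForm]

lemma toNegMod_eq_zero {z : U ⊗[ℂ] V} (hz : (vermaRel V).mkQ z = 0) : toNegMod V z = 0 := by
  rw [Submodule.mkQ_apply, Submodule.Quotient.mk_eq_zero] at hz
  exact toNegMod_of_mem hz

lemma vmk_dForm_independent (v : Fin 5 → Fin 5 → V) (hv : ∀ a b, v a b = - v b a)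
    (h : ∑ a, ∑ b, vmk (toU (dForm a b)) (v a b) = 0) (i j : Fin 5) : v i j = 0 := by
  refine nd_tmul_independent v hv ?_ i j
  have h2 : (vermaRel V).mkQ (∑ a, ∑ b, toU (dForm a b) ⊗ₜ[ℂ] v a b) = 0 := by
    simp only [map_sum, mkQ_tmul]
    exact h
  have h3 := toNegMod_eq_zero h2
  simp only [map_sum, toNegMod_tmul, negRep_dForm, TensorProduct.smul_tmul', smul_eq_mul, mul_one]
    at h3
  exact h3

lemma vmk_dForm_mul_dForm_independent (w : Fin 5 → Fin 5 → Fin 5 → Fin 5 → V) (hw : IsSkew w)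
    (u : Fin 5 → V) (h : ∑ a, ∑ b, ∑ c, ∑ d, vmk (toU (dForm a b) * toU (dForm c d)) (w a b c d) +
      ∑ t, vmk (toU (dV t)) (u t) = 0) : (∀ i j k l, w i j k l = 0) ∧ ∀ t, u t = 0 := by
  refine nd_mul_nd_tmul_independent w hw u ?_
  have h2 : (vermaRel V).mkQ (∑ a, ∑ b, ∑ c, ∑ d, (toU (dForm a b) * toU (dForm c d)) ⊗ₜ[ℂ]
      w a b c d + ∑ t, toU (dV t) ⊗ₜ[ℂ] u t) = 0 := by
    simp only [map_sum, map_add, mkQ_tmul]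
    exact h
  have h3 := toNegMod_eq_zero h2
  simp only [map_sum, map_add, toNegMod_tmul, map_mul, Module.End.mul_apply, act_dForm,
    TensorProduct.smul_tmul', smul_eq_mul, mul_one, negRep_toU, act_dV] at h3
  exact h3

end

/-! ### Relations in `U` and linear fields -/

lemma toU_mul_of_isEven {x : L} (hx : IsEven x) (y : L) :
    toU x * toU y = toU y * toU x + toU (bracket x y) := by
  have h := RingQuot.mkAlgHom_rel ℂ (EnvRel.even_left x y hx)
  rwa [map_add, map_mul, map_mul] at h

lemma toU_mul_of_isOdd {x y : L} (hx : IsOdd x) (hy : IsOdd y) :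
    toU x * toU y = - (toU y * toU x) + toU (bracket x y) := by
  have h := RingQuot.mkAlgHom_rel ℂ (EnvRel.odd_odd x y hx hy)
  rw [map_add, map_mul, map_mul] at h
  rw [neg_add_eq_sub]
  exact eq_sub_of_add_eq h

lemma D_X (p q : Fin 5) : D p (MvPowerSeries.X q : PS) = if p = q then 1 else 0 := by
  split_ifs with h
  · rw [h, MvPowerSeries.pderiv_X_self]
  · first
    | rw [MvPowerSeries.pderiv_X_of_ne h]
    | rw [MvPowerSeries.pderiv_X_of_ne (Ne.symm h)]

lemma D_dForm_snd (t a b c d : Fin 5) : D t ((dForm a b).1.2 c d) = 0 := MvPowerSeries.pderiv_C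

/-- The linear vector field `∑ A_ij x_i ∂_j`. -/
def linField (A : sl5) : L :=
  ⟨(fun j => ∑ i, A.mat i j • MvPowerSeries.X i, 0), by
    refine ⟨?_, by simp, by simp [extD]⟩
    have h : ∑ i, A.mat i i = 0 := A.2
    have e : ∀ j, D j (∑ i, A.mat i j • (MvPowerSeries.X i : PS)) = MvPowerSeries.C (A.mat j j) := by
      intro j
      rw [map_sum, Finset.sum_eq_single j]
      · rw [Derivation.map_smul, MvPowerSeries.pderiv_X_self, MvPowerSeries.smul_eq_C_mul, mul_one]
      · intro i _ hi
        rw [Derivation.map_smul, D_X, if_neg hi.symm, smul_zero]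
      · simp
    simp only [div, e, ← map_sum, h, map_zero]⟩

lemma D_linField (A : sl5) (i j : Fin 5) :
    D i ((linField A).1.1 j) = MvPowerSeries.C (A.mat i j) := by
  change D i (∑ k, A.mat k j • (MvPowerSeries.X k : PS)) = _
  rw [map_sum, Finset.sum_eq_single i]
  · rw [Derivation.map_smul, MvPowerSeries.pderiv_X_self, MvPowerSeries.smul_eq_C_mul, mul_one]
  · intro k _ hk
    rw [Derivation.map_smul, D_X, if_neg hk.symm, smul_zero]
  · simp

lemma isEven_linField (A : sl5) : IsEven (linField A) := rfl

lemma linField_mem (A : sl5) : linField A ∈ nonnegPart := by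
  rw [mem_nonnegPart]
  refine ⟨fun j => ?_, fun i j => map_zero _⟩
  change c0 (∑ k, A.mat k j • (MvPowerSeries.X k : PS)) = 0
  rw [map_sum, Finset.sum_eq_zero]
  intro k _
  rw [c0_smul, MvPowerSeries.constantCoeff_X, mul_zero]

lemma linPart_linField (A : sl5) : linPart (linField A) = A := by
  refine sl5.ext ?_
  ext i j
  rw [linPart_mat, D_linField, MvPowerSeries.constantCoeff_C]

/-- The coefficients of `d_ab` are constant, so the Lie derivative involves only first derivatives
of the field. -/
lemma bracket_dForm_of_isEven {x : L} (hx : IsEven x) (B : Fin 5 → Fin 5 → ℂ)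
    (hB : ∀ i j, D i (x.1.1 j) = MvPowerSeries.C (B i j)) (a b : Fin 5) :
    bracket x (dForm a b) = ∑ k, (B k a • dForm k b + B k b • dForm a k) := by
  refine L_ext ?_ ?_
  · rw [bracket_fst, show x.1.2 = 0 from hx, show (dForm a b).1.1 = 0 from rfl,
      vfBracket_zero_right, formBracket_zero_left, add_zero, coe_sum_fst]
    ext1 i
    rw [Finset.sum_apply]
    symm
    refine Finset.sum_eq_zero fun k _ => ?_
    change B k a • (0 : PS) + B k b • (0 : PS) = 0
    rw [smul_zero, smul_zero, add_zero]
  · rw [bracket_snd, show (dForm a b).1.1 = 0 from rfl, lieDeriv_zero_left, sub_zero, coe_sum_snd]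
    ext1 i; ext1 j
    rw [Finset.sum_apply, Finset.sum_apply, lieDeriv]
    have h1 : ∀ m, x.1.1 m * D m ((dForm a b).1.2 i j) = 0 := fun m => by
      rw [show D m ((dForm a b).1.2 i j) = 0 from MvPowerSeries.pderiv_C, mul_zero]
    have h2 : ∀ k, (B k a • dForm k b + B k b • dForm a k).1.2 i j =
        MvPowerSeries.C (B k a) * (dForm k b).1.2 i j +
        MvPowerSeries.C (B k b) * (dForm a k).1.2 i j := fun k => by
      rw [← MvPowerSeries.smul_eq_C_mul, ← MvPowerSeries.smul_eq_C_mul]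
      rfl
    simp only [h1, h2, hB, zero_add]
    simp only [dForm_snd, ite_and, mul_sub, mul_ite, mul_one, mul_zero,
      Finset.sum_add_distrib, Finset.sum_sub_distrib, Finset.sum_ite_eq', Finset.sum_ite_eq,
      Finset.mem_univ, if_true, Finset.sum_ite_irrel, Finset.sum_const_zero]
    ring

lemma bracket_linField_dForm (A : sl5) (a b : Fin 5) :
    bracket (linField A) (dForm a b) = ∑ k, (A.mat k a • dForm k b + A.mat k b • dForm a k) :=
  bracket_dForm_of_isEven (isEven_linField A) _ (D_linField A) a b

lemma bracket_linField_dV (A : sl5) (t : Fin 5) :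
    bracket (linField A) (dV t) = - ∑ j, A.mat t j • dV j := by
  refine L_ext ?_ ?_
  · ext1 i
    rw [bracket_dV_fst, D_linField]
    change _ = -(∑ j, A.mat t j • dV j).1.1 i
    rw [coe_sum_fst, Finset.sum_apply]
    congr 1
    have h : ∀ j, (A.mat t j • dV j).1.1 i = if i = j then MvPowerSeries.C (A.mat t j) else 0 := by
      intro j
      change A.mat t j • MvPowerSeries.C (if i = j then (1 : ℂ) else 0) = _
      split_ifs
      · rw [MvPowerSeries.smul_eq_C_mul, map_one, mul_one]
      · simp
    simp only [h, Finset.sum_ite_eq, Finset.mem_univ, if_true]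
  · ext1 i; ext1 j
    rw [bracket_dV_snd]
    change _ = -(∑ j, A.mat t j • dV j).1.2 i j
    rw [coe_sum_snd, Finset.sum_apply, Finset.sum_apply]
    have h : ∀ k, (A.mat t k • dV k).1.2 i j = 0 := fun k =>
      smul_zero (A := PS) (A.mat t k)
    simp only [h, Finset.sum_const_zero]
    rw [show (linField A).1.2 i j = 0 from rfl, map_zero]

/-- The form `x_i d_jk + x_j d_ik`. -/
def zForm (i j k : Fin 5) : L :=
  ⟨(0, fun a b => MvPowerSeries.X i * (dForm j k).1.2 a b +
      MvPowerSeries.X j * (dForm i k).1.2 a b), by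
    refine ⟨by simp [div], fun a b => ?_, fun a b c => ?_⟩
    · dsimp only
      rw [skew_snd (dForm j k) a b, skew_snd (dForm i k) a b]; ring
    · have h : ∀ p q r s t, D p ((dForm q r).1.2 s t) = 0 := fun p q r s t => MvPowerSeries.pderiv_C
      simp only [extD, map_add, Derivation.leibniz, smul_eq_mul, h, mul_zero, zero_add]
      simp only [dForm_snd]
      simp only [D_X, ite_and]
      split_ifs <;> ring⟩

lemma isOdd_zForm (i j k : Fin 5) : IsOdd (zForm i j k) := rfl

lemma zForm_mem (i j k : Fin 5) : zForm i j k ∈ nonnegPart := by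
  rw [mem_nonnegPart]
  refine ⟨fun _ => map_zero _, fun a b => ?_⟩
  change c0 (MvPowerSeries.X i * (dForm j k).1.2 a b + MvPowerSeries.X j * (dForm i k).1.2 a b) = 0
  simp

/-- The coefficient `B_pq` of `x_p ∂_q` in `[x_i d_jk + x_j d_ik, d_ab]`. -/
def zMat (i j k a b : Fin 5) (p q : Fin 5) : ℂ :=
  (if p = i then (levi j k a b q : ℂ) else 0) + (if p = j then (levi i k a b q : ℂ) else 0)

/-- The bracket is a linear field. It is through these elements of `sl_5` that `L_1` constrains a
singular vector. -/
lemma bracket_zForm_dForm_fst (i j k a b t : Fin 5) : (bracket (zForm i j k) (dForm a b)).1.1 t =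
    (levi j k a b t : PS) * MvPowerSeries.X i + (levi i k a b t : PS) * MvPowerSeries.X j := by
  rw [bracket_fst, show (dForm a b).1.1 = 0 from rfl, vfBracket_zero_right, zero_add,
    formBracket_dForm]
  have e : ∀ p q, (levi p q a b t : PS) * (zForm i j k).1.2 p q =
      ((if p = j then (if q = k then (levi p q a b t : PS) * MvPowerSeries.X i else 0) else 0) -
       (if p = k then (if q = j then (levi p q a b t : PS) * MvPowerSeries.X i else 0) else 0)) +
      ((if p = i then (if q = k then (levi p q a b t : PS) * MvPowerSeries.X j else 0) else 0) -
       (if p = k then (if q = i then (levi p q a b t : PS) * MvPowerSeries.X j else 0) else 0)) := by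
    intro p q
    change (levi p q a b t : PS) * (MvPowerSeries.X i * (dForm j k).1.2 p q +
      MvPowerSeries.X j * (dForm i k).1.2 p q) = _
    simp only [dForm_snd, ite_and, mul_sub, mul_add, mul_ite, mul_one, mul_zero]
  simp only [e, Finset.sum_add_distrib, Finset.sum_sub_distrib, Finset.sum_ite_eq',
    Finset.mem_univ, if_true, Finset.sum_ite_irrel, Finset.sum_const_zero]
  rw [levi_skew_left k j, levi_skew_left k i, MvPowerSeries.smul_eq_C_mul]
  have h2 : (MvPowerSeries.C (1 / 2 : ℂ) : PS) * 2 = 1 := by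
    rw [← map_ofNat (MvPowerSeries.C : ℂ →+* PS) 2, ← map_mul]
    norm_num
  push_cast
  linear_combination ((levi j k a b t : PS) * MvPowerSeries.X i +
    (levi i k a b t : PS) * MvPowerSeries.X j) * h2

lemma D_bracket_zForm_dForm (i j k a b p q : Fin 5) :
    D p ((bracket (zForm i j k) (dForm a b)).1.1 q) = MvPowerSeries.C (zMat i j k a b p q) := by
  rw [bracket_zForm_dForm_fst, zMat]
  simp only [map_add, Derivation.leibniz, Derivation.map_intCast, D_X, smul_eq_mul, smul_zero,
    mul_zero, add_zero, mul_ite, mul_one]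
  congr 1
  · split_ifs <;> simp
  · split_ifs <;> simp

lemma bracket_zForm_dForm_mem (i j k a b : Fin 5) :
    bracket (zForm i j k) (dForm a b) ∈ nonnegPart := by
  rw [mem_nonnegPart]
  refine ⟨fun t => ?_, fun p q => ?_⟩
  · rw [bracket_zForm_dForm_fst]; simp
  · rw [show (bracket (zForm i j k) (dForm a b)).1.2 = 0 from
      (isOdd_zForm i j k).bracket_isEven (isOdd_dForm a b)]
    exact map_zero _

lemma linPart_bracket_zForm_dForm (i j k a b p q : Fin 5) :
    (linPart (bracket (zForm i j k) (dForm a b))).mat p q = zMat i j k a b p q := by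
  rw [linPart_mat, D_bracket_zForm_dForm, MvPowerSeries.constantCoeff_C]

lemma bracket_zForm_dV (i j k t : Fin 5) : bracket (zForm i j k) (dV t) =
    - ((if t = i then (1 : ℂ) else 0) • dForm j k + (if t = j then (1 : ℂ) else 0) • dForm i k) := by
  refine L_ext ?_ ?_
  · ext1 p
    rw [bracket_dV_fst]
    change - D t 0 = -((if t = i then (1 : ℂ) else 0) • (0 : PS) +
      (if t = j then (1 : ℂ) else 0) • (0 : PS))
    rw [smul_zero, smul_zero, map_zero, add_zero]
  · ext1 p; ext1 q
    rw [bracket_dV_snd]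
    change - D t (MvPowerSeries.X i * (dForm j k).1.2 p q + MvPowerSeries.X j * (dForm i k).1.2 p q)
      = -((if t = i then (1 : ℂ) else 0) • (dForm j k).1.2 p q +
        (if t = j then (1 : ℂ) else 0) • (dForm i k).1.2 p q)
    simp only [map_add, Derivation.leibniz, smul_eq_mul, D_dForm_snd, mul_zero, zero_add, D_X, ite_smul,
      one_smul, zero_smul, mul_ite, mul_one, mul_zero]

/-! ### Elements of degree two -/

section

variable {V : Type} [AddCommGroup V] [Module ℂ V] [LieRingModule sl5 V]

/-- The element `∑ d_ab d_cd ⊗ w_abcd + ∑ ∂_t ⊗ u_t`. -/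
def vec2 (w : Fin 5 → Fin 5 → Fin 5 → Fin 5 → V) (u : Fin 5 → V) : Verma V :=
  ∑ a, ∑ b, ∑ c, ∑ d, vmk (toU (dForm a b) * toU (dForm c d)) (w a b c d) +
    ∑ t, vmk (toU (dV t)) (u t)

lemma vec2_add (w w' : Fin 5 → Fin 5 → Fin 5 → Fin 5 → V) (u u' : Fin 5 → V) :
    vec2 (w + w') (u + u') = vec2 w u + vec2 w' u' := by
  simp only [vec2, Pi.add_apply, vmk_add_right, Finset.sum_add_distrib]
  abel

lemma vec2_smul (c : ℂ) (w : Fin 5 → Fin 5 → Fin 5 → Fin 5 → V) (u : Fin 5 → V) :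
    vec2 (c • w) (c • u) = c • vec2 w u := by
  simp only [vec2, Pi.smul_apply, vmk_smul_right, Finset.smul_sum, smul_add]

lemma IsSkew.add {W : Type*} [AddCommGroup W] {w w' : Fin 5 → Fin 5 → Fin 5 → Fin 5 → W}
    (h : IsSkew w) (h' : IsSkew w') : IsSkew (w + w') :=
  ⟨fun a b c d => by simp only [Pi.add_apply]; rw [h.left, h'.left, neg_add],
    fun a b c d => by simp only [Pi.add_apply]; rw [h.swap, h'.swap, neg_add]⟩

lemma IsSkew.smul {W : Type*} [AddCommGroup W] [Module ℂ W]
    {w : Fin 5 → Fin 5 → Fin 5 → Fin 5 → W} (k : ℂ) (h : IsSkew w) : IsSkew (k • w) :=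
  ⟨fun a b c d => by simp only [Pi.smul_apply]; rw [h.left, smul_neg],
    fun a b c d => by simp only [Pi.smul_apply]; rw [h.swap, smul_neg]⟩

/-- Every tensor can be made skew-symmetric without changing the element. -/
lemma exists_isSkew_vec2 (w : Fin 5 → Fin 5 → Fin 5 → Fin 5 → V)
    (u : Fin 5 → V) :
    vec2 w u = vec2 (fun a b c d => (1 / 2 : ℂ) • (w a b c d - w c d a b))
      (fun t => u t + (1 / 2 : ℂ) • ∑ a, ∑ b, ∑ c, ∑ d, (levi a b c d t : ℂ) • w a b c d) := by
  -- Termwise `d d' = −d' d + [d, d']`, followed by exchanging the names of the two pairs.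
  have h1 : ∑ a, ∑ b, ∑ c, ∑ d, vmk (toU (dForm a b) * toU (dForm c d)) (w a b c d) =
      - ∑ a, ∑ b, ∑ c, ∑ d, vmk (toU (dForm a b) * toU (dForm c d)) (w c d a b) +
      ∑ t, vmk (toU (dV t)) (∑ a, ∑ b, ∑ c, ∑ d, (levi a b c d t : ℂ) • w a b c d) := by
    have h2 := sum_four_comm fun a b c d =>
      vmk (toU (dForm c d) * toU (dForm a b)) (w a b c d)
    have h3 : ∑ t, vmk (toU (dV t)) (∑ a, ∑ b, ∑ c, ∑ d, (levi a b c d t : ℂ) • w a b c d) =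
        ∑ a, ∑ b, ∑ c, ∑ d, vmk (toU (bracket (dForm a b) (dForm c d))) (w a b c d) := by
      simp only [← vmkL_apply, map_sum, bracket_dForm_dForm, LinearMap.sum_apply, map_smul,
        LinearMap.smul_apply]
      rw [Finset.sum_comm]
      refine Finset.sum_congr rfl fun a _ => ?_
      rw [Finset.sum_comm]
      refine Finset.sum_congr rfl fun b _ => ?_
      rw [Finset.sum_comm]
      refine Finset.sum_congr rfl fun c _ => ?_
      rw [Finset.sum_comm]
    have h5 : ∀ a b c d, vmk (toU (dForm a b) * toU (dForm c d)) (w a b c d) =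
        - vmk (toU (dForm c d) * toU (dForm a b)) (w a b c d) +
          vmk (toU (bracket (dForm a b) (dForm c d))) (w a b c d) := fun a b c d => by
      conv_lhs => rw [toU_mul_of_isOdd (isOdd_dForm a b) (isOdd_dForm c d)]
      simp only [← vmkL_apply, map_add, map_neg, LinearMap.add_apply, LinearMap.neg_apply]
    rw [h3]
    conv_lhs => simp only [h5, Finset.sum_add_distrib, Finset.sum_neg_distrib]
    rw [← h2]
  -- One half of the quadratic sum is kept; the other half is rewritten by `h1`.
  have h4 : vec2 w u = (1 / 2 : ℂ) • (∑ a, ∑ b, ∑ c, ∑ d, vmk (toU (dForm a b) * toU (dForm c d))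
      (w a b c d) + ∑ a, ∑ b, ∑ c, ∑ d, vmk (toU (dForm a b) * toU (dForm c d))
      (w a b c d)) + ∑ t, vmk (toU (dV t)) (u t) := by
    rw [← two_smul ℂ, smul_smul, vec2]
    norm_num
  rw [h4]
  nth_rewrite 2 [h1]
  simp only [vec2, ← vmkL_apply, map_add, map_sub, map_smul, smul_sub, Finset.sum_add_distrib,
    Finset.sum_sub_distrib, ← Finset.smul_sum, smul_add, smul_neg]
  abel

lemma constPart_of_gradedPiece {x : L}
    (hx : x ∈ gradedPiece (-((1 : ℕ) : ℤ)) ∨ x ∈ gradedPiece (-((2 : ℕ) : ℤ))) :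
    constPart x = x := by
  have hC : ∀ f : PS, (∀ m, MvPowerSeries.coeff m f ≠ 0 → m.degree = 0) →
      MvPowerSeries.C (c0 f) = f := by
    intro f hf
    ext m
    rw [MvPowerSeries.coeff_C]
    split_ifs with h
    · rw [h, MvPowerSeries.coeff_zero_eq_constantCoeff_apply]
    · by_contra h'
      exact h ((Finsupp.degree_eq_zero_iff m).mp (hf m (Ne.symm h')))
  refine L_ext ?_ ?_
  · ext1 i
    rw [constPart_fst]
    refine hC _ fun m hm => ?_
    rcases hx with hx | hx <;> have := hx.1 i m hm <;> omega
  · ext1 i; ext1 j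
    rw [constPart_snd]
    refine hC _ fun m hm => ?_
    rcases hx with hx | hx <;> have := hx.2 i j m hm <;> omega

lemma list_of_sum_eq_two {α : Type*} (l : List (ℕ × α)) (hl : ∀ p ∈ l, 0 < p.1)
    (hsum : (l.map Prod.fst).sum = 2) :
    (∃ y, l = [(2, y)]) ∨ ∃ y z, l = [(1, y), (1, z)] := by
  rcases l with _ | ⟨⟨p, y⟩, l⟩
  · simp at hsum
  have hp := hl (p, y) (by simp)
  rcases l with _ | ⟨⟨q, z⟩, l⟩
  · left
    simp at hsum
    exact ⟨y, by rw [hsum]⟩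
  have hq := hl (q, z) (by simp)
  rcases l with _ | ⟨⟨r, z'⟩, l⟩
  · right
    simp at hsum hp hq
    exact ⟨y, z, by rw [show p = 1 by omega, show q = 1 by omega]⟩
  have hr := hl (r, z') (by simp)
  simp at hsum hp hq hr
  omega

/-- Degree two is spanned by `L_{-2}` and products of two elements of `L_{-1}`. The coefficients of
such a product are skew within each pair, and antisymmetrising the exchange of the pairs costs only
brackets, which are absorbed in `u`. -/
lemma mem_vermaDeg_two {m : Verma V} (hm : m ∈ vermaDeg V 2) :
    ∃ w u, IsSkew w ∧ m = vec2 w u := by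
  have hP : ∀ w : Fin 5 → Fin 5 → Fin 5 → Fin 5 → V, (∀ a b c d, w a b c d = - w b a c d) →
      (∀ a b c d, w a b c d = - w a b d c) → ∀ u, ∃ w' u', IsSkew w' ∧ vec2 w u = vec2 w' u' := by
    intro w h1 h2 u
    refine ⟨_, _, ⟨fun a b c d => ?_, fun a b c d => ?_⟩, exists_isSkew_vec2 w u⟩
    · rw [h1 a b c d, h2 c d a b, ← smul_neg]; congr 1; abel
    · rw [← smul_neg, neg_sub]
  induction hm using Submodule.span_induction with
  | zero => exact ⟨0, 0, ⟨by simp, by simp⟩, by simp [vec2, ← vmkL_apply]⟩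
  | add x y _ _ hx hy =>
    obtain ⟨w, u, h, rfl⟩ := hx
    obtain ⟨w', u', h', rfl⟩ := hy
    exact ⟨_, _, h.add h', (vec2_add _ _ _ _).symm⟩
  | smul c x _ hx =>
    obtain ⟨w, u, h, rfl⟩ := hx
    exact ⟨_, _, h.smul c, (vec2_smul _ _ _).symm⟩
  | mem x hx =>
    obtain ⟨y, hy, v, rfl⟩ := hx
    induction hy using Submodule.span_induction with
    | zero => exact ⟨0, 0, ⟨by simp, by simp⟩, by simp [vec2, ← vmkL_apply]⟩
    | add x y _ _ hx hy =>
      obtain ⟨w, u, h, e⟩ := hx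
      obtain ⟨w', u', h', e'⟩ := hy
      exact ⟨_, _, h.add h', by rw [vmk_add_left, e, e', vec2_add]⟩
    | smul c x _ hx =>
      obtain ⟨w, u, h, e⟩ := hx
      exact ⟨_, _, h.smul c, by rw [vmk_smul_left, e, vec2_smul]⟩
    | mem y hy =>
      obtain ⟨l, hl, hsum, rfl⟩ := hy
      have hone : ∀ x ∈ gradedPiece (-((1 : ℕ) : ℤ)), x = (1 / 2 : ℂ) •
          ∑ a, ∑ b, c0 (x.1.2 a b) • dForm a b := fun x hx => by
        rw [← constPart_of_gradedPiece (Or.inl hx)]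
        conv_lhs => rw [constPart_apply]
        have h : ∀ t, c0 (x.1.1 t) = 0 := fun t => by
          by_contra h
          rw [← MvPowerSeries.coeff_zero_eq_constantCoeff_apply] at h
          have := hx.1 t 0 h
          omega
        simp only [h, zero_smul, Finset.sum_const_zero, zero_add]
        rw [constPart_of_gradedPiece (Or.inl hx)]
      have htwo : ∀ x ∈ gradedPiece (-((2 : ℕ) : ℤ)), x = ∑ t, c0 (x.1.1 t) • dV t :=
          fun x hx => by
        rw [← constPart_of_gradedPiece (Or.inr hx)]
        conv_lhs => rw [constPart_apply]
        have h : ∀ a b, c0 (x.1.2 a b) = 0 := fun a b => by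
          by_contra h
          rw [← MvPowerSeries.coeff_zero_eq_constantCoeff_apply] at h
          have := hx.2 a b 0 h
          omega
        simp only [h, zero_smul, Finset.sum_const_zero, smul_zero, add_zero]
        rw [constPart_of_gradedPiece (Or.inr hx)]
      rcases list_of_sum_eq_two l (fun p hp => (hl p hp).1) hsum with ⟨y, rfl⟩ | ⟨y, z, rfl⟩
      · have hy := htwo y (hl (2, y) (by simp)).2
        refine ⟨0, fun t => c0 (y.1.1 t) • v, ⟨by simp, by simp⟩, ?_⟩
        simp only [List.map_cons, List.map_nil, List.prod_cons, List.prod_nil, mul_one]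
        conv_lhs => rw [hy]
        simp only [vec2, ← vmkL_apply, map_sum, map_smul, LinearMap.sum_apply,
          LinearMap.smul_apply, Pi.zero_apply, map_zero, Finset.sum_const_zero, zero_add]
      · have hy := hone y (hl (1, y) (by simp)).2
        have hz := hone z (hl (1, z) (by simp)).2
        have hs : ∀ (x : L) a b, c0 (x.1.2 a b) = - c0 (x.1.2 b a) := fun x a b => by
          rw [skew_snd x a b, map_neg]
        -- The constant 1/4 is the product of the two halves in the expansions of `y` and `z` over
        -- ordered pairs.
        obtain ⟨w', u', hw', e⟩ := hP
          (fun a b c d => ((1 / 4 : ℂ) * (c0 (y.1.2 a b) * c0 (z.1.2 c d))) • v)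
          (fun a b c d => by rw [hs y a b, neg_mul, mul_neg, neg_smul])
          (fun a b c d => by rw [hs z c d, mul_neg, mul_neg, neg_smul]) 0
        refine ⟨w', u', hw', ?_⟩
        rw [← e]
        simp only [List.map_cons, List.map_nil, List.prod_cons, List.prod_nil, mul_one]
        conv_lhs => rw [hy, hz]
        simp only [vec2, ← vmkL_apply, map_sum, map_smul, LinearMap.sum_apply,
          LinearMap.smul_apply, Pi.zero_apply, map_zero, Finset.sum_const_zero, add_zero,
          smul_mul_assoc, mul_smul_comm, Finset.sum_mul, Finset.mul_sum, Finset.smul_sum,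
          smul_smul]
        conv_lhs => rw [sum_four_comm]
        refine Finset.sum_congr rfl fun a _ => Finset.sum_congr rfl fun b _ =>
          Finset.sum_congr rfl fun c _ => Finset.sum_congr rfl fun d _ => ?_
        refine congrArg (fun r : ℂ => r • vmkL (toU (dForm a b) * toU (dForm c d)) v) ?_
        ring

end

/-! ### The action of linear fields and of `L_1` on elements of degree two -/

lemma sum_swap_first_last {β W : Type*} [Fintype β] [AddCommMonoid W] (f : Fin 5 → β → Fin 5 → W) :
    ∑ a, ∑ b, ∑ k, f a b k = ∑ a, ∑ b, ∑ k, f k b a := by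
  rw [Finset.sum_comm]
  conv_rhs => rw [Finset.sum_comm]
  exact Finset.sum_congr rfl fun b _ => Finset.sum_comm

/-- Renaming one summation index moves a matrix from the basis elements `d_ab` to the coefficients.
-/
lemma sum_swap_five {W : Type*} [AddCommMonoid W] (f : Fin 5 → Fin 5 → Fin 5 → Fin 5 → Fin 5 → W) :
    (∑ a, ∑ b, ∑ c, ∑ d, ∑ k, f a b c d k = ∑ a, ∑ b, ∑ c, ∑ d, ∑ k, f k b c d a) ∧
    (∑ a, ∑ b, ∑ c, ∑ d, ∑ k, f a b c d k = ∑ a, ∑ b, ∑ c, ∑ d, ∑ k, f a k c d b) ∧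
    (∑ a, ∑ b, ∑ c, ∑ d, ∑ k, f a b c d k = ∑ a, ∑ b, ∑ c, ∑ d, ∑ k, f a b k d c) ∧
    (∑ a, ∑ b, ∑ c, ∑ d, ∑ k, f a b c d k = ∑ a, ∑ b, ∑ c, ∑ d, ∑ k, f a b c k d) := by
  refine ⟨?_, ?_, ?_, ?_⟩
  · have h := sum_swap_first_last fun a (p : Fin 5 × Fin 5 × Fin 5) k => f a p.1 p.2.1 p.2.2 k
    simpa only [Fintype.sum_prod_type] using h
  · refine Finset.sum_congr rfl fun a _ => ?_
    have h := sum_swap_first_last fun b (p : Fin 5 × Fin 5) k => f a b p.1 p.2 k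
    simpa only [Fintype.sum_prod_type] using h
  · exact Finset.sum_congr rfl fun a _ => Finset.sum_congr rfl fun b _ =>
      sum_swap_first_last fun c d k => f a b c d k
  · exact Finset.sum_congr rfl fun a _ => Finset.sum_congr rfl fun b _ =>
      Finset.sum_congr rfl fun c _ => Finset.sum_comm

section

variable {V : Type} [AddCommGroup V] [Module ℂ V] [LieRingModule sl5 V]

/-- The natural action on the coefficients `w_abcd`. -/
def actTensor (A : sl5) (w : Fin 5 → Fin 5 → Fin 5 → Fin 5 → V) (a b c d : Fin 5) : V :=
  ⁅A, w a b c d⁆ + ∑ k, (A.mat a k • w k b c d + A.mat b k • w a k c d + A.mat c k • w a b k d +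
    A.mat d k • w a b c k)

/-- The natural action on the coefficients `u_t`. -/
def actVec (A : sl5) (u : Fin 5 → V) (t : Fin 5) : V := ⁅A, u t⁆ - ∑ i, A.mat i t • u i

lemma toU_bracket_linField (A : sl5) (a b : Fin 5) : toU (bracket (linField A) (dForm a b)) =
    ∑ k, (A.mat k a • toU (dForm k b) + A.mat k b • toU (dForm a k)) := by
  simp only [bracket_linField_dForm, map_sum, map_add, map_smul]

lemma linField_smul_vec2 (A : sl5) (w : Fin 5 → Fin 5 → Fin 5 → Fin 5 → V) (u : Fin 5 → V) :
    toU (linField A) • vec2 w u = vec2 (actTensor A w) (actVec A u) := by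
  have h1 : ∀ a b c d, toU (linField A) • vmk (toU (dForm a b) * toU (dForm c d)) (w a b c d) =
      vmk (toU (dForm a b) * toU (dForm c d)) ⁅A, w a b c d⁆ +
      ∑ k, (A.mat k a • vmk (toU (dForm k b) * toU (dForm c d)) (w a b c d)) +
      ∑ k, (A.mat k b • vmk (toU (dForm a k) * toU (dForm c d)) (w a b c d)) +
      ∑ k, (A.mat k c • vmk (toU (dForm a b) * toU (dForm k d)) (w a b c d)) +
      ∑ k, (A.mat k d • vmk (toU (dForm a b) * toU (dForm c k)) (w a b c d)) := by
    intro a b c d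
    have e : toU (linField A) * (toU (dForm a b) * toU (dForm c d)) =
        toU (dForm a b) * toU (dForm c d) * toU (linField A) +
        toU (bracket (linField A) (dForm a b)) * toU (dForm c d) +
        toU (dForm a b) * toU (bracket (linField A) (dForm c d)) := by
      rw [← mul_assoc, toU_mul_of_isEven (isEven_linField A), add_mul, mul_assoc,
        toU_mul_of_isEven (isEven_linField A), mul_add, mul_assoc]
      abel
    rw [smul_vmk, e, vmk_add_left, vmk_add_left, vmk_mul_of_mem _ (linField_mem A),
      linPart_linField, toU_bracket_linField, toU_bracket_linField]
    simp only [← vmkL_apply, Finset.sum_mul, Finset.mul_sum, add_mul, mul_add, smul_mul_assoc,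
      mul_smul_comm, map_sum, map_add, map_smul, LinearMap.sum_apply, LinearMap.add_apply,
      LinearMap.smul_apply, Finset.sum_add_distrib]
    abel
  have h2 : ∀ t, toU (linField A) • vmk (toU (dV t)) (u t) = vmk (toU (dV t)) ⁅A, u t⁆ -
      ∑ i, A.mat t i • vmk (toU (dV i)) (u t) := by
    intro t
    rw [smul_vmk, toU_mul_of_isEven (isEven_linField A), vmk_add_left,
      vmk_mul_of_mem _ (linField_mem A), linPart_linField, bracket_linField_dV]
    simp only [← vmkL_apply, map_neg, map_sum, map_smul, LinearMap.neg_apply, LinearMap.sum_apply,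
      LinearMap.smul_apply, sub_eq_add_neg]
  rw [vec2, smul_add, Finset.smul_sum, Finset.smul_sum]
  simp only [Finset.smul_sum, h1, h2]
  simp only [Finset.sum_add_distrib, Finset.sum_sub_distrib]
  rw [(sum_swap_five fun a b c d k => A.mat k a • vmk (toU (dForm k b) * toU (dForm c d))
      (w a b c d)).1,
    (sum_swap_five fun a b c d k => A.mat k b • vmk (toU (dForm a k) * toU (dForm c d))
      (w a b c d)).2.1,
    (sum_swap_five fun a b c d k => A.mat k c • vmk (toU (dForm a b) * toU (dForm k d))
      (w a b c d)).2.2.1,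
    (sum_swap_five fun a b c d k => A.mat k d • vmk (toU (dForm a b) * toU (dForm c k))
      (w a b c d)).2.2.2,
    Finset.sum_comm (f := fun t i => A.mat t i • vmk (toU (dV i)) (u t))]
  simp only [vec2, actTensor, actVec, ← vmkL_apply, map_add, map_sub, map_sum, map_smul,
    Finset.sum_add_distrib, Finset.sum_sub_distrib]
  abel

/-- The component `[x_i d_jk + x_j d_ik, d_ab]` in `sl_5`. -/
def zLin (i j k a b : Fin 5) : sl5 := linPart (bracket (zForm i j k) (dForm a b))

lemma zLin_mat (i j k a b p q : Fin 5) : (zLin i j k a b).mat p q = zMat i j k a b p q :=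
  linPart_bracket_zForm_dForm i j k a b p q

/-- The coefficients of `(x_i d_jk + x_j d_ik) (∑ d_ab d_cd ⊗ w_abcd + ∑ ∂_t ⊗ u_t)`. -/
def actZ (i j k : Fin 5) (w : Fin 5 → Fin 5 → Fin 5 → Fin 5 → V) (u : Fin 5 → V) (c d : Fin 5) :
    V :=
  (2 : ℂ) • ∑ a, ∑ b, ⁅zLin i j k a b, w a b c d⁆ +
    ∑ a, ∑ b, ∑ q, (zMat i j k a b c q • w a b q d + zMat i j k a b d q • w a b c q) -
    (1 / 2 : ℂ) • (elem j k c d • u i + elem i k c d • u j)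

lemma toU_bracket_bracket_zForm (i j k a b c d : Fin 5) :
    toU (bracket (bracket (zForm i j k) (dForm a b)) (dForm c d)) =
      ∑ q, (zMat i j k a b q c • toU (dForm q d) + zMat i j k a b q d • toU (dForm c q)) := by
  rw [bracket_dForm_of_isEven ((isOdd_zForm i j k).bracket_isEven (isOdd_dForm a b)) _
    (fun p q => D_bracket_zForm_dForm i j k a b p q)]
  simp only [map_sum, map_add, map_smul]

/-- Elements of `L_1` annihilate `V`, so moving `z` to the right leaves `−d_ab [z, d_cd]`, `d_cd [z,
d_ab]` and `[[z, d_ab], d_cd]`. Skewness of `w` absorbs the sign of the first term, which after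
summation coincides with the second; this is the factor 2 in `actZ`. -/
lemma zForm_smul_vmk (i j k : Fin 5) {w : Fin 5 → Fin 5 → Fin 5 → Fin 5 → V} (hw : IsSkew w)
    (a b c d : Fin 5) : toU (zForm i j k) • vmk (toU (dForm a b) * toU (dForm c d)) (w a b c d) =
      vmk (toU (dForm a b)) ⁅zLin i j k c d, w c d a b⁆ +
      vmk (toU (dForm c d)) ⁅zLin i j k a b, w a b c d⁆ +
      ∑ q, zMat i j k a b q c • vmk (toU (dForm q d)) (w a b c d) +
      ∑ q, zMat i j k a b q d • vmk (toU (dForm c q)) (w a b c d) := by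
    have e : toU (zForm i j k) * (toU (dForm a b) * toU (dForm c d)) =
        toU (dForm a b) * toU (dForm c d) * toU (zForm i j k) -
        toU (dForm a b) * toU (bracket (zForm i j k) (dForm c d)) +
        (toU (dForm c d) * toU (bracket (zForm i j k) (dForm a b)) +
        toU (bracket (bracket (zForm i j k) (dForm a b)) (dForm c d))) := by
      rw [← toU_mul_of_isEven ((isOdd_zForm i j k).bracket_isEven (isOdd_dForm a b)), ← mul_assoc,
        toU_mul_of_isOdd (isOdd_zForm i j k) (isOdd_dForm a b), add_mul, neg_mul, mul_assoc,
        toU_mul_of_isOdd (isOdd_zForm i j k) (isOdd_dForm c d), mul_add, mul_neg, mul_assoc]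
      abel
    rw [smul_vmk, e, toU_bracket_bracket_zForm, sub_eq_add_neg]
    simp only [vmk_add_left]
    rw [vmk_mul_of_mem _ (zForm_mem i j k), vmk_mul_of_mem _ (bracket_zForm_dForm_mem i j k a b),
      linPart_of_isOdd (isOdd_zForm i j k), zero_lie, ← neg_mul,
      vmk_mul_of_mem _ (bracket_zForm_dForm_mem i j k c d), hw.swap c d a b]
    change vmkL _ 0 + _ + _ = _
    simp only [← vmkL_apply, map_neg, map_zero, lie_neg, map_sum, map_add, map_smul,
      LinearMap.neg_apply, LinearMap.sum_apply, LinearMap.add_apply, LinearMap.smul_apply,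
      Finset.sum_add_distrib, zero_add, zLin]
    abel

lemma zForm_smul_vmk_dV (i j k : Fin 5) (u : Fin 5 → V) (t : Fin 5) : toU (zForm i j k) • vmk (toU (dV t)) (u t) =
      - ((if t = i then vmk (toU (dForm j k)) (u t) else 0) +
        (if t = j then vmk (toU (dForm i k)) (u t) else 0)) := by
    have e : toU (zForm i j k) * toU (dV t) = toU (dV t) * toU (zForm i j k) +
        toU (bracket (zForm i j k) (dV t)) := by
      have := toU_mul_of_isEven (isEven_dV t) (zForm i j k)
      rw [(isEven_dV t).bracket_skew, map_neg] at this
      rw [this]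
      abel
    rw [smul_vmk, e, vmk_add_left, vmk_mul_of_mem _ (zForm_mem i j k),
      linPart_of_isOdd (isOdd_zForm i j k), zero_lie, bracket_zForm_dV]
    simp only [← vmkL_apply, map_neg, map_zero, map_add, map_smul, LinearMap.neg_apply,
      LinearMap.add_apply, LinearMap.smul_apply, zero_add]
    split_ifs <;> simp only [one_smul, zero_smul, map_zero, LinearMap.zero_apply]

lemma zForm_smul_vec2 (i j k : Fin 5) {w : Fin 5 → Fin 5 → Fin 5 → Fin 5 → V} (hw : IsSkew w)
    (u : Fin 5 → V) :
    toU (zForm i j k) • vec2 w u = ∑ c, ∑ d, vmk (toU (dForm c d)) (actZ i j k w u c d) := by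
  -- Every unordered pair occurs twice, which the factor 1/2 in `actZ` compensates.
  have h3 : ∀ (p q : Fin 5) (v : V), ∑ c, ∑ d, elem p q c d • vmk (toU (dForm c d)) v =
      (2 : ℂ) • vmk (toU (dForm p q)) v := fun p q v =>
    sum_smul_elem (fun c d => vmk (toU (dForm c d)) v) (fun a b => by
      rw [dForm_skew a b, map_neg, ← vmkL_apply, map_neg]; rfl) p q
  have h4 : toU (zForm i j k) • vec2 w u =
      ((∑ a, ∑ b, ∑ c, ∑ d, vmk (toU (dForm a b)) ⁅zLin i j k c d, w c d a b⁆ +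
        ∑ a, ∑ b, ∑ c, ∑ d, vmk (toU (dForm c d)) ⁅zLin i j k a b, w a b c d⁆) +
      (∑ a, ∑ b, ∑ c, ∑ d, ∑ q, zMat i j k a b c q • vmk (toU (dForm c d)) (w a b q d) +
        ∑ a, ∑ b, ∑ c, ∑ d, ∑ q, zMat i j k a b d q • vmk (toU (dForm c d)) (w a b c q))) -
      (vmk (toU (dForm j k)) (u i) + vmk (toU (dForm i k)) (u j)) := by
    rw [vec2, smul_add, Finset.smul_sum, Finset.smul_sum]
    simp only [Finset.smul_sum, zForm_smul_vmk i j k hw, zForm_smul_vmk_dV]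
    simp only [Finset.sum_add_distrib, Finset.sum_neg_distrib, Finset.sum_ite_eq',
      Finset.mem_univ, if_true]
    rw [(sum_swap_five fun a b c d q => zMat i j k a b q c • vmk (toU (dForm q d))
        (w a b c d)).2.2.1,
      (sum_swap_five fun a b c d q => zMat i j k a b q d • vmk (toU (dForm c q))
        (w a b c d)).2.2.2, sub_eq_add_neg]
    simp only [add_assoc]
  have h5 : ∀ c d, vmk (toU (dForm c d)) (actZ i j k w u c d) =
      ((∑ a, ∑ b, vmk (toU (dForm c d)) ⁅zLin i j k a b, w a b c d⁆ +
        ∑ a, ∑ b, vmk (toU (dForm c d)) ⁅zLin i j k a b, w a b c d⁆) +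
      (∑ a, ∑ b, ∑ q, zMat i j k a b c q • vmk (toU (dForm c d)) (w a b q d) +
        ∑ a, ∑ b, ∑ q, zMat i j k a b d q • vmk (toU (dForm c d)) (w a b c q))) -
      ((1 / 2 : ℂ) • elem j k c d • vmk (toU (dForm c d)) (u i) +
        (1 / 2 : ℂ) • elem i k c d • vmk (toU (dForm c d)) (u j)) := fun c d => by
    rw [← two_smul ℂ]
    simp only [actZ, ← vmkL_apply, map_add, map_sub, map_sum, map_smul, Finset.sum_add_distrib,
      smul_add]
  have h6 := sum_four_comm fun a b c d => vmk (toU (dForm a b)) ⁅zLin i j k c d, w c d a b⁆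
  have h7 := sum_four_comm fun a b c d => vmk (toU (dForm c d)) ⁅zLin i j k a b, w a b c d⁆
  have h8 := sum_four_comm fun a b c d =>
    ∑ q, zMat i j k a b c q • vmk (toU (dForm c d)) (w a b q d)
  have h9 := sum_four_comm fun a b c d =>
    ∑ q, zMat i j k a b d q • vmk (toU (dForm c d)) (w a b c q)
  rw [h4, h6, h7, h8, h9]
  simp only [h5, Finset.sum_add_distrib, Finset.sum_sub_distrib, ← Finset.smul_sum]
  rw [h3, h3, smul_smul, smul_smul]
  norm_num

end

/-! ### Equations for the image of a vector under a morphism. -/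

section

variable {V W : Type} [AddCommGroup V] [Module ℂ V] [LieRingModule sl5 V]
  [AddCommGroup W] [Module ℂ W] [LieRingModule sl5 W]

lemma map_vmk_lie (φ : Verma V →ₗ[U] Verma W) (A : sl5) (v : V) :
    φ (vmk 1 ⁅A, v⁆) = toU (linField A) • φ (vmk 1 v) := by
  rw [← map_smul, smul_vmk, mul_one, ← one_mul (toU (linField A)),
    vmk_mul_of_mem _ (linField_mem A), linPart_linField]

lemma IsSkew.actTensor (A : sl5) {w : Fin 5 → Fin 5 → Fin 5 → Fin 5 → W} (hw : IsSkew w) :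
    IsSkew (actTensor A w) := by
  constructor
  · intro a b c d
    simp only [E510.actTensor, neg_add, ← lie_neg, ← Finset.sum_neg_distrib, ← smul_neg]
    rw [← hw.left]
    refine congrArg _ (Finset.sum_congr rfl fun k _ => ?_)
    rw [← hw.left, ← hw.left, ← hw.left, ← hw.left]
    abel
  · intro a b c d
    simp only [E510.actTensor, neg_add, ← lie_neg, ← Finset.sum_neg_distrib, ← smul_neg]
    rw [← hw.swap]
    refine congrArg _ (Finset.sum_congr rfl fun k _ => ?_)
    rw [← hw.swap, ← hw.swap, ← hw.swap, ← hw.swap]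
    abel

variable [LieModule ℂ sl5 W]

/-- The independence in degree two is applied to the difference, whose tensor part is again skew. -/
lemma vec2_injective {w w' : Fin 5 → Fin 5 → Fin 5 → Fin 5 → W} (hw : IsSkew w) (hw' : IsSkew w')
    {u u' : Fin 5 → W} (h : vec2 w u = vec2 w' u') : w = w' ∧ u = u' := by
  have h2 : vec2 (w + (-1 : ℂ) • w') (u + (-1 : ℂ) • u') = 0 := by
    rw [vec2_add, vec2_smul, h]
    module
  obtain ⟨h3, h4⟩ := vmk_dForm_mul_dForm_independent _ (hw.add (hw'.smul _)) _ h2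
  refine ⟨?_, ?_⟩
  · funext a b c d
    have := h3 a b c d
    simp only [Pi.add_apply, Pi.smul_apply, neg_smul, one_smul] at this
    exact eq_of_sub_eq_zero (by rw [sub_eq_add_neg]; exact this)
  · funext t
    have := h4 t
    simp only [Pi.add_apply, Pi.smul_apply, neg_smul, one_smul] at this
    exact eq_of_sub_eq_zero (by rw [sub_eq_add_neg]; exact this)

lemma vec2_zero : vec2 (V := W) (fun _ _ _ _ => 0) (fun _ => 0) = 0 := by
  simp [vec2, ← vmkL_apply]

lemma IsSkew.zero : IsSkew (W := W) (fun _ _ _ _ => 0) := ⟨by simp, by simp⟩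

lemma elem_skew_right (a b i j : Fin 5) : elem a b i j = - elem a b j i := by
  rw [elem, elem]
  simp only [and_comm]
  ring

/-- `L_1` kills `1 ⊗ v`, hence also its image under `φ`. The coefficients can be read off because
they are skew in `c`, `d` and the `d_cd` are independent. -/
lemma actZ_eq_zero (φ : Verma V →ₗ[U] Verma W) (v : V) {w : Fin 5 → Fin 5 → Fin 5 → Fin 5 → W}
    (hw : IsSkew w) (u : Fin 5 → W) (h : φ (vmk 1 v) = vec2 w u) (i j k c d : Fin 5) :
    actZ i j k w u c d = 0 := by
  refine vmk_dForm_independent _ (fun a b => ?_) ?_ c d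
  · simp only [actZ]
    rw [elem_skew_right j k a b, elem_skew_right i k a b]
    have h1 : ∀ x y, ⁅zLin i j k x y, w x y a b⁆ = - ⁅zLin i j k x y, w x y b a⁆ := fun x y => by
      rw [hw.right, lie_neg]
    have h2 : ∀ x y q, zMat i j k x y a q • w x y q b + zMat i j k x y b q • w x y a q =
        - (zMat i j k x y b q • w x y q a + zMat i j k x y a q • w x y b q) := fun x y q => by
      rw [hw.right x y q b, hw.right x y a q, smul_neg, smul_neg]
      abel
    simp only [h1, h2, Finset.sum_neg_distrib]
    module
  · rw [← zForm_smul_vec2 i j k hw, ← h, ← map_smul, smul_vmk, mul_one,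
      ← one_mul (toU (zForm i j k)), vmk_mul_of_mem _ (zForm_mem i j k),
      linPart_of_isOdd (isOdd_zForm i j k), zero_lie, ← vmkL_apply, map_zero, map_zero]

end

/-! ### Partial derivatives on the polynomial algebra -/

open MvPolynomial in
/-- `∂/∂x_i`. -/
abbrev px (i : Fin 5) : Derivation ℂ P P := pderiv (Var.x i)

open MvPolynomial in
/-- `∂/∂x_i^*`. -/
abbrev pxd (i : Fin 5) : Derivation ℂ P P := pderiv (Var.xd i)

/-- `∂/∂x_ij` for arbitrary `i`, `j`. -/
def pxx (i j : Fin 5) : Derivation ℂ P P :=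
  if h : i < j then MvPolynomial.pderiv (Var.xx ⟨(i, j), h⟩)
  else if h : j < i then - MvPolynomial.pderiv (Var.xx ⟨(j, i), h⟩) else 0

/-- `∂/∂x_ij^*` for arbitrary `i`, `j`. -/
def pxxd (i j : Fin 5) : Derivation ℂ P P :=
  if h : i < j then MvPolynomial.pderiv (Var.xxd ⟨(i, j), h⟩)
  else if h : j < i then - MvPolynomial.pderiv (Var.xxd ⟨(j, i), h⟩) else 0

lemma pxx_skew (i j : Fin 5) : pxx i j = - pxx j i := by
  rcases lt_trichotomy i j with h | h | h
  · simp [pxx, h, h.not_gt]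
  · subst h; simp [pxx]
  · simp [pxx, h, h.not_gt]

lemma xx_self (i : Fin 5) : xx i i = 0 := by simp [xx]

lemma xxd_self (i : Fin 5) : xxd i i = 0 := by simp [xxd]

lemma xx_of_lt {i j : Fin 5} (h : i < j) : xx i j = MvPolynomial.X (Var.xx ⟨(i, j), h⟩) := by
  simp [xx, h]

lemma xxd_of_lt {i j : Fin 5} (h : i < j) : xxd i j = MvPolynomial.X (Var.xxd ⟨(i, j), h⟩) := by
  simp [xxd, h]

lemma pxx_of_lt {i j : Fin 5} (h : i < j) :
    pxx i j = MvPolynomial.pderiv (Var.xx ⟨(i, j), h⟩) := by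
  simp [pxx, h]

lemma P_derivation_ext {d e : Derivation ℂ P P}
    (h1 : ∀ i, d (MvPolynomial.X (Var.x i)) = e (MvPolynomial.X (Var.x i)))
    (h2 : ∀ i j, d (xx i j) = e (xx i j)) (h3 : ∀ i j, d (xxd i j) = e (xxd i j))
    (h4 : ∀ i, d (MvPolynomial.X (Var.xd i)) = e (MvPolynomial.X (Var.xd i))) : d = e := by
  refine MvPolynomial.derivation_ext fun v => ?_
  cases v with
  | x i => exact h1 i
  | xx p => rw [show (MvPolynomial.X (Var.xx p) : P) = xx p.1.1 p.1.2 from (xx_of_lt p.2).symm, h2]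
  | xxd p =>
    rw [show (MvPolynomial.X (Var.xxd p) : P) = xxd p.1.1 p.1.2 from (xxd_of_lt p.2).symm, h3]
  | xd i => exact h4 i

section values

variable (i j a b : Fin 5)

lemma pderiv_X_eq (u v : Var) [Decidable (v = u)] :
    MvPolynomial.pderiv u (MvPolynomial.X v : P) = if v = u then 1 else 0 := by
  split_ifs with h
  · rw [h, MvPolynomial.pderiv_X_self]
  · rw [MvPolynomial.pderiv_X_of_ne h]

open Classical in
lemma px_x : px i (MvPolynomial.X (Var.x j)) = if i = j then 1 else 0 := by
  rw [pderiv_X_eq]; simp only [Var.x.injEq, eq_comm]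

open Classical in
lemma pxd_xd : pxd i (MvPolynomial.X (Var.xd j)) = if i = j then 1 else 0 := by
  rw [pderiv_X_eq]; simp only [Var.xd.injEq, eq_comm]

lemma px_xd : px i (MvPolynomial.X (Var.xd j)) = 0 := MvPolynomial.pderiv_X_of_ne (by simp)

lemma pxd_x : pxd i (MvPolynomial.X (Var.x j)) = 0 := MvPolynomial.pderiv_X_of_ne (by simp)

open Classical in
lemma px_xx : px i (xx a b) = 0 := by
  unfold xx; split_ifs <;> simp [pderiv_X_eq]

open Classical in
lemma px_xxd : px i (xxd a b) = 0 := by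
  unfold xxd; split_ifs <;> simp [pderiv_X_eq]

open Classical in
lemma pxd_xx : pxd i (xx a b) = 0 := by
  unfold xx; split_ifs <;> simp [pderiv_X_eq]

open Classical in
lemma pxd_xxd : pxd i (xxd a b) = 0 := by
  unfold xxd; split_ifs <;> simp [pderiv_X_eq]

open Classical in
lemma pxx_x : pxx i j (MvPolynomial.X (Var.x a)) = 0 := by
  unfold pxx; split_ifs <;> simp [pderiv_X_eq]

open Classical in
lemma pxx_xd : pxx i j (MvPolynomial.X (Var.xd a)) = 0 := by
  unfold pxx; split_ifs <;> simp [pderiv_X_eq]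

open Classical in
lemma pxx_xxd : pxx i j (xxd a b) = 0 := by
  unfold pxx xxd; split_ifs <;> simp [pderiv_X_eq]

open Classical in
lemma pxxd_x : pxxd i j (MvPolynomial.X (Var.x a)) = 0 := by
  unfold pxxd; split_ifs <;> simp [pderiv_X_eq]

open Classical in
lemma pxxd_xd : pxxd i j (MvPolynomial.X (Var.xd a)) = 0 := by
  unfold pxxd; split_ifs <;> simp [pderiv_X_eq]

open Classical in
lemma pxxd_xx : pxxd i j (xx a b) = 0 := by
  unfold pxxd xx; split_ifs <;> simp [pderiv_X_eq]

open Classical in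
lemma pxx_xx : pxx i j (xx a b) = MvPolynomial.C (elem i j a b) := by
  unfold pxx xx elem
  split_ifs <;> simp [pderiv_X_eq, Subtype.ext_iff, Prod.ext_iff] <;> grind

open Classical in
lemma pxxd_xxd : pxxd i j (xxd a b) = MvPolynomial.C (elem i j a b) := by
  unfold pxxd xxd elem
  split_ifs <;> simp [pderiv_X_eq, Subtype.ext_iff, Prod.ext_iff] <;> grind

end values

lemma actDer_x (A : Matrix (Fin 5) (Fin 5) ℂ) (k : Fin 5) :
    actDer A (MvPolynomial.X (Var.x k)) = ∑ i, A i k • MvPolynomial.X (Var.x i) := actDer_X A _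

lemma actDer_xd (A : Matrix (Fin 5) (Fin 5) ℂ) (k : Fin 5) :
    actDer A (MvPolynomial.X (Var.xd k)) = - ∑ i, A k i • MvPolynomial.X (Var.xd i) := actDer_X A _

lemma actDer_C (A : Matrix (Fin 5) (Fin 5) ℂ) (c : ℂ) : actDer A (MvPolynomial.C c) = 0 :=
  Derivation.map_algebraMap _ c

/-! ### Commutators with `gl_5` -/

lemma sum_derivation_apply {ι : Type*} (s : Finset ι) (f : ι → Derivation ℂ P P) (g : P) :
    (∑ i ∈ s, f i) g = ∑ i ∈ s, f i g :=
  map_sum (⟨⟨fun d => d g, rfl⟩, fun _ _ => rfl⟩ : Derivation ℂ P P →+ P) f s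

/-- A commutator of derivations is a derivation, so a comparison on the variables is enough. Partial
derivatives transform dually to the variables; the analogues for the other three families follow in
the same way. -/
lemma px_actDer (A : Matrix (Fin 5) (Fin 5) ℂ) (t : Fin 5) (g : P) :
    px t (actDer A g) = actDer A (px t g) + ∑ k, A t k • px k g := by
  have h : ⁅px t, actDer A⁆ = ∑ k, A t k • px k := by
    refine P_derivation_ext (fun i => ?_) (fun i j => ?_) (fun i j => ?_) (fun i => ?_) <;>
    simp only [Derivation.commutator_apply, actDer_x, actDer_xx, actDer_xxd, actDer_xd, map_sum,
      map_add, map_neg, Derivation.map_smul, px_x, px_xx, px_xxd, px_xd, sum_derivation_apply, Derivation.coe_smul, Pi.smul_apply, smul_zero, add_zero, map_zero, sub_zero,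
      Finset.sum_const_zero, neg_zero, smul_ite, Finset.sum_ite_eq, Finset.sum_ite_eq',
      Finset.mem_univ, if_true, apply_ite (actDer A), Derivation.map_one_eq_zero, ite_self]
  have h2 := congrArg (fun d => d g) h
  simp only [Derivation.commutator_apply, sum_derivation_apply,
    Derivation.coe_smul, Pi.smul_apply] at h2
  rw [← h2]
  abel

lemma pxd_actDer (A : Matrix (Fin 5) (Fin 5) ℂ) (t : Fin 5) (g : P) :
    pxd t (actDer A g) = actDer A (pxd t g) - ∑ k, A k t • pxd k g := by
  have h : ⁅pxd t, actDer A⁆ = - ∑ k, A k t • pxd k := by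
    refine P_derivation_ext (fun i => ?_) (fun i j => ?_) (fun i j => ?_) (fun i => ?_) <;>
    simp only [Derivation.commutator_apply, actDer_x, actDer_xx, actDer_xxd, actDer_xd, map_sum,
      map_add, map_neg, Derivation.map_smul, pxd_x, pxd_xx, pxd_xxd, pxd_xd, sum_derivation_apply, Derivation.coe_smul, Pi.smul_apply, smul_zero, add_zero, map_zero, sub_zero,
      Finset.sum_const_zero, neg_zero, smul_ite, Finset.sum_ite_eq, Finset.sum_ite_eq',
      Finset.mem_univ, if_true, apply_ite (actDer A), Derivation.map_one_eq_zero, ite_self,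
      Derivation.coe_neg, Pi.neg_apply]
  have h2 := congrArg (fun d => d g) h
  simp only [Derivation.commutator_apply, sum_derivation_apply,
    Derivation.coe_smul, Pi.smul_apply, Derivation.coe_neg, Pi.neg_apply] at h2
  rw [sub_eq_add_neg, ← h2]
  abel

lemma smul_C_elem (r : ℂ) (a b c d : Fin 5) :
    r • (MvPolynomial.C (elem a b c d) : P) = MvPolynomial.C (r * elem a b c d) := by
  rw [MvPolynomial.smul_eq_C_mul, ← map_mul]

lemma sum_mul_elem (f : Fin 5 → ℂ) (a b c d : Fin 5) :
    (∑ k, f k * elem a b k d = (if d = b then f a else 0) - (if d = a then f b else 0)) ∧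
    (∑ k, f k * elem a b c k = (if c = a then f b else 0) - (if c = b then f a else 0)) ∧
    (∑ k, f k * elem k b c d = (if d = b then f c else 0) - (if c = b then f d else 0)) ∧
    (∑ k, f k * elem a k c d = (if c = a then f d else 0) - (if d = a then f c else 0)) := by
  refine ⟨?_, ?_, ?_, ?_⟩ <;>
  simp only [elem, mul_sub, mul_ite, mul_one, mul_zero, Finset.sum_sub_distrib, ite_and,
    Finset.sum_ite_eq, Finset.sum_ite_eq', Finset.mem_univ, if_true, Finset.sum_ite_irrel,
    Finset.sum_const_zero]

lemma pxx_actDer (A : Matrix (Fin 5) (Fin 5) ℂ) (a b : Fin 5) (g : P) :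
    pxx a b (actDer A g) = actDer A (pxx a b g) + ∑ k, (A a k • pxx k b g + A b k • pxx a k g) := by
  have h : ⁅pxx a b, actDer A⁆ = ∑ k, (A a k • pxx k b + A b k • pxx a k) := by
    refine P_derivation_ext (fun i => ?_) (fun i j => ?_) (fun i j => ?_) (fun i => ?_) <;>
    simp only [Derivation.commutator_apply, actDer_x, actDer_xx, actDer_xxd, actDer_xd, map_sum,
      map_add, map_neg, Derivation.map_smul, pxx_x, pxx_xx, pxx_xxd, pxx_xd, sum_derivation_apply, Derivation.coe_smul, Pi.smul_apply, smul_zero, add_zero, map_zero, sub_zero,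
      Finset.sum_const_zero, neg_zero, actDer_C, Derivation.coe_add, Pi.add_apply]
    simp only [smul_C_elem, Finset.sum_add_distrib, ← map_sum, ← map_add]
    rw [(sum_mul_elem (fun k => A k i) a b i j).1, (sum_mul_elem (fun k => A k j) a b i j).2.1,
      (sum_mul_elem (fun k => A a k) a b i j).2.2.1, (sum_mul_elem (fun k => A b k) a b i j).2.2.2]
    congr 1
    ring
  have h2 := congrArg (fun d => d g) h
  simp only [Derivation.commutator_apply, sum_derivation_apply,
    Derivation.coe_smul, Pi.smul_apply, Derivation.coe_add, Pi.add_apply] at h2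
  rw [← h2]
  abel

lemma pxxd_actDer (A : Matrix (Fin 5) (Fin 5) ℂ) (a b : Fin 5) (g : P) : pxxd a b (actDer A g) =
    actDer A (pxxd a b g) - ∑ k, (A k a • pxxd k b g + A k b • pxxd a k g) := by
  have h : ⁅pxxd a b, actDer A⁆ = - ∑ k, (A k a • pxxd k b + A k b • pxxd a k) := by
    refine P_derivation_ext (fun i => ?_) (fun i j => ?_) (fun i j => ?_) (fun i => ?_) <;>
    simp only [Derivation.commutator_apply, actDer_x, actDer_xx, actDer_xxd, actDer_xd, map_sum,
      map_add, map_neg, Derivation.map_smul, pxxd_x, pxxd_xx, pxxd_xxd, pxxd_xd,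
      sum_derivation_apply, Derivation.coe_smul, Pi.smul_apply, smul_zero, add_zero,
      map_zero, sub_zero, Finset.sum_const_zero, neg_zero, actDer_C, Derivation.coe_add,
      Pi.add_apply, Derivation.coe_neg, Pi.neg_apply]
    simp only [smul_C_elem, Finset.sum_add_distrib, ← map_sum, ← map_add]
    rw [(sum_mul_elem (fun k => A i k) a b i j).1, (sum_mul_elem (fun k => A j k) a b i j).2.1,
      (sum_mul_elem (fun k => A k a) a b i j).2.2.1, (sum_mul_elem (fun k => A k b) a b i j).2.2.2]
    congr 2
    ring
  have h2 := congrArg (fun d => d g) h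
  simp only [Derivation.commutator_apply, sum_derivation_apply,
    Derivation.coe_smul, Pi.smul_apply, Derivation.coe_add, Pi.add_apply, Derivation.coe_neg,
    Pi.neg_apply] at h2
  rw [sub_eq_add_neg, ← h2]
  abel

lemma sum_smul_elem_left {W : Type*} [AddCommGroup W] [Module ℂ W] (f : Fin 5 → W)
    (k c d : Fin 5) : ∑ s, elem k s c d • f s =
      (if c = k then f d else 0) - (if d = k then f c else 0) := by
  simp only [elem, sub_smul, ite_smul, one_smul, zero_smul, Finset.sum_sub_distrib, ite_and,
    Finset.sum_ite_eq, Finset.sum_ite_eq', Finset.mem_univ, if_true, Finset.sum_ite_irrel,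
    Finset.sum_const_zero]

/-- Both sides are derivations. Written as variables times partial derivatives, the action displays
the symmetry under transposition that makes the Fischer form contravariant. -/
lemma actDer_eq_sum (A : Matrix (Fin 5) (Fin 5) ℂ) (g : P) :
    actDer A g = ∑ i, ∑ k, A i k • (MvPolynomial.X (Var.x i) * px k g +
      ∑ s, xx i s * pxx k s g - ∑ s, xxd k s * pxxd i s g - MvPolynomial.X (Var.xd k) * pxd i g) := by
  have h : actDer A = ∑ i, ∑ k, A i k • ((MvPolynomial.X (Var.x i) : P) • px k +
      ∑ s, xx i s • pxx k s - ∑ s, xxd k s • pxxd i s - (MvPolynomial.X (Var.xd k) : P) • pxd i) := by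
    refine P_derivation_ext (fun i => ?_) (fun i j => ?_) (fun i j => ?_) (fun i => ?_) <;>
    simp only [actDer_x, actDer_xx, actDer_xxd, actDer_xd, px_x, px_xx, px_xxd, px_xd, pxd_x,
      pxd_xx, pxd_xxd, pxd_xd, pxx_x, pxx_xx, pxx_xxd, pxx_xd, pxxd_x, pxxd_xx, pxxd_xxd, pxxd_xd,
      sum_derivation_apply, Derivation.coe_smul, Pi.smul_apply, smul_zero,
      Derivation.coe_add, Derivation.coe_sub, Pi.add_apply, Pi.sub_apply, smul_eq_mul, mul_zero,
      Finset.sum_const_zero, add_zero, sub_zero, zero_add, zero_sub, mul_ite, mul_one, smul_ite,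
      Finset.sum_ite_eq', Finset.sum_ite_eq, Finset.mem_univ, if_true, smul_neg,
      Finset.sum_neg_distrib, Finset.sum_ite_irrel]
    · have e : ∀ i' k, ∑ s, xx i' s * MvPolynomial.C (elem k s i j) =
          (if i = k then xx i' j else 0) - (if j = k then xx i' i else 0) := fun i' k => by
        rw [← sum_smul_elem_left]
        exact Finset.sum_congr rfl fun s _ => by rw [MvPolynomial.smul_eq_C_mul, mul_comm]
      simp only [e, smul_sub, smul_ite, smul_zero, Finset.sum_sub_distrib, Finset.sum_ite_eq,
        Finset.mem_univ, if_true, Finset.sum_add_distrib]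
      rw [sub_eq_add_neg, ← Finset.sum_neg_distrib]
      refine congrArg _ (Finset.sum_congr rfl fun k _ => ?_)
      rw [xx_skew i k, smul_neg]
    · have e : ∀ i' k, ∑ s, xxd k s * MvPolynomial.C (elem i' s i j) =
          (if i = i' then xxd k j else 0) - (if j = i' then xxd k i else 0) := fun i' k => by
        rw [← sum_smul_elem_left]
        exact Finset.sum_congr rfl fun s _ => by rw [MvPolynomial.smul_eq_C_mul, mul_comm]
      rw [Finset.sum_comm]
      simp only [e, smul_sub, smul_ite, smul_zero, Finset.sum_sub_distrib, Finset.sum_ite_eq,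
        Finset.mem_univ, if_true, Finset.sum_add_distrib]
      rw [sub_eq_add_neg, ← Finset.sum_neg_distrib]
      refine congrArg Neg.neg (congrArg _ (Finset.sum_congr rfl fun k _ => ?_))
      rw [xxd_skew i k, smul_neg]
  rw [h]
  simp only [sum_derivation_apply, Derivation.coe_smul, Pi.smul_apply,
    Derivation.coe_add, Derivation.coe_sub, Pi.add_apply, Pi.sub_apply, smul_eq_mul]

lemma actDer_comm (A B : Matrix (Fin 5) (Fin 5) ℂ) (g : P) :
    actDer A (actDer B g) = actDer B (actDer A g) + actDer (A * B - B * A) g := by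
  have h : actDer (A * B - B * A) = ⁅actDer A, actDer B⁆ := by
    refine MvPolynomial.derivation_ext fun v => ?_
    rw [Derivation.commutator_apply]
    simp only [actDer_X]
    exact actVar_comm A B v
  rw [h, Derivation.commutator_apply]
  abel

lemma lie_P (A : sl5) (g : P) : ⁅A, g⁆ = actDer A.mat g := rfl

/-- The action of `gl_5` as a linear map. -/
def actL : Matrix (Fin 5) (Fin 5) ℂ →ₗ[ℂ] P →ₗ[ℂ] P :=
  LinearMap.mk₂ ℂ (fun A g => actDer A g)
    (fun A B g => by
      simp only [actDer_eq_sum, Matrix.add_apply, add_smul, Finset.sum_add_distrib])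
    (fun c A g => by
      simp only [actDer_eq_sum, Matrix.smul_apply, smul_eq_mul, mul_smul, Finset.smul_sum])
    (fun A g h => map_add _ g h) (fun c A g => Derivation.map_smul _ c g)

lemma actL_apply (A : Matrix (Fin 5) (Fin 5) ℂ) (g : P) : actL A g = actDer A g := rfl

/-- Matrix units. -/
abbrev mu1 (p q : Fin 5) : Matrix (Fin 5) (Fin 5) ℂ := Matrix.single p q 1

lemma actDer_eq_sum_single (A : Matrix (Fin 5) (Fin 5) ℂ) (g : P) :
    actDer A g = ∑ p, ∑ q, A p q • actDer (mu1 p q) g := by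
  conv_lhs => rw [← actL_apply, Matrix.matrix_eq_sum_single A]
  simp only [map_sum, LinearMap.sum_apply]
  refine Finset.sum_congr rfl fun p _ => Finset.sum_congr rfl fun q _ => ?_
  rw [show Matrix.single p q (A p q) = A p q • mu1 p q by simp [mu1], map_smul]
  rfl

/-! ### The contravariant form -/

section

open MvPolynomial

/-- `∏ m_v!` -/
def multiFact (m : Var →₀ ℕ) : ℂ := m.prod fun _ k => (k.factorial : ℂ)

lemma multiFact_add_single (m : Var →₀ ℕ) (v : Var) :
    multiFact (m + Finsupp.single v 1) = (m v + 1) * multiFact m := by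
  classical
  have h1 : ∀ n : Var →₀ ℕ, multiFact n = (n.erase v).prod (fun _ k => (k.factorial : ℂ)) *
      ((n v).factorial : ℂ) := fun n => by
    by_cases hv : v ∈ n.support
    · rw [multiFact, ← Finsupp.mul_prod_erase n v _ hv, mul_comm]
    · rw [Finsupp.erase_of_notMem_support hv, Finsupp.notMem_support_iff.mp hv]
      simp [multiFact]
  rw [h1, h1 m, Finsupp.erase_add, Finsupp.erase_single, add_zero, Finsupp.add_apply,
    Finsupp.single_eq_same, Nat.factorial_succ]
  push_cast
  ring

/-- The Fischer form `(g, h) ↦ (g(∂) h)(0)`. -/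
def fischer : P →ₗ[ℂ] P →ₗ[ℂ] ℂ :=
  (basisMonomials Var ℂ).constr ℂ fun m => multiFact m • lcoeff ℂ m

lemma fischer_monomial (m : Var →₀ ℕ) (r : ℂ) (h : P) :
    fischer (monomial m r) h = r * (multiFact m * coeff m h) := by
  have e : (monomial m r : P) = r • basisMonomials Var ℂ m := by
    rw [coe_basisMonomials, smul_monomial, smul_eq_mul, mul_one]
  rw [e, map_smul, fischer, Module.Basis.constr_basis]
  simp

/-- Multiplication by a variable is adjoint to differentiation: on a monomial both sides acquire the
factor `(m_v + 1) m!`. -/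
lemma fischer_X_mul (v : Var) (g h : P) : fischer (X v * g) h = fischer g (pderiv v h) := by
  induction g using MvPolynomial.induction_on' with
  | monomial m r =>
    rw [X, monomial_mul, one_mul, fischer_monomial, fischer_monomial, coeff_pderiv, add_comm,
      multiFact_add_single]
    ring
  | add p q hp hq => rw [mul_add, map_add, map_add, LinearMap.add_apply, LinearMap.add_apply, hp, hq]

lemma fischer_comm (g h : P) : fischer g h = fischer h g := by
  induction g using MvPolynomial.induction_on' with
  | monomial m r =>
    induction h using MvPolynomial.induction_on' with
    | monomial n s =>
      classical
      rw [fischer_monomial, fischer_monomial, coeff_monomial, coeff_monomial]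
      by_cases e : m = n
      · subst e; simp only [if_true]; ring
      · rw [if_neg e, if_neg (Ne.symm e)]; simp
    | add p q hp hq => rw [map_add, map_add, LinearMap.add_apply, hp, hq]
  | add p q hp hq => rw [map_add, map_add, LinearMap.add_apply, hp, hq]

lemma fischer_pderiv (v : Var) (g h : P) : fischer (pderiv v g) h = fischer g (X v * h) := by
  rw [fischer_comm, ← fischer_X_mul, fischer_comm]

lemma fischer_xx_mul (i j : Fin 5) (g h : P) : fischer (xx i j * g) h = fischer g (pxx i j h) := by
  unfold xx pxx
  split_ifs
  · rw [fischer_X_mul]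
  · rw [neg_mul, map_neg, LinearMap.neg_apply, fischer_X_mul, Derivation.neg_apply, map_neg]
  · simp

lemma fischer_xxd_mul (i j : Fin 5) (g h : P) :
    fischer (xxd i j * g) h = fischer g (pxxd i j h) := by
  unfold xxd pxxd
  split_ifs
  · rw [fischer_X_mul]
  · rw [neg_mul, map_neg, LinearMap.neg_apply, fischer_X_mul, Derivation.neg_apply, map_neg]
  · simp

lemma fischer_pxx (i j : Fin 5) (g h : P) : fischer (pxx i j g) h = fischer g (xx i j * h) := by
  rw [fischer_comm, ← fischer_xx_mul, fischer_comm]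

lemma fischer_pxxd (i j : Fin 5) (g h : P) : fischer (pxxd i j g) h = fischer g (xxd i j * h) := by
  rw [fischer_comm, ← fischer_xxd_mul, fischer_comm]

/-- Taking adjoints exchanges variables and derivatives, so `E_ik` becomes `E_ki`. -/
lemma fischer_actDer (A : Matrix (Fin 5) (Fin 5) ℂ) (g h : P) :
    fischer (actDer A g) h = fischer g (actDer A.transpose h) := by
  rw [actDer_eq_sum, actDer_eq_sum, Finset.sum_comm]
  simp only [map_sum, map_smul, map_add, map_sub, LinearMap.sum_apply, LinearMap.smul_apply,
    LinearMap.add_apply, LinearMap.sub_apply, fischer_X_mul, fischer_xx_mul, fischer_xxd_mul,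
    fischer_pxx, fischer_pxxd, fischer_pderiv, Matrix.transpose_apply]

/-- Complex conjugation of the coefficients. -/
def conjP : P →+* P := MvPolynomial.map (starRingEnd ℂ)

lemma conjP_smul (c : ℂ) (g : P) : conjP (c • g) = starRingEnd ℂ c • conjP g := by
  rw [smul_eq_C_mul, map_mul, conjP, map_C, smul_eq_C_mul]

lemma conjP_X (v : Var) : conjP (X v) = X v := map_X _ _

lemma conjP_xx (i j : Fin 5) : conjP (xx i j) = xx i j := by
  unfold xx; split_ifs <;> simp [conjP_X]

lemma conjP_xxd (i j : Fin 5) : conjP (xxd i j) = xxd i j := by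
  unfold xxd; split_ifs <;> simp [conjP_X]

lemma conjP_actDer (A : Matrix (Fin 5) (Fin 5) ℂ) (g : P) :
    conjP (actDer A g) = actDer (A.map (starRingEnd ℂ)) (conjP g) := by
  induction g using MvPolynomial.induction_on with
  | C c => rw [actDer_C, map_zero, conjP, map_C, actDer_C]
  | add p q hp hq => rw [map_add, map_add, hp, hq, map_add, map_add]
  | mul_X p v hp =>
    rw [Derivation.leibniz, map_add, smul_eq_mul, smul_eq_mul, map_mul, map_mul, hp, map_mul,
      Derivation.leibniz, conjP_X, smul_eq_mul, smul_eq_mul, actDer_X, actDer_X]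
    congr 2
    cases v <;> simp only [actVar, map_sum, map_neg, map_add, conjP_smul, conjP_X, conjP_xx,
      conjP_xxd, Matrix.map_apply]

lemma fischer_eq_sum (g h : P) :
    fischer g h = ∑ m ∈ g.support, coeff m g * (multiFact m * coeff m h) := by
  conv_lhs => rw [as_sum g]
  rw [map_sum, LinearMap.sum_apply]
  exact Finset.sum_congr rfl fun m _ => fischer_monomial _ _ _

/-- Up to symmetry of the form, the pairing equals `∑ m! |coeff_m|²`, which is positive definite. -/
lemma eq_zero_of_fischer_conjP {g : P} (h : fischer (conjP g) g = 0) : g = 0 := by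
  have e : fischer g (conjP g) = ((∑ m ∈ g.support,
      (m.prod fun _ k => (k.factorial : ℝ)) * Complex.normSq (coeff m g) : ℝ) : ℂ) := by
    rw [fischer_eq_sum, Complex.ofReal_sum]
    refine Finset.sum_congr rfl fun m _ => ?_
    rw [conjP, coeff_map, Complex.ofReal_mul, Complex.normSq_eq_conj_mul_self, multiFact,
      Finsupp.prod, Finsupp.prod, Complex.ofReal_prod]
    simp only [Complex.ofReal_natCast]
    ring
  rw [fischer_comm, e, Complex.ofReal_eq_zero, Finset.sum_eq_zero_iff_of_nonneg] at h
  · ext m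
    by_contra hm
    have h1 := h m (mem_support_iff.mpr hm)
    rw [mul_eq_zero, Complex.normSq_eq_zero] at h1
    rcases h1 with h1 | h1
    · exact Finset.prod_ne_zero_iff.mpr
        (fun _ _ => Nat.cast_ne_zero.mpr (Nat.factorial_ne_zero _)) h1
    · exact hm h1
  · exact fun m _ => mul_nonneg (Finset.prod_nonneg fun _ _ => Nat.cast_nonneg _)
      (Complex.normSq_nonneg _)

/-! ### The modules `F(λ)` -/

lemma hw_mem (lam : Fin 4 → ℕ) : hw lam ∈ F lam :=
  LieSubmodule.subset_lieSpan (Set.mem_singleton _)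

lemma F_le {lam : Fin 4 → ℕ} {N : LieSubmodule ℂ sl5 P} (h : hw lam ∈ N) : F lam ≤ N :=
  LieSubmodule.lieSpan_le.mpr (Set.singleton_subset_iff.mpr h)

lemma conjP_hw (lam : Fin 4 → ℕ) : conjP (hw lam) = hw lam := by
  simp only [hw, map_mul, map_pow, conjP_X, conjP_xx, conjP_xxd]

/-- The complex conjugate of a trace zero matrix. -/
def sl5.conj (A : sl5) : sl5 := sl5.mk (A.mat.map (starRingEnd ℂ)) (by
  have h : A.mat.trace = 0 := A.2
  rw [Matrix.trace] at *
  simpa using congrArg (starRingEnd ℂ) h)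

/-- The transpose of a trace zero matrix. -/
def sl5.transpose (A : sl5) : sl5 := sl5.mk A.mat.transpose (by
  rw [Matrix.trace_transpose]
  exact A.2)

/-- The generator has real coefficients and complex conjugation preserves `sl_5`. This stability
lets positivity of the Hermitian form be used inside `F(λ)`. -/
lemma conjP_mem {lam : Fin 4 → ℕ} {g : P} (hg : g ∈ F lam) : conjP g ∈ F lam := by
  let N : LieSubmodule ℂ sl5 P :=
    { carrier := {g | conjP g ∈ F lam}
      zero_mem' := by simp
      add_mem' := fun {a b} ha hb => by
        change conjP (a + b) ∈ F lam
        rw [map_add]; exact add_mem ha hb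
      smul_mem' := fun c a ha => by
        change conjP (c • a) ∈ F lam
        rw [conjP_smul]; exact (F lam).smul_mem _ ha
      lie_mem := fun {A a} ha => by
        change conjP (actDer A.mat a) ∈ F lam
        rw [conjP_actDer]
        exact (F lam).lie_mem (x := A.conj) ha }
  exact F_le (N := N) (show conjP (hw lam) ∈ F lam by rw [conjP_hw]; exact hw_mem lam) hg

/-- A derivation multiplying the four relevant variables by scalars multiplies the highest weight
vector by a scalar. -/
lemma derivation_hw (d : Derivation ℂ P P) (lam : Fin 4 → ℕ) (a b c e : ℂ)
    (h1 : d (X (Var.x 0)) = a • X (Var.x 0)) (h2 : d (xx 0 1) = b • xx 0 1)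
    (h3 : d (xxd 3 4) = c • xxd 3 4) (h4 : d (X (Var.xd 4)) = e • X (Var.xd 4)) :
    d (hw lam) = (lam 0 * a + lam 1 * b + lam 2 * c + lam 3 * e) • hw lam := by
  have hp : ∀ (g : P) (r : ℂ) (n : ℕ), d g = r • g → d (g ^ n) = (n * r) • g ^ n := by
    intro g r n hg
    induction n with
    | zero => simp
    | succ n ih =>
      rw [pow_succ, Derivation.leibniz, ih, hg]
      simp only [smul_eq_mul, smul_eq_C_mul]
      push_cast
      simp only [map_mul, map_add, map_one]
      ring
  rw [hw]
  simp only [Derivation.leibniz, hp _ _ _ h1, hp _ _ _ h2, hp _ _ _ h3, hp _ _ _ h4, smul_eq_mul,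
    smul_eq_C_mul, map_add, map_mul]
  ring

/-- The weight of `λ` at the diagonal matrix unit `E_pp`. -/
def wt (lam : Fin 4 → ℕ) : Fin 5 → ℂ :=
  ![lam 0 + lam 1, lam 1, 0, - lam 2, - lam 2 - lam 3]

lemma actDer_hw_of_lt (lam : Fin 4 → ℕ) {p q : Fin 5} (hpq : p < q) :
    actDer (mu1 p q) (hw lam) = 0 := by
  rw [derivation_hw (actDer (mu1 p q)) lam 0 0 0 0]
  · simp
  · rw [actDer_x, zero_smul, Finset.sum_eq_zero]
    intro i _
    rw [show mu1 p q i 0 = 0 by simp only [mu1, Matrix.single_apply]; grind, zero_smul]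
  · rw [actDer_xx, zero_smul, Finset.sum_eq_zero]
    intro i _
    fin_cases q <;> fin_cases p <;> fin_cases i <;> simp [Matrix.single_apply, xx_self] at hpq ⊢
  · rw [actDer_xxd, zero_smul, Finset.sum_eq_zero, neg_zero]
    intro i _
    fin_cases q <;> fin_cases p <;> fin_cases i <;> simp [Matrix.single_apply, xxd_self] at hpq ⊢
  · rw [actDer_xd, zero_smul, Finset.sum_eq_zero, neg_zero]
    intro i _
    rw [show mu1 p q 4 i = 0 by simp only [mu1, Matrix.single_apply]; grind, zero_smul]

lemma actDer_hw_self (lam : Fin 4 → ℕ) (p : Fin 5) :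
    actDer (mu1 p p) (hw lam) = wt lam p • hw lam := by
  have e : ∀ i j, mu1 p p i j = if i = j then (if i = p then (1 : ℂ) else 0) else 0 := fun i j => by
    simp only [mu1, Matrix.single_apply]
    grind
  rw [derivation_hw (actDer (mu1 p p)) lam (if (0 : Fin 5) = p then 1 else 0)
    ((if (0 : Fin 5) = p then 1 else 0) + (if (1 : Fin 5) = p then 1 else 0))
    (- ((if (3 : Fin 5) = p then 1 else 0) + (if (4 : Fin 5) = p then 1 else 0)))
    (- (if (4 : Fin 5) = p then 1 else 0))]
  · congr 1
    fin_cases p <;> simp [wt] <;> ring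
  · simp only [actDer_x, e, ite_smul, zero_smul, Finset.sum_ite_eq', Finset.mem_univ, if_true]
  · simp only [actDer_xx, e, ite_smul, zero_smul, Finset.sum_add_distrib, Finset.sum_ite_eq',
      Finset.mem_univ, if_true, add_smul]
  · simp only [actDer_xxd, e, ite_smul, zero_smul, Finset.sum_add_distrib, Finset.sum_ite_eq,
      Finset.mem_univ, if_true, add_smul, neg_smul]
  · simp only [actDer_xd, e, ite_smul, zero_smul, Finset.sum_ite_eq,
      Finset.mem_univ, if_true, neg_smul]

/-- The linear form given by the highest weight vector. -/
def hwForm (lam : Fin 4 → ℕ) : P →ₗ[ℂ] ℂ := fischer (hw lam)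

/-- By contravariance the lowering operator becomes a raising operator on the highest weight vector.
-/
lemma hwForm_lower (lam : Fin 4 → ℕ) {p q : Fin 5} (hpq : q < p) (g : P) :
    hwForm lam (actDer (mu1 p q) g) = 0 := by
  rw [hwForm, ← Matrix.transpose_transpose (mu1 p q), ← fischer_actDer, mu1,
    Matrix.transpose_single, actDer_hw_of_lt lam hpq, map_zero, LinearMap.zero_apply]

lemma hwForm_diag (lam : Fin 4 → ℕ) (p : Fin 5) (g : P) :
    hwForm lam (actDer (mu1 p p) g) = wt lam p * hwForm lam g := by
  rw [hwForm, ← Matrix.transpose_transpose (mu1 p p), ← fischer_actDer, mu1,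
    Matrix.transpose_single, actDer_hw_self, map_smul, LinearMap.smul_apply, smul_eq_mul]

lemma hw_ne_zero (lam : Fin 4 → ℕ) : hw lam ≠ 0 := by
  rw [hw, xx_of_lt (by decide), xxd_of_lt (by decide)]
  simp [X_ne_zero]

lemma hwForm_hw (lam : Fin 4 → ℕ) : hwForm lam (hw lam) ≠ 0 := fun h =>
  hw_ne_zero lam (eq_zero_of_fischer_conjP (by rw [conjP_hw]; exact h))

/-- `F(λ)` is obtained from the highest weight vector by lowering operators. -/
lemma F_le_of_lower {lam : Fin 4 → ℕ} (K : Submodule ℂ P) (h0 : hw lam ∈ K)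
    (hK : ∀ p q : Fin 5, q < p → ∀ g ∈ K, actDer (mu1 p q) g ∈ K) {g : P} (hg : g ∈ F lam) :
    g ∈ K := by
  -- `R` is spanned by the words in lowering operators applied to the highest weight vector, and
  -- `R'` below collects the vectors of `R` that all of `gl_5` keeps in `R`. The inclusion `R ≤ R'`
  -- makes `R` a submodule, hence contains `F(λ)`.
  let R : Submodule ℂ P := sInf {N | hw lam ∈ N ∧
    ∀ p q : Fin 5, q < p → ∀ g ∈ N, actDer (mu1 p q) g ∈ N}
  have hR0 : hw lam ∈ R := by
    rw [Submodule.mem_sInf]; exact fun N hN => hN.1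
  have hRl : ∀ p q : Fin 5, q < p → ∀ g ∈ R, actDer (mu1 p q) g ∈ R := by
    intro p q hpq g hg
    rw [Submodule.mem_sInf] at hg ⊢
    exact fun N hN => hN.2 p q hpq g (hg N hN)
  have hRle : ∀ N : Submodule ℂ P, hw lam ∈ N →
      (∀ p q : Fin 5, q < p → ∀ g ∈ N, actDer (mu1 p q) g ∈ N) → R ≤ N :=
    fun N h1 h2 => sInf_le ⟨h1, h2⟩
  let R' : Submodule ℂ P :=
    { carrier := {g | g ∈ R ∧ ∀ A : Matrix (Fin 5) (Fin 5) ℂ, actDer A g ∈ R}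
      zero_mem' := ⟨zero_mem _, fun A => by rw [map_zero]; exact zero_mem _⟩
      add_mem' := fun {a b} ha hb => ⟨add_mem ha.1 hb.1, fun A => by
        rw [map_add]; exact add_mem (ha.2 A) (hb.2 A)⟩
      smul_mem' := fun c a ha => ⟨R.smul_mem c ha.1, fun A => by
        rw [Derivation.map_smul]; exact R.smul_mem c (ha.2 A)⟩ }
  have hall : R ≤ R' := by
    refine hRle R' ⟨hR0, fun A => ?_⟩ fun p q hpq g hg => ⟨hRl p q hpq g hg.1, fun A => ?_⟩
    · rw [actDer_eq_sum_single]
      refine Submodule.sum_mem _ fun p _ => Submodule.sum_mem _ fun q _ => R.smul_mem _ ?_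
      rcases lt_trichotomy p q with h | h | h
      · rw [actDer_hw_of_lt lam h]; exact zero_mem _
      · rw [h, actDer_hw_self]; exact R.smul_mem _ hR0
      · exact hRl p q h _ hR0
    -- `A f g = f A g + [A, f] g`, and both terms lie in `R` because `g` is in `R'`.
    · rw [actDer_comm]
      exact add_mem (hRl p q hpq _ (hg.2 A)) (hg.2 _)
  let N : LieSubmodule ℂ sl5 P :=
    { R with lie_mem := fun {A a} ha => (hall ha).2 A.mat }
  exact hRle K h0 hK (F_le (N := N) hR0 hg)

end

/-! ### Highest weight coefficients of a singular vector -/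

/-- The coefficients of `E_pq w_abkd` at the highest weight vector. -/
def raised (m : Fin 5 → ℂ) (c : Fin 5 → Fin 5 → Fin 5 → Fin 5 → ℂ) (p q a b k d : Fin 5) : ℂ :=
  if p = q then m p * c a b k d else if p < q then
    - ((if a = p then c q b k d else 0) + (if b = p then c a q k d else 0) +
      (if k = p then c a b q d else 0) + (if d = p then c a b k q else 0)) else 0

/-- The highest weight part of the action of `x_i d_jl + x_j d_il`, before symmetrization. -/
def singT (m : Fin 5 → ℂ) (c : Fin 5 → Fin 5 → Fin 5 → Fin 5 → ℂ) (u : Fin 5 → ℂ)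
    (i j l k d : Fin 5) : ℂ :=
  ∑ a, ∑ b, ∑ q, (levi j l a b q : ℂ) * (2 * raised m c i q a b k d +
    ((if k = i then c a b q d else 0) + (if d = i then c a b k q else 0))) -
    (1 / 2) * (elem j l k d * u i)

/-- The multiplicity of `p` in `(a, b, k, d)`. -/
def mult (a b k d p : Fin 5) : ℂ :=
  (if a = p then 1 else 0) + (if b = p then 1 else 0) + (if k = p then 1 else 0) +
    (if d = p then 1 else 0)

/-- The equations satisfied by the highest weight coefficients of a singular vector. -/
structure IsSingular (lam mu : Fin 4 → ℕ) (c : Fin 5 → Fin 5 → Fin 5 → Fin 5 → ℂ)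
    (u : Fin 5 → ℂ) : Prop where
  skew : IsSkew c
  eq : ∀ i j l k d, singT (wt mu) c u i j l k d + singT (wt mu) c u j i l k d = 0
  weight : ∀ a b k d, c a b k d ≠ 0 → ∀ p q, p ≠ q →
    wt lam p - wt lam q = wt mu p - wt mu q + (mult a b k d p - mult a b k d q)

section

variable {lam mu : Fin 4 → ℕ}

/-- The highest weight vector as an element of `F(λ)`. -/
def hwF (lam : Fin 4 → ℕ) : F lam := ⟨hw lam, hw_mem lam⟩

/-- Off-diagonal matrix units. -/
def rootE (p q : Fin 5) (h : p ≠ q) : sl5 :=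
  sl5.mk (mu1 p q) (Matrix.trace_single_eq_of_ne p q 1 h)

/-- Differences of diagonal matrix units. -/
def cartanH (p q : Fin 5) : sl5 := sl5.mk (mu1 p p - mu1 q q) (by
  rw [Matrix.trace_sub, Matrix.trace_single_eq_same, Matrix.trace_single_eq_same, sub_self])

lemma coe_lie_F (A : sl5) (v : F lam) : ((⁅A, v⁆ : F lam) : P) = actDer A.mat (v : P) := rfl

lemma rootE_hwF {p q : Fin 5} (h : p < q) : ⁅rootE p q h.ne, hwF lam⁆ = 0 :=
  Subtype.ext (actDer_hw_of_lt lam h)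

lemma actDer_cartanH (p q : Fin 5) (g : P) :
    actDer (cartanH p q).mat g = actDer (mu1 p p) g - actDer (mu1 q q) g := by
  simp only [← actL_apply]
  exact congrFun (congrArg DFunLike.coe (map_sub actL _ _)) g

lemma cartanH_hwF (p q : Fin 5) : ⁅cartanH p q, hwF lam⁆ = (wt lam p - wt lam q) • hwF lam := by
  refine Subtype.ext ?_
  rw [coe_lie_F, actDer_cartanH]
  change actDer _ (hw lam) - actDer _ (hw lam) = (wt lam p - wt lam q) • hw lam
  rw [actDer_hw_self, actDer_hw_self, sub_smul]

variable (φ : M lam →ₗ[U] M mu) {w : Fin 5 → Fin 5 → Fin 5 → Fin 5 → F mu} {u : Fin 5 → F mu}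

/-- The image of the highest weight vector is killed by raising operators, and uniqueness of the
coefficients turns this into equations for `w` and `u` separately. -/
lemma raise_eq_zero (hw : IsSkew w) (h : φ (vmk 1 (hwF lam)) = vec2 w u) {p q : Fin 5}
    (hpq : p < q) : (∀ a b k d, actTensor (rootE p q hpq.ne) w a b k d = 0) ∧
      ∀ t, actVec (rootE p q hpq.ne) u t = 0 := by
  have h1 := map_vmk_lie φ (rootE p q hpq.ne) (hwF lam)
  rw [rootE_hwF hpq, h, linField_smul_vec2, ← vmkL_apply, map_zero, map_zero] at h1
  obtain ⟨h2, h3⟩ := vec2_injective (hw.actTensor _) IsSkew.zero (h1.symm.trans vec2_zero.symm)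
  exact ⟨fun a b k d => by rw [h2], fun t => by rw [h3]⟩

lemma cartan_eq_smul (hw : IsSkew w) (h : φ (vmk 1 (hwF lam)) = vec2 w u) (p q : Fin 5) :
    actTensor (cartanH p q) w = (wt lam p - wt lam q) • w := by
  have h1 := map_vmk_lie φ (cartanH p q) (hwF lam)
  rw [cartanH_hwF, h, linField_smul_vec2, vmk_smul_right] at h1
  refine (vec2_injective (u' := (wt lam p - wt lam q) • u) (hw.actTensor _) (hw.smul _)
    (h1.symm.trans ?_)).1
  rw [vec2_smul, ← h]
  exact (φ.restrictScalars ℂ).map_smul _ _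

lemma rootE_mat (p q : Fin 5) (h : p ≠ q) (a b : Fin 5) :
    (rootE p q h).mat a b = if a = p then (if b = q then 1 else 0) else 0 := by
  change Matrix.single p q (1 : ℂ) a b = _
  simp only [Matrix.single_apply]
  grind

lemma actTensor_rootE (p q : Fin 5) (h : p ≠ q) (w : Fin 5 → Fin 5 → Fin 5 → Fin 5 → F mu)
    (a b k d : Fin 5) : actTensor (rootE p q h) w a b k d = ⁅rootE p q h, w a b k d⁆ +
      ((if a = p then w q b k d else 0) + (if b = p then w a q k d else 0) +
        (if k = p then w a b q d else 0) + (if d = p then w a b k q else 0)) := by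
  simp only [actTensor, rootE_mat, ite_smul, one_smul, zero_smul, Finset.sum_add_distrib,
    Finset.sum_ite_irrel, Finset.sum_ite_eq', Finset.mem_univ, if_true, Finset.sum_const_zero]

lemma actVec_rootE (p q : Fin 5) (h : p ≠ q) (u : Fin 5 → F mu) (t : Fin 5) :
    actVec (rootE p q h) u t = ⁅rootE p q h, u t⁆ - (if t = q then u p else 0) := by
  simp only [actVec, rootE_mat, ite_smul, one_smul, zero_smul, Finset.sum_ite_irrel,
    Finset.sum_ite_eq', Finset.mem_univ, if_true, Finset.sum_const_zero]

lemma cartanH_mat (p q a b : Fin 5) : (cartanH p q).mat a b =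
    if b = a then ((if a = p then 1 else 0) - (if a = q then 1 else 0)) else 0 := by
  change Matrix.single p p (1 : ℂ) a b - Matrix.single q q (1 : ℂ) a b = _
  simp only [Matrix.single_apply]
  grind

lemma actTensor_cartanH (p q : Fin 5) (w : Fin 5 → Fin 5 → Fin 5 → Fin 5 → F mu)
    (a b k d : Fin 5) : actTensor (cartanH p q) w a b k d = ⁅cartanH p q, w a b k d⁆ +
      (mult a b k d p - mult a b k d q) • w a b k d := by
  simp only [actTensor, cartanH_mat, ite_smul, zero_smul, Finset.sum_add_distrib,
    Finset.sum_ite_eq', Finset.mem_univ, if_true, ← add_smul, mult]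
  congr 2
  ring

/-- This makes the system numerical. A lowering operator vanishes under `hwForm`, a diagonal one
gives the weight of `μ`, and a raising one is traded for shifts of the indices of `w` by
`raise_eq_zero`. -/
lemma hwForm_actDer_single (hw : IsSkew w) (h : φ (vmk 1 (hwF lam)) = vec2 w u)
    (p q a b k d : Fin 5) : hwForm mu (actDer (mu1 p q) (w a b k d : P)) =
      raised (wt mu) (fun a b k d => hwForm mu (w a b k d : P)) p q a b k d := by
  rw [raised]
  rcases lt_trichotomy p q with hpq | hpq | hpq
  · rw [if_neg hpq.ne, if_pos hpq]
    have h1 := (raise_eq_zero φ hw h hpq).1 a b k d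
    rw [actTensor_rootE] at h1
    have h2 := congrArg (fun v : F mu => hwForm mu (v : P)) h1
    have hite : ∀ (r : Prop) [Decidable r] (v : F mu), hwForm mu ((if r then v else 0 : F mu) : P) =
        if r then hwForm mu (v : P) else 0 := fun r _ v => by split_ifs <;> simp
    simp only [LieSubmodule.coe_add, map_add, coe_lie_F, hite] at h2
    change hwForm mu (actDer (mu1 p q) _) + _ = hwForm mu 0 at h2
    rw [map_zero] at h2
    exact eq_neg_of_add_eq_zero_left h2
  · subst hpq
    rw [if_pos rfl, hwForm_diag]
  · rw [if_neg hpq.ne', if_neg hpq.not_gt, hwForm_lower mu hpq]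

/-- Every matrix unit occurring in `actZ` can be evaluated under `hwForm`, which leaves scalar
equations. The weight condition compares eigenvalues of the Cartan subalgebra. -/
lemma isSingular_hwForm (hw : IsSkew w) (h : φ (vmk 1 (hwF lam)) = vec2 w u) :
    IsSingular lam mu (fun a b k d => hwForm mu (w a b k d : P))
      (fun t => hwForm mu (u t : P)) := by
  refine ⟨⟨fun a b k d => ?_, fun a b k d => ?_⟩, fun i j l k d => ?_,
    fun a b k d h0 p q hpq => ?_⟩
  · rw [hw.left, LieSubmodule.coe_neg, map_neg]
  · rw [hw.swap, LieSubmodule.coe_neg, map_neg]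
  · let f : F mu →ₗ[ℂ] ℂ := hwForm mu ∘ₗ (F mu).toSubmodule.subtype
    have hf : ∀ a b, f ⁅zLin i j l a b, w a b k d⁆ = ∑ p, ∑ q, zMat i j l a b p q *
        raised (wt mu) (fun a b k d => f (w a b k d)) p q a b k d := fun a b => by
      change hwForm mu (actDer (zLin i j l a b).mat (w a b k d : P)) = _
      rw [actDer_eq_sum_single]
      simp only [map_sum, map_smul, hwForm_actDer_single φ hw h, smul_eq_mul, zLin_mat]
      rfl
    have h1 := congrArg f (actZ_eq_zero φ (hwF lam) hw u h i j l k d)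
    simp only [actZ, map_add, map_sub, map_smul, map_sum, hf, smul_eq_mul, map_zero, zMat, add_mul,
      ite_mul, zero_mul, Finset.sum_add_distrib, Finset.sum_ite_irrel, Finset.sum_const_zero,
      Finset.sum_ite_eq', Finset.mem_univ, if_true, mul_add] at h1
    change singT (wt mu) (fun a b k d => f (w a b k d)) (fun t => f (u t)) i j l k d +
      singT (wt mu) (fun a b k d => f (w a b k d)) (fun t => f (u t)) j i l k d = 0
    simp only [singT, mul_add, mul_ite, mul_zero, Finset.sum_add_distrib, Finset.sum_ite_irrel,
      Finset.sum_const_zero]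
    simp only [mul_left_comm _ (2 : ℂ), ← Finset.mul_sum]
    linear_combination h1
  · have h1 := congrFun (congrFun (congrFun (congrFun (cartan_eq_smul φ hw h p q) a) b) k) d
    rw [actTensor_cartanH] at h1
    have h2 := congrArg (fun v : F mu => hwForm mu (v : P)) h1
    simp only [LieSubmodule.coe_add, map_add, coe_lie_F, actDer_cartanH, map_sub, hwForm_diag,
      Pi.smul_apply, LieSubmodule.coe_smul, map_smul, smul_eq_mul] at h2
    refine mul_right_cancel₀ h0 ?_
    linear_combination -h2

/-- Polynomials orthogonal to all coefficients are stable under lowering operators: by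
contravariance the operator becomes a raising one on `w` and `u`, where it only shifts indices. The
highest weight vector is such a polynomial, so all of `F(μ)` is orthogonal to the coefficients, and
positivity finishes. -/
lemma eq_zero_of_hwForm (hw : IsSkew w) (h : φ (vmk 1 (hwF lam)) = vec2 w u)
    (h1 : ∀ a b k d, hwForm mu (w a b k d : P) = 0) (h2 : ∀ t, hwForm mu (u t : P) = 0) :
    vec2 w u = 0 := by
  let K : Submodule ℂ P :=
    { carrier := {g | (∀ a b k d, fischer g (w a b k d : P) = 0) ∧ ∀ t, fischer g (u t : P) = 0}
      zero_mem' := by simp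
      add_mem' := fun {g g'} hg hg' => by
        refine ⟨fun a b k d => ?_, fun t => ?_⟩
        · rw [map_add, LinearMap.add_apply, hg.1, hg'.1, add_zero]
        · rw [map_add, LinearMap.add_apply, hg.2, hg'.2, add_zero]
      smul_mem' := fun r g hg => by
        refine ⟨fun a b k d => ?_, fun t => ?_⟩
        · rw [map_smul, LinearMap.smul_apply, hg.1, smul_zero]
        · rw [map_smul, LinearMap.smul_apply, hg.2, smul_zero] }
  have hK : ∀ p q : Fin 5, q < p → ∀ g ∈ K, actDer (mu1 p q) g ∈ K := by
    intro p q hpq g hg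
    have hite : ∀ (r : Prop) [Decidable r] (v : F mu), fischer g (v : P) = 0 →
        fischer g ((if r then v else 0 : F mu) : P) = 0 := fun r _ v hv => by
      split_ifs
      · exact hv
      · simp
    refine ⟨fun a b k d => ?_, fun t => ?_⟩
    · have h3 := (raise_eq_zero φ hw h hpq).1 a b k d
      rw [actTensor_rootE] at h3
      have h4 := congrArg (fun v : F mu => fischer g (v : P)) h3
      simp only [LieSubmodule.coe_add, map_add, coe_lie_F, hite _ _ (hg.1 _ _ _ _), add_zero] at h4
      rw [fischer_actDer, mu1, Matrix.transpose_single]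
      exact h4.trans (map_zero _)
    · have h3 := (raise_eq_zero φ hw h hpq).2 t
      rw [actVec_rootE] at h3
      have h4 := congrArg (fun v : F mu => fischer g (v : P)) h3
      simp only [LieSubmodule.coe_sub, map_sub, coe_lie_F, hite _ _ (hg.2 _), sub_zero] at h4
      rw [fischer_actDer, mu1, Matrix.transpose_single]
      exact h4.trans (map_zero _)
  have hF : ∀ g ∈ F mu, g ∈ K := fun g hg => F_le_of_lower K ⟨h1, h2⟩ hK hg
  have h3 : w = fun _ _ _ _ => 0 := by
    funext a b k d
    exact Subtype.ext (eq_zero_of_fischer_conjP ((hF _ (conjP_mem (w a b k d).2)).1 a b k d))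
  have h4 : u = fun _ => 0 := by
    funext t
    exact Subtype.ext (eq_zero_of_fischer_conjP ((hF _ (conjP_mem (u t).2)).2 t))
  rw [h3, h4, vec2_zero]

/-- A morphism is determined by the image of the highest weight vector. -/
lemma eq_zero_of_hwF (h : φ (vmk 1 (hwF lam)) = 0) : φ = 0 := by
  let N : LieSubmodule ℂ sl5 P :=
    { carrier := {g | ∃ hg : g ∈ F lam, φ (vmk 1 ⟨g, hg⟩) = 0}
      zero_mem' := ⟨zero_mem _, by
        rw [← vmkL_apply]
        exact (congrArg φ (map_zero (vmkL (1 : U)))).trans (map_zero φ)⟩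
      add_mem' := fun {a b} ha hb => by
        obtain ⟨ha, ha'⟩ := ha
        obtain ⟨hb, hb'⟩ := hb
        refine ⟨add_mem ha hb, ?_⟩
        have := vmk_add_right (1 : U) (⟨a, ha⟩ : F lam) ⟨b, hb⟩
        exact (congrArg φ this).trans (by rw [map_add, ha', hb', add_zero])
      smul_mem' := fun r a ha => by
        obtain ⟨ha, ha'⟩ := ha
        refine ⟨(F lam).smul_mem r ha, ?_⟩
        have := vmk_smul_right r (1 : U) (⟨a, ha⟩ : F lam)
        refine (congrArg φ this).trans ?_
        rw [show φ (r • vmk 1 (⟨a, ha⟩ : F lam)) = r • φ (vmk 1 (⟨a, ha⟩ : F lam)) from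
          (φ.restrictScalars ℂ).map_smul _ _, ha', smul_zero]
      lie_mem := fun {A a} ha => by
        obtain ⟨ha, ha'⟩ := ha
        refine ⟨(F lam).lie_mem ha, ?_⟩
        have := map_vmk_lie φ A (⟨a, ha⟩ : F lam)
        rw [ha', smul_zero] at this
        exact this }
  have hN : ∀ v : F lam, φ (vmk 1 v) = 0 := fun v =>
    (F_le (N := N) ⟨hw_mem lam, h⟩ v.2).2
  refine LinearMap.ext fun z => ?_
  obtain ⟨y, rfl⟩ := Submodule.mkQ_surjective _ z
  induction y using TensorProduct.induction_on with
  | zero => rw [map_zero, map_zero, map_zero]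
  | add a b ha hb => rw [map_add, map_add, ha, hb, map_add]
  | tmul r v =>
    rw [mkQ_tmul, ← mul_one r, ← smul_vmk, map_smul, hN, smul_zero]
    rfl

end

/-! ### The linear algebra of singular vectors -/

lemma sum_five_of_nodup {W : Type*} [AddCommMonoid W] {a b c d e : Fin 5}
    (h : [a, b, c, d, e].Nodup) (f : Fin 5 → W) :
    ∑ x, f x = f a + f b + f c + f d + f e := by
  have h2 : (Finset.univ : Finset (Fin 5)) = {a, b, c, d, e} := by
    symm
    rw [← Finset.card_eq_iff_eq_univ, Fintype.card_fin]
    exact (congrArg Finset.card (by simp : ({a, b, c, d, e} : Finset (Fin 5)) =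
      [a, b, c, d, e].toFinset)).trans (List.toFinset_card_of_nodup h)
  simp only [List.nodup_cons, List.mem_cons, List.not_mem_nil, or_false, not_or] at h
  rw [h2, Finset.sum_insert (by simp [h]), Finset.sum_insert (by simp [h]),
    Finset.sum_insert (by simp [h]), Finset.sum_pair (by simp [h])]
  simp only [add_assoc]

set_option maxRecDepth 100000 in
lemma levi_mul_self : ∀ {j l a b e : Fin 5}, [j, l, a, b, e].Nodup →
    levi j l a b e * levi j l a b e = 1 := by decide

set_option maxRecDepth 100000 in
lemma levi_skew_last : ∀ k l a b e : Fin 5, levi k l a e b = - levi k l a b e := by decide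

lemma levi_repeat (i j : Fin 5) : (∀ y z, levi i j i y z = 0) ∧ (∀ y z, levi i j j y z = 0) ∧
    (∀ x z, levi i j x i z = 0) ∧ (∀ x z, levi i j x j z = 0) ∧ (∀ x y, levi i j x y i = 0) ∧
    (∀ x y, levi i j x y j = 0) ∧ (∀ x z, levi i j x x z = 0) ∧ (∀ x y, levi i j x y x = 0) ∧
    ∀ x y, levi i j x y y = 0 := by
  refine ⟨?_, ?_, ?_, ?_, ?_, ?_, ?_, ?_, ?_⟩ <;> intros <;>
    exact levi_eq_zero _ _ _ _ _ (by simp)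

lemma levi_perms (k l a b e : Fin 5) : levi k l b a e = - levi k l a b e ∧
    levi k l b e a = levi k l a b e ∧ levi k l e b a = - levi k l a b e ∧
    levi k l e a b = levi k l a b e ∧ levi k l a e b = - levi k l a b e := by
  have h1 : ∀ k l a b e : Fin 5, levi k l b a e = - levi k l a b e := levi_skew_right'
  have h2 : ∀ k l a b e : Fin 5, levi k l a e b = - levi k l a b e := levi_skew_last
  refine ⟨h1 _ _ _ _ _, ?_, ?_, ?_, h2 _ _ _ _ _⟩
  · rw [h2, h1, neg_neg]
  · rw [h1, h2, h1, neg_neg]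
  · rw [h1, h2, neg_neg]

/-- Only the six orderings of `a`, `b`, `e` survive, and skewness of `G` in its first two arguments
pairs them into three cyclic terms. -/
lemma sum_levi_of_nodup {k l a b e : Fin 5} (h : [k, l, a, b, e].Nodup)
    (G : Fin 5 → Fin 5 → Fin 5 → ℂ) (hG : ∀ x y z, G y x z = - G x y z) :
    ∑ x, ∑ y, ∑ z, (levi k l x y z : ℂ) * G x y z =
      2 * (levi k l a b e : ℂ) * (G a b e + G b e a + G e a b) := by
  have h0 := levi_repeat k l
  simp only [sum_five_of_nodup h, h0, Int.cast_zero, zero_mul, zero_add, add_zero]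
  obtain ⟨h1, h2, h3, h4, h5⟩ := levi_perms k l a b e
  rw [h1, h2, h3, h4, h5, hG a b e, hG b e a, hG e a b]
  push_cast
  ring

section

variable {m : Fin 5 → ℂ} {c : Fin 5 → Fin 5 → Fin 5 → Fin 5 → ℂ} {u : Fin 5 → ℂ}

lemma raised_skew (hc : IsSkew c) (p q a b k d : Fin 5) :
    raised m c p q b a k d = - raised m c p q a b k d := by
  have h : ∀ x y z t, c x y z t = - c y x z t := hc.left
  simp only [raised]
  rw [h b a k d, h q a k d, h b q k d, h b a q d, h b a k q]
  split_ifs <;> ring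

lemma singT_eq (hc : IsSkew c) {j l a b e : Fin 5} (h : [j, l, a, b, e].Nodup) (i k d : Fin 5) :
    singT m c u i j l k d = 2 * (levi j l a b e : ℂ) *
      ((2 * raised m c i e a b k d + ((if k = i then c a b e d else 0) +
          (if d = i then c a b k e else 0))) +
        (2 * raised m c i a b e k d + ((if k = i then c b e a d else 0) +
          (if d = i then c b e k a else 0))) +
        (2 * raised m c i b e a k d + ((if k = i then c e a b d else 0) +
          (if d = i then c e a k b else 0)))) - (1 / 2) * (elem j l k d * u i) := by
  rw [singT, sum_levi_of_nodup h]
  intro x y z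
  rw [raised_skew hc, hc.left y x z d, hc.left y x k z]
  split_ifs <;> ring

end

/-- Normalization of the indices of a skew tensor. -/
lemma IsSkew.normalize {c : Fin 5 → Fin 5 → Fin 5 → Fin 5 → ℂ} (hc : IsSkew c) :
    (∀ a b k d, b < a → c a b k d = - c b a k d) ∧ (∀ a b k d, d < k → c a b k d = - c a b d k) ∧
    (∀ a b k d, k < a → c a b k d = - c k d a b) ∧ (∀ a b d, d < b → c a b a d = - c a d a b) ∧
    (∀ a k d, c a a k d = 0) ∧ (∀ a b k, c a b k k = 0) ∧ ∀ a b, c a b a b = 0 := by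
  refine ⟨fun a b k d _ => hc.left a b k d, fun a b k d _ => hc.right a b k d,
    fun a b k d _ => hc.swap a b k d, fun a b d _ => hc.swap a b a d, fun a k d => ?_,
    fun a b k => ?_, fun a b => ?_⟩
  · exact self_eq_neg.mp (hc.left a a k d)
  · exact self_eq_neg.mp (hc.right a b k k)
  · exact self_eq_neg.mp (hc.swap a b a b)

section

variable {lam mu : Fin 4 → ℕ} {c : Fin 5 → Fin 5 → Fin 5 → Fin 5 → ℂ} {u : Fin 5 → ℂ}

/-- The equations coming from `x_k d_kl`. -/
lemma IsSingular.cyclic (h : IsSingular lam mu c u) {k l a b e : Fin 5}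
    (hn : [k, l, a, b, e].Nodup) {f : Fin 5} (hf : f ≠ k) :
    (if k < e then -1 else 1) * c a b e f + (if k < a then -1 else 1) * c b e a f +
      (if k < b then -1 else 1) * c e a b f =
      (1 / 4) * (levi k l a b e : ℂ) * (if f = l then u k else 0) := by
  -- The form is `2 x_k d_kl`, tested in the component `(k, f)`.
  have h1 := h.eq k k l k f
  rw [singT_eq h.skew hn] at h1
  have hs : (levi k l a b e : ℂ) * (levi k l a b e : ℂ) = 1 := by
    have : levi k l a b e * levi k l a b e = 1 := levi_mul_self hn
    exact_mod_cast this
  simp only [List.nodup_cons, List.mem_cons, List.not_mem_nil, or_false, not_or] at hn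
  obtain ⟨⟨hkl, hka, hkb, hke⟩, -⟩ := hn
  have he : elem k l k f = if f = l then 1 else 0 := by simp [elem, hkl]
  -- The index `k` sits only in the third slot. The bracket contributes 1 there, and a raising
  -- operator a further −2, hence the signs of the statement.
  have hr : ∀ x y z, x ≠ k → y ≠ k → z ≠ k → raised (wt mu) c k z x y k f =
      if k < z then - c x y z f else 0 := fun x y z hx hy hz => by
    simp [raised, hx, hy, hz.symm, hf]
  rw [hr a b e (Ne.symm hka) (Ne.symm hkb) (Ne.symm hke),
    hr b e a (Ne.symm hkb) (Ne.symm hke) (Ne.symm hka),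
    hr e a b (Ne.symm hke) (Ne.symm hka) (Ne.symm hkb), he] at h1
  simp only [if_true, hf, if_false] at h1
  have h2 : 4 * (levi k l a b e : ℂ) * ((if k < e then -1 else 1) * c a b e f +
      (if k < a then -1 else 1) * c b e a f + (if k < b then -1 else 1) * c e a b f) =
      if f = l then u k else 0 := by
    simp only [ite_mul, one_mul, zero_mul] at h1
    split_ifs at h1 ⊢ <;> linear_combination h1
  linear_combination (1 / 4) * (levi k l a b e : ℂ) * h2 -
    ((if k < e then -1 else 1) * c a b e f + (if k < a then -1 else 1) * c b e a f +
      (if k < b then -1 else 1) * c e a b f) * hs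

end

section

variable {lam mu : Fin 4 → ℕ} {c : Fin 5 → Fin 5 → Fin 5 → Fin 5 → ℂ} {u : Fin 5 → ℂ}

/-- For `f = b` the third term of `IsSingular.cyclic` vanishes and the other two coincide up to the
explicit signs. If `k` lies on the same side of `a` and `e`, the signs agree and the terms add up.
-/
lemma IsSingular.repeated_eq_zero (h : IsSingular lam mu c u) {k l a b e : Fin 5}
    (hn : [k, l, a, b, e].Nodup) (hk : (k < a ∧ k < e) ∨ (a < k ∧ e < k)) : c a b e b = 0 := by
  have hn' := hn
  simp only [List.nodup_cons, List.mem_cons, List.not_mem_nil, or_false, not_or] at hn'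
  have h1 := h.cyclic hn (f := b) (Ne.symm hn'.1.2.2.1)
  rw [if_neg (Ne.symm hn'.2.1.2.1), h.skew.swap b e a b, h.skew.right a b b e,
    h.skew.normalize.2.2.2.2.2.1 e a b] at h1
  rcases hk with ⟨h2, h3⟩ | ⟨h2, h3⟩
  · rw [if_pos h2, if_pos h3] at h1
    linear_combination (-1 / 2) * h1
  · rw [if_neg h2.not_gt, if_neg h3.not_gt] at h1
    linear_combination (1 / 2) * h1

lemma eq_zero_of_natCast_mul {n : ℕ} {x : ℂ} (h : ((n : ℂ) + 1) * x = 0) : x = 0 :=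
  (mul_eq_zero.mp h).resolve_left (Nat.cast_add_one_ne_zero n)

/-- The unknowns are the three pairings of `{1, 2, 3, 4}` and `u_0`. Since 0 lies below all other
indices, the four forms `x_0 d_0l` give an invertible system that does not involve `μ`. -/
lemma IsSingular.without_zero (h : IsSingular lam mu c u) :
    c 1 2 3 4 = 0 ∧ c 1 3 2 4 = 0 ∧ c 1 4 2 3 = 0 ∧ u 0 = 0 := by
  obtain ⟨n1, n2, n3, n4, n5, n6, n7⟩ := h.skew.normalize
  have e1 : ((-4)) * c 1 2 3 4 + ((4)) * c 1 3 2 4 + ((-4)) * c 1 4 2 3 + ((-1)) * u 0 = 0 := by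
    have e := h.eq 0 0 1 0 1
    rw [singT_eq h.skew (j := 0) (l := 1) (a := 2) (b := 3) (e := 4) (by decide)] at e
    simp [raised, elem, levi] at e
    simp [n1, n2, n3, n4, n5, n6, n7, wt] at e
    linear_combination 2 * e
  have e2 : ((-4)) * c 1 2 3 4 + ((-4)) * c 1 3 2 4 + ((4)) * c 1 4 2 3 + ((-1)) * u 0 = 0 := by
    have e := h.eq 0 0 2 0 2
    rw [singT_eq h.skew (j := 0) (l := 2) (a := 1) (b := 3) (e := 4) (by decide)] at e
    simp [raised, elem, levi] at e
    simp [n1, n2, n3, n4, n5, n6, n7, wt] at e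
    linear_combination 2 * e
  have e3 : ((4)) * c 1 2 3 4 + ((4)) * c 1 3 2 4 + ((4)) * c 1 4 2 3 + ((-1)) * u 0 = 0 := by
    have e := h.eq 0 0 3 0 3
    rw [singT_eq h.skew (j := 0) (l := 3) (a := 1) (b := 2) (e := 4) (by decide)] at e
    simp [raised, elem, levi] at e
    simp [n1, n2, n3, n4, n5, n6, n7, wt] at e
    linear_combination 2 * e
  have e4 : ((4)) * c 1 2 3 4 + ((-4)) * c 1 3 2 4 + ((-4)) * c 1 4 2 3 + ((-1)) * u 0 = 0 := by
    have e := h.eq 0 0 4 0 4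
    rw [singT_eq h.skew (j := 0) (l := 4) (a := 1) (b := 2) (e := 3) (by decide)] at e
    simp [raised, elem, levi] at e
    simp [n1, n2, n3, n4, n5, n6, n7, wt] at e
    linear_combination 2 * e
  refine ⟨?_, ?_, ?_, ?_⟩ <;> grind

/-- As for the index 0, since 4 lies above all other indices. -/
lemma IsSingular.without_four (h : IsSingular lam mu c u) :
    c 0 1 2 3 = 0 ∧ c 0 2 1 3 = 0 ∧ c 0 3 1 2 = 0 ∧ u 4 = 0 := by
  obtain ⟨n1, n2, n3, n4, n5, n6, n7⟩ := h.skew.normalize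
  have e1 : ((-4)) * c 0 1 2 3 + ((4)) * c 0 2 1 3 + ((-4)) * c 0 3 1 2 + ((1)) * u 4 = 0 := by
    have e := h.eq 4 4 0 0 4
    rw [singT_eq h.skew (j := 4) (l := 0) (a := 1) (b := 2) (e := 3) (by decide)] at e
    simp [raised, elem, levi] at e
    simp [n1, n2, n3, n4, n5, n6, n7, wt] at e
    linear_combination 2 * e
  have e2 : ((-4)) * c 0 1 2 3 + ((-4)) * c 0 2 1 3 + ((4)) * c 0 3 1 2 + ((1)) * u 4 = 0 := by
    have e := h.eq 4 4 1 1 4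
    rw [singT_eq h.skew (j := 4) (l := 1) (a := 0) (b := 2) (e := 3) (by decide)] at e
    simp [raised, elem, levi] at e
    simp [n1, n2, n3, n4, n5, n6, n7, wt] at e
    linear_combination 2 * e
  have e3 : ((4)) * c 0 1 2 3 + ((4)) * c 0 2 1 3 + ((4)) * c 0 3 1 2 + ((1)) * u 4 = 0 := by
    have e := h.eq 4 4 2 2 4
    rw [singT_eq h.skew (j := 4) (l := 2) (a := 0) (b := 1) (e := 3) (by decide)] at e
    simp [raised, elem, levi] at e
    simp [n1, n2, n3, n4, n5, n6, n7, wt] at e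
    linear_combination 2 * e
  have e4 : ((4)) * c 0 1 2 3 + ((-4)) * c 0 2 1 3 + ((-4)) * c 0 3 1 2 + ((1)) * u 4 = 0 := by
    have e := h.eq 4 4 3 3 4
    rw [singT_eq h.skew (j := 4) (l := 3) (a := 0) (b := 1) (e := 2) (by decide)] at e
    simp [raised, elem, levi] at e
    simp [n1, n2, n3, n4, n5, n6, n7, wt] at e
    linear_combination 2 * e
  refine ⟨?_, ?_, ?_, ?_⟩ <;> grind

/-- Two forms `x_1 d_1l` give `u_1 = 0` and one relation among the three pairings. Two mixed forms
complete this to a triangular system, with pivots `2 + μ_0 + μ_1 + μ_2 + μ_3` and `1 + μ_0 + μ_1 +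
μ_2`, nonzero because `μ` is dominant. -/
lemma IsSingular.without_one (h : IsSingular lam mu c u) :
    c 0 2 3 4 = 0 ∧ c 0 3 2 4 = 0 ∧ c 0 4 2 3 = 0 ∧ u 1 = 0 := by
  obtain ⟨n1, n2, n3, n4, n5, n6, n7⟩ := h.skew.normalize
  have e1 : ((-4)) * c 0 2 3 4 + ((4)) * c 0 3 2 4 + ((-4)) * c 0 4 2 3 + ((1)) * u 1 = 0 := by
    have e := h.eq 1 1 0 0 1
    rw [singT_eq h.skew (j := 1) (l := 0) (a := 2) (b := 3) (e := 4) (by decide)] at e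
    simp [raised, elem, levi] at e
    simp [n1, n2, n3, n4, n5, n6, n7, wt] at e
    linear_combination 2 * e
  have e2 : ((-4)) * c 0 2 3 4 + ((4)) * c 0 3 2 4 + ((-4)) * c 0 4 2 3 + ((-1)) * u 1 = 0 := by
    have e := h.eq 1 1 2 1 2
    rw [singT_eq h.skew (j := 1) (l := 2) (a := 0) (b := 3) (e := 4) (by decide)] at e
    simp [raised, elem, levi] at e
    simp [n1, n2, n3, n4, n5, n6, n7, wt] at e
    linear_combination 2 * e
  have e3 : ((8) + (4) * (mu 0 : ℂ) + (4) * (mu 1 : ℂ) + (4) * (mu 2 : ℂ) + (4) * (mu 3 : ℂ)) * c 0 4 2 3 = 0 := by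
    have e := h.eq 0 4 1 0 4
    rw [singT_eq h.skew (j := 4) (l := 1) (a := 0) (b := 2) (e := 3) (by decide),
      singT_eq h.skew (j := 0) (l := 1) (a := 2) (b := 3) (e := 4) (by decide)] at e
    simp [raised, elem, levi] at e
    simp [n1, n2, n3, n4, n5, n6, n7, wt] at e
    linear_combination e
  have e4 : ((-4) + (-4) * (mu 0 : ℂ) + (-4) * (mu 1 : ℂ) + (-4) * (mu 2 : ℂ)) * c 0 3 2 4 + ((4)) * c 0 4 2 3 = 0 := by
    have e := h.eq 0 3 1 0 3
    rw [singT_eq h.skew (j := 3) (l := 1) (a := 0) (b := 2) (e := 4) (by decide),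
      singT_eq h.skew (j := 0) (l := 1) (a := 2) (b := 3) (e := 4) (by decide)] at e
    simp [raised, elem, levi] at e
    simp [n1, n2, n3, n4, n5, n6, n7, wt] at e
    linear_combination e
  have h1 : c 0 4 2 3 = 0 := by
    refine eq_zero_of_natCast_mul (n := 1 + (mu 0 + mu 1 + mu 2 + mu 3)) ?_
    push_cast
    linear_combination (1 / 4) * e3
  have h2 : c 0 3 2 4 = 0 := by
    refine eq_zero_of_natCast_mul (n := mu 0 + mu 1 + mu 2) ?_
    push_cast
    linear_combination (-1 / 4) * e4 + h1
  refine ⟨?_, h2, h1, ?_⟩ <;> grind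

/-- As for the omitted index 1, now with pivots `2 + μ_0 + μ_1 + μ_2 + μ_3` and `1 + μ_0 + μ_1`. -/
lemma IsSingular.without_three (h : IsSingular lam mu c u) :
    c 0 1 2 4 = 0 ∧ c 0 2 1 4 = 0 ∧ c 0 4 1 2 = 0 ∧ u 3 = 0 := by
  obtain ⟨n1, n2, n3, n4, n5, n6, n7⟩ := h.skew.normalize
  have e1 : ((4)) * c 0 1 2 4 + ((-4)) * c 0 2 1 4 + ((-4)) * c 0 4 1 2 + ((1)) * u 3 = 0 := by
    have e := h.eq 3 3 0 0 3
    rw [singT_eq h.skew (j := 3) (l := 0) (a := 1) (b := 2) (e := 4) (by decide)] at e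
    simp [raised, elem, levi] at e
    simp [n1, n2, n3, n4, n5, n6, n7, wt] at e
    linear_combination 2 * e
  have e2 : ((4)) * c 0 1 2 4 + ((-4)) * c 0 2 1 4 + ((-4)) * c 0 4 1 2 + ((-1)) * u 3 = 0 := by
    have e := h.eq 3 3 4 3 4
    rw [singT_eq h.skew (j := 3) (l := 4) (a := 0) (b := 1) (e := 2) (by decide)] at e
    simp [raised, elem, levi] at e
    simp [n1, n2, n3, n4, n5, n6, n7, wt] at e
    linear_combination 2 * e
  have e3 : ((8) + (4) * (mu 0 : ℂ) + (4) * (mu 1 : ℂ) + (4) * (mu 2 : ℂ) + (4) * (mu 3 : ℂ)) * c 0 4 1 2 = 0 := by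
    have e := h.eq 0 4 3 0 4
    rw [singT_eq h.skew (j := 4) (l := 3) (a := 0) (b := 1) (e := 2) (by decide),
      singT_eq h.skew (j := 0) (l := 3) (a := 1) (b := 2) (e := 4) (by decide)] at e
    simp [raised, elem, levi] at e
    simp [n1, n2, n3, n4, n5, n6, n7, wt] at e
    linear_combination e
  have e4 : ((-4) + (-4) * (mu 0 : ℂ) + (-4) * (mu 1 : ℂ)) * c 0 2 1 4 + ((4)) * c 0 4 1 2 = 0 := by
    have e := h.eq 0 2 3 0 2
    rw [singT_eq h.skew (j := 2) (l := 3) (a := 0) (b := 1) (e := 4) (by decide),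
      singT_eq h.skew (j := 0) (l := 3) (a := 1) (b := 2) (e := 4) (by decide)] at e
    simp [raised, elem, levi] at e
    simp [n1, n2, n3, n4, n5, n6, n7, wt] at e
    linear_combination e
  have h1 : c 0 4 1 2 = 0 := by
    refine eq_zero_of_natCast_mul (n := 1 + (mu 0 + mu 1 + mu 2 + mu 3)) ?_
    push_cast
    linear_combination (1 / 4) * e3
  have h2 : c 0 2 1 4 = 0 := by
    refine eq_zero_of_natCast_mul (n := mu 0 + mu 1) ?_
    push_cast
    linear_combination (-1 / 4) * e4 + h1
  refine ⟨?_, h2, h1, ?_⟩ <;> grind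

/-- With the omitted index in the middle, the forms `x_2 d_2l` leave `c_0134` free; it is the
distinguished coefficient of `∇_C ∇_A`. If it is nonzero, four mixed forms determine the four
coordinates of `μ`. -/
lemma IsSingular.without_two (h : IsSingular lam mu c u) :
    c 0 3 1 4 = 0 ∧ c 0 4 1 3 = 0 ∧ u 2 = 4 * c 0 1 3 4 ∧
      (c 0 1 3 4 ≠ 0 → mu = ![0, 0, 1, 0]) := by
  obtain ⟨n1, n2, n3, n4, n5, n6, n7⟩ := h.skew.normalize
  have e1 : ((-4)) * c 0 1 3 4 + ((-4)) * c 0 3 1 4 + ((4)) * c 0 4 1 3 + ((1)) * u 2 = 0 := by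
    have e := h.eq 2 2 0 0 2
    rw [singT_eq h.skew (j := 2) (l := 0) (a := 1) (b := 3) (e := 4) (by decide)] at e
    simp [raised, elem, levi] at e
    simp [n1, n2, n3, n4, n5, n6, n7, wt] at e
    linear_combination 2 * e
  have e2 : ((-4)) * c 0 1 3 4 + ((4)) * c 0 3 1 4 + ((-4)) * c 0 4 1 3 + ((1)) * u 2 = 0 := by
    have e := h.eq 2 2 1 1 2
    rw [singT_eq h.skew (j := 2) (l := 1) (a := 0) (b := 3) (e := 4) (by decide)] at e
    simp [raised, elem, levi] at e
    simp [n1, n2, n3, n4, n5, n6, n7, wt] at e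
    linear_combination 2 * e
  have e3 : ((4)) * c 0 1 3 4 + ((4)) * c 0 3 1 4 + ((4)) * c 0 4 1 3 + ((-1)) * u 2 = 0 := by
    have e := h.eq 2 2 4 2 4
    rw [singT_eq h.skew (j := 2) (l := 4) (a := 0) (b := 1) (e := 3) (by decide)] at e
    simp [raised, elem, levi] at e
    simp [n1, n2, n3, n4, n5, n6, n7, wt] at e
    linear_combination 2 * e
  have h1 : c 0 3 1 4 = 0 ∧ c 0 4 1 3 = 0 ∧ u 2 = 4 * c 0 1 3 4 := by
    refine ⟨?_, ?_, ?_⟩ <;> grind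
  refine ⟨h1.1, h1.2.1, h1.2.2, fun h0 => ?_⟩
  have e4 : ((-4) * (mu 0 : ℂ)) * c 0 1 3 4 + ((4)) * c 0 3 1 4 + ((-4)) * c 0 4 1 3 = 0 := by
    have e := h.eq 0 1 2 0 1
    rw [singT_eq h.skew (j := 1) (l := 2) (a := 0) (b := 3) (e := 4) (by decide),
      singT_eq h.skew (j := 0) (l := 2) (a := 1) (b := 3) (e := 4) (by decide)] at e
    simp [raised, elem, levi] at e
    simp [n1, n2, n3, n4, n5, n6, n7, wt] at e
    linear_combination e
  have e5 : ((2) + (4) * (mu 0 : ℂ) + (4) * (mu 1 : ℂ)) * c 0 1 3 4 + ((-2)) * c 0 3 1 4 + ((2)) * c 0 4 1 3 + ((-1/2)) * u 2 = 0 := by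
    have e := h.eq 0 2 1 0 1
    rw [singT_eq h.skew (j := 2) (l := 1) (a := 0) (b := 3) (e := 4) (by decide),
      singT_eq h.skew (j := 0) (l := 1) (a := 2) (b := 3) (e := 4) (by decide)] at e
    simp [raised, elem, levi] at e
    simp [n1, n2, n3, n4, n5, n6, n7, wt] at e
    linear_combination e
  have e6 : ((4) * (mu 3 : ℂ)) * c 0 1 3 4 + ((-4)) * c 0 3 1 4 + ((-4)) * c 0 4 1 3 = 0 := by
    have e := h.eq 3 4 2 3 4
    rw [singT_eq h.skew (j := 4) (l := 2) (a := 0) (b := 1) (e := 3) (by decide),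
      singT_eq h.skew (j := 3) (l := 2) (a := 0) (b := 1) (e := 4) (by decide)] at e
    simp [raised, elem, levi] at e
    simp [n1, n2, n3, n4, n5, n6, n7, wt] at e
    linear_combination e
  have e7 : ((4) * (mu 2 : ℂ) + (-2)) * c 0 1 3 4 + ((2)) * c 0 3 1 4 + ((2)) * c 0 4 1 3 + ((-1/2)) * u 2 = 0 := by
    have e := h.eq 2 3 4 3 4
    rw [singT_eq h.skew (j := 3) (l := 4) (a := 0) (b := 1) (e := 2) (by decide),
      singT_eq h.skew (j := 2) (l := 4) (a := 0) (b := 1) (e := 3) (by decide)] at e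
    simp [raised, elem, levi] at e
    simp [n1, n2, n3, n4, n5, n6, n7, wt] at e
    linear_combination e
  rw [h1.1, h1.2.1] at e4 e5 e6 e7
  rw [h1.2.2] at e5 e7
  have g0 : (mu 0 : ℂ) = 0 := mul_right_cancel₀ h0 (by linear_combination (-1 / 4) * e4)
  have g1 : (mu 1 : ℂ) = 0 := mul_right_cancel₀ h0 (by
    linear_combination (1 / 4) * e5 - c 0 1 3 4 * g0)
  have g3 : (mu 3 : ℂ) = 0 := mul_right_cancel₀ h0 (by linear_combination (1 / 4) * e6)
  have g2 : (mu 2 : ℂ) = 1 := mul_right_cancel₀ h0 (by linear_combination (1 / 4) * e7)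
  funext x
  fin_cases x
  · exact_mod_cast g0
  · exact_mod_cast g1
  · exact_mod_cast g2
  · exact_mod_cast g3

/-- Between outer indices 0 and 4 there is no room for `IsSingular.repeated_eq_zero`. A mixed form
supplies the pivot `1 + μ_0 + μ_1` instead. -/
lemma IsSingular.repeated_one (h : IsSingular lam mu c u) : c 0 1 1 4 = 0 := by
  obtain ⟨n1, n2, n3, n4, n5, n6, n7⟩ := h.skew.normalize
  have e1 : ((-4) + (-4) * (mu 0 : ℂ) + (-4) * (mu 1 : ℂ)) * c 0 1 1 4 = 0 := by
    have e := h.eq 0 2 3 0 1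
    rw [singT_eq h.skew (j := 2) (l := 3) (a := 0) (b := 1) (e := 4) (by decide),
      singT_eq h.skew (j := 0) (l := 3) (a := 1) (b := 2) (e := 4) (by decide)] at e
    simp [raised, elem, levi] at e
    simp [n1, n2, n3, n4, n5, n6, n7, wt] at e
    linear_combination e
  refine eq_zero_of_natCast_mul (n := mu 0 + mu 1) ?_
  push_cast
  linear_combination (-1 / 4) * e1

/-- Here the pivot is `1 + μ_1 + μ_2`. -/
lemma IsSingular.repeated_two (h : IsSingular lam mu c u) : c 0 2 2 4 = 0 := by
  obtain ⟨n1, n2, n3, n4, n5, n6, n7⟩ := h.skew.normalize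
  have e1 : ((4) + (4) * (mu 1 : ℂ) + (4) * (mu 2 : ℂ)) * c 0 2 2 4 = 0 := by
    have e := h.eq 1 3 0 0 2
    rw [singT_eq h.skew (j := 3) (l := 0) (a := 1) (b := 2) (e := 4) (by decide),
      singT_eq h.skew (j := 1) (l := 0) (a := 2) (b := 3) (e := 4) (by decide)] at e
    simp [raised, elem, levi] at e
    simp [n1, n2, n3, n4, n5, n6, n7, wt] at e
    linear_combination e
  refine eq_zero_of_natCast_mul (n := mu 1 + mu 2) ?_
  push_cast
  linear_combination (1 / 4) * e1

/-- The pivot `μ_1 + μ_2 + μ_3` may vanish, but then `μ_2 = 0` and comparison of weights would give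
`λ_2 = −2`. -/
lemma IsSingular.repeated_three (h : IsSingular lam mu c u) : c 0 3 3 4 = 0 := by
  obtain ⟨n1, n2, n3, n4, n5, n6, n7⟩ := h.skew.normalize
  by_contra h0
  have e1 : ((-4) * (mu 1 : ℂ) + (-4) * (mu 2 : ℂ) + (-4) * (mu 3 : ℂ)) * c 0 3 3 4 = 0 := by
    have e := h.eq 1 4 2 3 4
    rw [singT_eq h.skew (j := 4) (l := 2) (a := 0) (b := 1) (e := 3) (by decide),
      singT_eq h.skew (j := 1) (l := 2) (a := 0) (b := 3) (e := 4) (by decide)] at e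
    simp [raised, elem, levi] at e
    simp [n1, n2, n3, n4, n5, n6, n7, wt] at e
    linear_combination e
  have h2 := h.weight 0 3 3 4 h0 2 3 (by decide)
  have g1 : ((mu 1 + mu 2 + mu 3 : ℕ) : ℂ) = 0 := mul_right_cancel₀ h0 (by
    push_cast
    linear_combination (-1 / 4) * e1)
  have g2 : mu 2 = 0 := by
    have : mu 1 + mu 2 + mu 3 = 0 := by exact_mod_cast g1
    omega
  simp [wt, mult, g2] at h2
  have h3 : ((lam 2 + 2 : ℕ) : ℂ) = 0 := by
    push_cast
    linear_combination h2
  have : lam 2 + 2 = 0 := by exact_mod_cast h3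
  omega

/-- This is the distinguished coefficient of `∇_C ∇_B`. Three mixed forms fix `μ_0`, `μ_1`, `μ_2`;
the last coordinate stays free, and comparison of weights relates it to `λ`. -/
lemma IsSingular.repeated_four (h : IsSingular lam mu c u) (h0 : c 0 4 3 4 ≠ 0) :
    ∃ n : ℕ, lam = ![1, 0, 0, n] ∧ mu = ![0, 0, 1, n + 1] := by
  obtain ⟨n1, n2, n3, n4, n5, n6, n7⟩ := h.skew.normalize
  have e1 : ((-4) * (mu 0 : ℂ)) * c 0 4 3 4 = 0 := by
    have e := h.eq 0 1 2 0 4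
    rw [singT_eq h.skew (j := 1) (l := 2) (a := 0) (b := 3) (e := 4) (by decide),
      singT_eq h.skew (j := 0) (l := 2) (a := 1) (b := 3) (e := 4) (by decide)] at e
    simp [raised, elem, levi] at e
    simp [n1, n2, n3, n4, n5, n6, n7, wt] at e
    linear_combination e
  have e2 : ((4) * (mu 0 : ℂ) + (4) * (mu 1 : ℂ)) * c 0 4 3 4 = 0 := by
    have e := h.eq 0 2 1 0 4
    rw [singT_eq h.skew (j := 2) (l := 1) (a := 0) (b := 3) (e := 4) (by decide),
      singT_eq h.skew (j := 0) (l := 1) (a := 2) (b := 3) (e := 4) (by decide)] at e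
    simp [raised, elem, levi] at e
    simp [n1, n2, n3, n4, n5, n6, n7, wt] at e
    linear_combination e
  have e3 : ((4) + (-4) * (mu 2 : ℂ)) * c 0 4 3 4 = 0 := by
    have e := h.eq 2 3 1 3 4
    rw [singT_eq h.skew (j := 3) (l := 1) (a := 0) (b := 2) (e := 4) (by decide),
      singT_eq h.skew (j := 2) (l := 1) (a := 0) (b := 3) (e := 4) (by decide)] at e
    simp [raised, elem, levi] at e
    simp [n1, n2, n3, n4, n5, n6, n7, wt] at e
    linear_combination e
  have g0 : (mu 0 : ℂ) = 0 := mul_right_cancel₀ h0 (by linear_combination (-1 / 4) * e1)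
  have g1 : (mu 1 : ℂ) = 0 := mul_right_cancel₀ h0 (by
    linear_combination (1 / 4) * e2 - c 0 4 3 4 * g0)
  have g2 : (mu 2 : ℂ) = 1 := mul_right_cancel₀ h0 (by linear_combination (-1 / 4) * e3)
  have l0 := h.weight 0 4 3 4 h0 0 1 (by decide)
  have l1 := h.weight 0 4 3 4 h0 1 2 (by decide)
  have l2 := h.weight 0 4 3 4 h0 2 3 (by decide)
  have l3 := h.weight 0 4 3 4 h0 3 4 (by decide)
  simp [wt, mult, g0, g1, g2] at l0 l1 l2 l3
  have l3' : (mu 3 : ℂ) = (lam 3 + 1 : ℕ) := by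
    push_cast
    linear_combination -l3
  refine ⟨lam 3, ?_, ?_⟩
  · funext x
    fin_cases x
    · exact_mod_cast l0
    · exact_mod_cast l1
    · exact_mod_cast l2
    · rfl
  · funext x
    fin_cases x
    · exact_mod_cast g0
    · exact_mod_cast g1
    · exact_mod_cast g2
    · exact_mod_cast l3'

/-- This is the distinguished coefficient of `∇_B ∇_A`. Here `μ_0` is the coordinate that stays
free. -/
lemma IsSingular.repeated_zero (h : IsSingular lam mu c u) (h0 : c 0 1 0 4 ≠ 0) :
    ∃ n : ℕ, lam = ![n + 1, 1, 0, 0] ∧ mu = ![n, 0, 0, 1] := by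
  obtain ⟨n1, n2, n3, n4, n5, n6, n7⟩ := h.skew.normalize
  have e1 : ((4) * (mu 1 : ℂ)) * c 0 1 0 4 = 0 := by
    have e := h.eq 1 2 3 0 1
    rw [singT_eq h.skew (j := 2) (l := 3) (a := 0) (b := 1) (e := 4) (by decide),
      singT_eq h.skew (j := 1) (l := 3) (a := 0) (b := 2) (e := 4) (by decide)] at e
    simp [raised, elem, levi] at e
    simp [n1, n2, n3, n4, n5, n6, n7, wt] at e
    linear_combination e
  have e2 : ((4) * (mu 2 : ℂ)) * c 0 1 0 4 = 0 := by
    have e := h.eq 2 3 1 0 1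
    rw [singT_eq h.skew (j := 3) (l := 1) (a := 0) (b := 2) (e := 4) (by decide),
      singT_eq h.skew (j := 2) (l := 1) (a := 0) (b := 3) (e := 4) (by decide)] at e
    simp [raised, elem, levi] at e
    simp [n1, n2, n3, n4, n5, n6, n7, wt] at e
    linear_combination e
  have e3 : ((-4) * (mu 2 : ℂ) + (-4) * (mu 3 : ℂ) + (4)) * c 0 1 0 4 = 0 := by
    have e := h.eq 2 4 3 0 4
    rw [singT_eq h.skew (j := 4) (l := 3) (a := 0) (b := 1) (e := 2) (by decide),
      singT_eq h.skew (j := 2) (l := 3) (a := 0) (b := 1) (e := 4) (by decide)] at e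
    simp [raised, elem, levi] at e
    simp [n1, n2, n3, n4, n5, n6, n7, wt] at e
    linear_combination 2 * e
  have g1 : (mu 1 : ℂ) = 0 := mul_right_cancel₀ h0 (by linear_combination (1 / 4) * e1)
  have g2 : (mu 2 : ℂ) = 0 := mul_right_cancel₀ h0 (by linear_combination (1 / 4) * e2)
  have g3 : (mu 3 : ℂ) = 1 := mul_right_cancel₀ h0 (by
    linear_combination (-1 / 4) * e3 - c 0 1 0 4 * g2)
  have l0 := h.weight 0 1 0 4 h0 0 1 (by decide)
  have l1 := h.weight 0 1 0 4 h0 1 2 (by decide)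
  have l2 := h.weight 0 1 0 4 h0 2 3 (by decide)
  have l3 := h.weight 0 1 0 4 h0 3 4 (by decide)
  simp [wt, mult, g1, g2, g3] at l0 l1 l2 l3
  refine ⟨mu 0, ?_, ?_⟩
  · funext x
    fin_cases x
    · have : (lam 0 : ℂ) = (mu 0 + 1 : ℕ) := by
        push_cast
        linear_combination l0
      exact_mod_cast this
    · exact_mod_cast l1
    · exact_mod_cast l2
    · exact_mod_cast l3
  · funext x
    fin_cases x
    · rfl
    · exact_mod_cast g1
    · exact_mod_cast g2
    · exact_mod_cast g3

end

/-! ### Collecting the vanishing statements. -/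

section

variable {lam mu : Fin 4 → ℕ} {c : Fin 5 → Fin 5 → Fin 5 → Fin 5 → ℂ} {u : Fin 5 → ℂ}

-- The exceptions are the triples for which no index other than `b` lies outside the interval from
-- `a` to `e`.
set_option maxRecDepth 100000 in
lemma exists_outside_or : ∀ a b e : Fin 5, a < e → a ≠ b → e ≠ b →
    (∃ k l : Fin 5, [k, l, a, b, e].Nodup ∧ ((k < a ∧ k < e) ∨ (a < k ∧ e < k))) ∨
    (a = 0 ∧ e = 4) ∨ (a = 1 ∧ b = 0 ∧ e = 4) ∨ (a = 0 ∧ b = 4 ∧ e = 3) := by decide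

-- Five choices of the omitted index, times three pairings of the remaining four.
set_option maxRecDepth 100000 in
lemma pairing_cases : ∀ a b k d : Fin 5, a < b → k < d → a < k → b ≠ k → b ≠ d →
    (a, b, k, d) ∈ [((0 : Fin 5), (1 : Fin 5), (2 : Fin 5), (3 : Fin 5)), (0, 2, 1, 3),
      (0, 3, 1, 2), (0, 1, 2, 4), (0, 2, 1, 4), (0, 4, 1, 2), (0, 1, 3, 4), (0, 3, 1, 4),
      (0, 4, 1, 3), (0, 2, 3, 4), (0, 3, 2, 4), (0, 4, 2, 3), (1, 2, 3, 4), (1, 3, 2, 4),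
      (1, 4, 2, 3)] := by decide

lemma IsSkew.eq_zero_of_lt (hc : IsSkew c) (h : ∀ a b k d, a < b → k < d → a ≤ k → c a b k d = 0)
    (a b k d : Fin 5) : c a b k d = 0 := by
  have h1 : ∀ a b k d, a < b → k < d → c a b k d = 0 := fun a b k d hab hkd => by
    rcases le_total a k with h2 | h2
    · exact h a b k d hab hkd h2
    · rw [hc.swap, h k d a b hkd hab h2, neg_zero]
  have h2 : ∀ a b k d, a < b → c a b k d = 0 := fun a b k d hab => by
    rcases lt_trichotomy k d with h2 | rfl | h2
    · exact h1 a b k d hab h2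
    · exact hc.normalize.2.2.2.2.2.1 a b k
    · rw [hc.right, h1 a b d k hab h2, neg_zero]
  rcases lt_trichotomy a b with h3 | rfl | h3
  · exact h2 a b k d h3
  · exact hc.normalize.2.2.2.2.1 a k d
  · rw [hc.left, h2 b a k d h3, neg_zero]

/-- A coefficient has either a repeated index or four distinct ones. Up to skewness all of them
vanish unconditionally except the three in the hypotheses, and `u` vanishes with them because `u_2 =
4 c_0134`. -/
lemma IsSingular.eq_zero (h : IsSingular lam mu c u) (h1 : c 0 4 3 4 = 0) (h2 : c 0 1 0 4 = 0)
    (h3 : c 0 1 3 4 = 0) : (∀ a b k d, c a b k d = 0) ∧ ∀ t, u t = 0 := by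
  have n := h.skew.normalize
  obtain ⟨z1, z2, z3, z4⟩ := h.without_zero
  obtain ⟨o1, o2, o3, o4⟩ := h.without_one
  obtain ⟨t1, t2, t3, -⟩ := h.without_two
  obtain ⟨r1, r2, r3, r4⟩ := h.without_three
  obtain ⟨f1, f2, f3, f4⟩ := h.without_four
  have hrep : ∀ a b e, a < e → c a b e b = 0 := by
    intro a b e hae
    by_cases hab : a = b
    · subst hab; exact n.2.2.2.2.1 _ _ _
    by_cases heb : e = b
    · subst heb; exact n.2.2.2.2.2.1 _ _ _
    rcases exists_outside_or a b e hae hab heb with ⟨k, l, hn, hk⟩ | ⟨rfl, rfl⟩ |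
      ⟨rfl, rfl, rfl⟩ | ⟨rfl, rfl, rfl⟩
    · exact h.repeated_eq_zero hn hk
    · rw [h.skew.right]
      fin_cases b
      · exact absurd rfl hab
      · simpa using h.repeated_one
      · simpa using h.repeated_two
      · simpa using h.repeated_three
      · exact absurd rfl heb
    · rw [h.skew.right, h.skew.left, h2, neg_neg]
    · exact h1
  have hrep' : ∀ a b e, c a b e b = 0 := by
    intro a b e
    rcases lt_trichotomy a e with h4 | rfl | h4
    · exact hrep a b e h4
    · exact n.2.2.2.2.2.2 a b
    · rw [h.skew.swap, hrep e b a h4, neg_zero]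
  refine ⟨h.skew.eq_zero_of_lt fun a b k d hab hkd hak => ?_, fun t => ?_⟩
  · rcases hak.eq_or_lt with rfl | hak
    · rw [h.skew.left, h.skew.right, hrep', neg_zero, neg_zero]
    by_cases hbk : b = k
    · subst hbk
      rw [h.skew.right, hrep', neg_zero]
    by_cases hbd : b = d
    · subst hbd
      exact hrep' _ _ _
    have := pairing_cases a b k d hab hkd hak hbk hbd
    simp only [List.mem_cons, Prod.mk.injEq, List.not_mem_nil, or_false] at this
    rcases this with h | h | h | h | h | h | h | h | h | h | h | h | h | h | h <;>
    · obtain ⟨rfl, rfl, rfl, rfl⟩ := h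
      assumption
  · fin_cases t
    · exact z4
    · exact o4
    · exact t3.trans (by rw [h3, mul_zero])
    · exact r4
    · exact f4

lemma IsSingular.weights (h : IsSingular lam mu c u)
    (h0 : ¬ ((∀ a b k d, c a b k d = 0) ∧ ∀ t, u t = 0)) :
    (∃ n : ℕ, lam = ![1, 0, 0, n] ∧ mu = ![0, 0, 1, n + 1]) ∨
    (∃ n : ℕ, lam = ![n + 1, 1, 0, 0] ∧ mu = ![n, 0, 0, 1]) ∨
    (lam = ![0, 1, 0, 0] ∧ mu = ![0, 0, 1, 0]) := by
  by_cases h1 : c 0 4 3 4 = 0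
  · by_cases h2 : c 0 1 0 4 = 0
    · have h3 : c 0 1 3 4 ≠ 0 := fun h3 => h0 (h.eq_zero h1 h2 h3)
      have hmu := h.without_two.2.2.2 h3
      have l0 := h.weight 0 1 3 4 h3 0 1 (by decide)
      have l1 := h.weight 0 1 3 4 h3 1 2 (by decide)
      have l2 := h.weight 0 1 3 4 h3 2 3 (by decide)
      have l3 := h.weight 0 1 3 4 h3 3 4 (by decide)
      simp [wt, mult, hmu] at l0 l1 l2 l3
      refine Or.inr (Or.inr ⟨?_, hmu⟩)
      funext x
      fin_cases x
      · exact_mod_cast l0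
      · exact_mod_cast l1
      · exact_mod_cast l2
      · exact_mod_cast l3
    · exact Or.inr (Or.inl (h.repeated_zero h2))
  · exact Or.inl (h.repeated_four h1)

/-- Either of the other two distinguished coefficients, if nonzero, would force a different `λ`. So
for this `λ` the solutions are determined by one number; the next two lemmas treat the remaining
cases. -/
lemma IsSingular.eq_zero_of_weights_B_C (h : IsSingular lam mu c u) {n : ℕ}
    (hl : lam = ![1, 0, 0, n]) (h1 : c 0 4 3 4 = 0) :
    (∀ a b k d, c a b k d = 0) ∧ ∀ t, u t = 0 := by
  refine h.eq_zero h1 ?_ ?_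
  · by_contra h2
    obtain ⟨m, h3, -⟩ := h.repeated_zero h2
    rw [hl] at h3
    simpa using congrFun h3 1
  · by_contra h2
    have h3 := h.weight 0 1 3 4 h2 0 1 (by decide)
    have hmu := h.without_two.2.2.2 h2
    simp [wt, mult, hl, hmu] at h3

lemma IsSingular.eq_zero_of_weights_A_B (h : IsSingular lam mu c u) {n : ℕ}
    (hl : lam = ![n + 1, 1, 0, 0]) (h1 : c 0 1 0 4 = 0) :
    (∀ a b k d, c a b k d = 0) ∧ ∀ t, u t = 0 := by
  refine h.eq_zero ?_ h1 ?_
  · by_contra h2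
    obtain ⟨m, h3, -⟩ := h.repeated_four h2
    rw [hl] at h3
    simpa using congrFun h3 1
  · by_contra h2
    have h3 := h.weight 0 1 3 4 h2 0 1 (by decide)
    have hmu := h.without_two.2.2.2 h2
    simp [wt, mult, hl, hmu] at h3
    exact Nat.cast_add_one_ne_zero n h3

lemma IsSingular.eq_zero_of_weights_A_C (h : IsSingular lam mu c u)
    (hl : lam = ![0, 1, 0, 0]) (h1 : c 0 1 3 4 = 0) :
    (∀ a b k d, c a b k d = 0) ∧ ∀ t, u t = 0 := by
  refine h.eq_zero ?_ ?_ h1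
  · by_contra h2
    obtain ⟨m, h3, -⟩ := h.repeated_four h2
    rw [hl] at h3
    simpa using congrFun h3 1
  · by_contra h2
    obtain ⟨m, h3, -⟩ := h.repeated_zero h2
    rw [hl] at h3
    simpa using congrFun h3 0

end

/-! ### Morphisms of degree one -/

section

variable {V W : Type} [AddCommGroup V] [Module ℂ V] [LieRingModule sl5 V]
  [AddCommGroup W] [Module ℂ W] [LieRingModule sl5 W]

/-- The universal property of the induced module. -/
lemma exists_verma_lift (Ψ : V →ₗ[ℂ] Verma W)
    (h : ∀ x ∈ nonnegPart, ∀ v, toU x • Ψ v = Ψ ⁅linPart x, v⁆) :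
    ∃ φ : Verma V →ₗ[U] Verma W, ∀ v, φ (vmk 1 v) = Ψ v := by
  let f : U ⊗[ℂ] V →ₗ[U] Verma W :=
    TensorProduct.AlgebraTensorModule.lift (LinearMap.toSpanSingleton U (V →ₗ[ℂ] Verma W) Ψ)
  have hf : ∀ (u : U) (v : V), f (u ⊗ₜ v) = u • Ψ v := fun u v => rfl
  refine ⟨(vermaRel V).liftQ f ?_, fun v => ?_⟩
  · rw [vermaRel, Submodule.span_le]
    rintro z ⟨x, hx, v, rfl⟩
    rw [SetLike.mem_coe, LinearMap.mem_ker, map_sub, hf, hf, one_smul, h x hx, sub_self]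
  · change f (1 ⊗ₜ v) = _
    rw [hf, one_smul]

/-- The map `v ↦ ∑ d_ab ⊗ θ_ab v`. -/
def degOne (θ : Fin 5 → Fin 5 → V →ₗ[ℂ] W) : V →ₗ[ℂ] Verma W :=
  ∑ a, ∑ b, (vmkL (toU (dForm a b))).comp (θ a b)

lemma degOne_apply (θ : Fin 5 → Fin 5 → V →ₗ[ℂ] W) (v : V) :
    degOne θ v = ∑ a, ∑ b, vmk (toU (dForm a b)) (θ a b v) := by
  simp [degOne, vmkL_apply]

lemma bracket_dForm_mem_of_isEven {x : L} (hx : IsEven x) (h0 : linPart x = 0) (a b : Fin 5) :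
    bracket x (dForm a b) ∈ nonnegPart := by
  rw [mem_nonnegPart]
  have h1 : ∀ i j, c0 (D i (x.1.1 j)) = 0 := fun i j => by
    rw [← linPart_mat, h0, map_zero, Matrix.zero_apply]
  refine ⟨fun t => ?_, fun i j => ?_⟩
  · rw [show (bracket x (dForm a b)).1.1 = 0 from hx.bracket_isOdd (isOdd_dForm a b)]
    exact map_zero _
  · rw [bracket_snd, show (dForm a b).1.1 = 0 from rfl, lieDeriv_zero_left, sub_zero, lieDeriv,
      map_sum]
    refine Finset.sum_eq_zero fun m _ => ?_
    rw [D_dForm_snd, mul_zero, zero_add, map_add, map_mul, map_mul, h1, h1, zero_mul, zero_mul,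
      add_zero]

lemma vmk_eq_zero_of_isOdd {x : L} (hx : IsOdd x) (hx0 : x ∈ nonnegPart) (u : U) (v : V) :
    vmk (u * toU x) v = 0 := by
  rw [vmk_mul_of_mem _ hx0, linPart_of_isOdd hx, zero_lie, ← vmkL_apply, map_zero]

/-- After subtracting its linear part the field vanishes to second order. Its bracket with `d_ab` is
then an odd element of `L_{≥0}` and kills `V`. -/
lemma isEven_smul_vmk_dForm {x : L} (hx : IsEven x) (hx0 : x ∈ nonnegPart) (a b : Fin 5) (v : V) :
    toU x • vmk (toU (dForm a b)) v = vmk (toU (dForm a b)) ⁅linPart x, v⁆ +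
      ∑ k, ((linPart x).mat k a • vmk (toU (dForm k b)) v +
        (linPart x).mat k b • vmk (toU (dForm a k)) v) := by
  set y := x - linField (linPart x) with hy
  have hye : IsEven y := by
    change x.1.2 - (linField (linPart x)).1.2 = 0
    rw [show x.1.2 = 0 from hx, show (linField (linPart x)).1.2 = 0 from rfl, sub_zero]
  have hy0 : linPart y = 0 := by rw [hy, map_sub, linPart_linField, sub_self]
  have e : bracket x (dForm a b) = bracket y (dForm a b) +
      bracket (linField (linPart x)) (dForm a b) := by
    rw [← bracket_add_left, hy, sub_add_cancel]
  have h1 := vmk_eq_zero_of_isOdd (hye.bracket_isOdd (isOdd_dForm a b))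
    (bracket_dForm_mem_of_isEven hye hy0 a b) 1 v
  rw [one_mul] at h1
  rw [smul_vmk, toU_mul_of_isEven hx, vmk_add_left, vmk_mul_of_mem _ hx0, e, map_add, vmk_add_left,
    h1, zero_add, bracket_linField_dForm]
  simp only [← vmkL_apply, map_sum, map_add, map_smul, LinearMap.sum_apply, LinearMap.add_apply,
    LinearMap.smul_apply]

lemma bracket_dForm_mem_of_isOdd {x : L} (hx : IsOdd x) (hx0 : x ∈ nonnegPart) (a b : Fin 5) :
    bracket x (dForm a b) ∈ nonnegPart := by
  rw [mem_nonnegPart] at *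
  refine ⟨fun t => ?_, fun i j => ?_⟩
  · rw [bracket_fst, show (dForm a b).1.1 = 0 from rfl, vfBracket_zero_right, zero_add]
    exact c0_formBracket_left _ hx0.2 t
  · rw [show (bracket x (dForm a b)).1.2 = 0 from hx.bracket_isEven (isOdd_dForm a b)]
    exact map_zero _

lemma linPart_bracket_dForm {x : L} (a b p q : Fin 5) :
    (linPart (bracket x (dForm a b))).mat p q =
      (1 / 2) * ∑ k, ∑ l, (levi k l a b q : ℂ) * c0 (D p (x.1.2 k l)) := by
  rw [linPart_mat, bracket_fst, show (dForm a b).1.1 = 0 from rfl, vfBracket_zero_right, zero_add,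
    formBracket_dForm, Derivation.map_smul, c0_smul]
  simp only [map_sum, Derivation.leibniz, Derivation.map_intCast, smul_zero, mul_zero, add_zero,
    smul_eq_mul, map_mul, map_intCast]

lemma isOdd_smul_vmk_dForm {x : L} (hx : IsOdd x) (hx0 : x ∈ nonnegPart) (a b : Fin 5) (v : V) :
    toU x • vmk (toU (dForm a b)) v = vmk 1 ⁅linPart (bracket x (dForm a b)), v⁆ := by
  rw [smul_vmk, toU_mul_of_isOdd hx (isOdd_dForm a b), vmk_add_left, ← neg_mul,
    vmk_eq_zero_of_isOdd hx hx0, zero_add, ← one_mul (toU (bracket _ _)),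
    vmk_mul_of_mem _ (bracket_dForm_mem_of_isOdd hx hx0 a b)]

end

/-! ### When an equivariant family of operators defines a morphism. -/

lemma sum_rotate {W : Type*} [AddCommMonoid W] (f : Fin 5 → Fin 5 → Fin 5 → W) :
    ∑ p, ∑ k, ∑ l, f k l p = ∑ p, ∑ k, ∑ l, f p k l := by
  rw [Finset.sum_comm]
  exact Finset.sum_congr rfl fun k _ => Finset.sum_comm

lemma sum_two_three_comm {W : Type*} [AddCommMonoid W]
    (f : Fin 5 → Fin 5 → Fin 5 → Fin 5 → Fin 5 → W) :
    ∑ a, ∑ b, ∑ p, ∑ k, ∑ l, f a b p k l = ∑ p, ∑ k, ∑ l, ∑ a, ∑ b, f a b p k l := by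
  have h : ∀ g : Fin 5 → Fin 5 → Fin 5 → Fin 5 → W,
      ∑ b, ∑ p, ∑ k, ∑ l, g b p k l = ∑ p, ∑ k, ∑ l, ∑ b, g b p k l := fun g => by
    rw [Finset.sum_comm]
    refine Finset.sum_congr rfl fun p _ => ?_
    rw [Finset.sum_comm]
    exact Finset.sum_congr rfl fun k _ => Finset.sum_comm
  rw [← h fun a p k l => ∑ b, f a b p k l]
  exact Finset.sum_congr rfl fun a _ => h (f a)

lemma sum_transpose_smul {W : Type*} [AddCommGroup W] [Module ℂ W] (m : Fin 5 → Fin 5 → ℂ)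
    (g : Fin 5 → Fin 5 → Fin 5 → Fin 5 → W) :
    ∑ a, ∑ b, ∑ k, (m k a • g k b a b + m k b • g a k a b) =
      ∑ a, ∑ b, ∑ k, (m a k • g a b k b + m b k • g a b a k) := by
  simp only [Finset.sum_add_distrib]
  congr 1
  · calc ∑ a, ∑ b, ∑ k, m k a • g k b a b = ∑ b, ∑ k, ∑ a, m k a • g k b a b :=
          (sum_rotate fun b k a => m k a • g k b a b)
      _ = ∑ k, ∑ b, ∑ a, m k a • g k b a b := Finset.sum_comm
  · exact Finset.sum_congr rfl fun a _ => Finset.sum_comm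

/-- An alternating tensor is invariant under rotation of its indices, so three times the sum is the
pairing of `Ω` with the cyclic sums of `y`. -/
lemma sum_smul_eq_zero_of_cyclic {W : Type*} [AddCommGroup W] [Module ℂ W]
    (y : Fin 5 → Fin 5 → Fin 5 → ℂ) (Ω : Fin 5 → Fin 5 → Fin 5 → W)
    (hy : ∀ p k l, y p k l + y k l p + y l p k = 0) (h1 : ∀ p k l, Ω p k l = - Ω p l k)
    (h2 : ∀ p k l, Ω p k l = - Ω k p l) : ∑ p, ∑ k, ∑ l, y p k l • Ω p k l = 0 := by
  have h3 : ∀ p k l, Ω p k l = Ω k l p := fun p k l => by rw [h2 p k l, h1 k p l, neg_neg]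
  have e1 : ∑ p, ∑ k, ∑ l, y k l p • Ω p k l = ∑ p, ∑ k, ∑ l, y p k l • Ω p k l := by
    rw [← sum_rotate fun p k l => y p k l • Ω p k l]
    exact Finset.sum_congr rfl fun p _ => Finset.sum_congr rfl fun k _ =>
      Finset.sum_congr rfl fun l _ => by rw [h3 p k l]
  have e2 : ∑ p, ∑ k, ∑ l, y l p k • Ω p k l = ∑ p, ∑ k, ∑ l, y p k l • Ω p k l := by
    rw [← sum_rotate fun p k l => y l p k • Ω p k l]
    exact Finset.sum_congr rfl fun p _ => Finset.sum_congr rfl fun k _ =>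
      Finset.sum_congr rfl fun l _ => by rw [h3 p k l]
  have e3 : (3 : ℂ) • ∑ p, ∑ k, ∑ l, y p k l • Ω p k l =
      ∑ p, ∑ k, ∑ l, (y p k l + y k l p + y l p k) • Ω p k l := by
    simp only [add_smul, Finset.sum_add_distrib]
    rw [e2, e1, show (3 : ℂ) = 1 + 1 + 1 by norm_num, add_smul, add_smul, one_smul]
  simp only [hy, zero_smul, Finset.sum_const_zero] at e3
  exact (smul_eq_zero.mp e3).resolve_left (by norm_num)

lemma c0_D_cyclic (x : L) (p k l : Fin 5) :
    c0 (D p (x.1.2 k l)) + c0 (D k (x.1.2 l p)) + c0 (D l (x.1.2 p k)) = 0 := by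
  have h := congrArg c0 (x.2.2.2 p k l)
  simpa [extD] using h

section

variable {lam mu : Fin 4 → ℕ}

/-- The condition for `∑ d_ab ⊗ θ_ab v` to be annihilated by the `x_p d_kl + x_k d_pl`. -/
def obstruction (θ : Fin 5 → Fin 5 → P) (p k l : Fin 5) : P :=
  ∑ a, ∑ b, ∑ t, (levi k l a b t : ℂ) • actDer (mu1 p t) (θ a b)

lemma obstruction_skew (θ : Fin 5 → Fin 5 → P) (p k l : Fin 5) :
    obstruction θ p k l = - obstruction θ p l k := by
  simp only [obstruction, ← Finset.sum_neg_distrib]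
  refine Finset.sum_congr rfl fun a _ => Finset.sum_congr rfl fun b _ =>
    Finset.sum_congr rfl fun t _ => ?_
  rw [levi_skew_left k l, ← neg_smul]
  push_cast
  rfl

/-- Since `x` is closed, its first derivatives at the origin have vanishing cyclic sums. The
hypothesis and the built-in skewness in `k`, `l` make the obstruction alternating. Testing on the
forms `x_i d_jk + x_j d_ik` is therefore enough for all odd elements. -/
lemma sum_lie_bracket_eq_zero {θ : Fin 5 → Fin 5 → F mu}
    (h : ∀ p k l, obstruction (fun a b => (θ a b : P)) p k l =
      - obstruction (fun a b => (θ a b : P)) k p l) (x : L) :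
    ∑ a, ∑ b, ⁅linPart (bracket x (dForm a b)), θ a b⁆ = 0 := by
  refine Subtype.ext ?_
  have e : ∀ a b, ((⁅linPart (bracket x (dForm a b)), θ a b⁆ : F mu) : P) =
      (1 / 2 : ℂ) • ∑ p, ∑ k, ∑ l, c0 (D p (x.1.2 k l)) •
        ∑ t, (levi k l a b t : ℂ) • actDer (mu1 p t) (θ a b : P) := fun a b => by
    rw [coe_lie_F, actDer_eq_sum_single]
    simp only [linPart_bracket_dForm, mul_smul, Finset.smul_sum, Finset.sum_smul,
      Finset.mul_sum]
    refine Finset.sum_congr rfl fun p _ => ?_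
    rw [Finset.sum_comm]
    refine Finset.sum_congr rfl fun k _ => ?_
    rw [Finset.sum_comm]
    refine Finset.sum_congr rfl fun l _ => Finset.sum_congr rfl fun t _ => ?_
    rw [smul_comm (c0 _)]
  have h2 := sum_smul_eq_zero_of_cyclic (fun p k l => c0 (D p (x.1.2 k l)))
    (obstruction fun a b => (θ a b : P)) (c0_D_cyclic x) (obstruction_skew _) h
  have h3 : ((∑ a, ∑ b, ⁅linPart (bracket x (dForm a b)), θ a b⁆ : F mu) : P) =
      (1 / 2 : ℂ) • ∑ p, ∑ k, ∑ l, c0 (D p (x.1.2 k l)) •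
        obstruction (fun a b => (θ a b : P)) p k l := by
    simp only [AddSubmonoidClass.coe_finsetSum, e, ← Finset.smul_sum]
    rw [sum_two_three_comm]
    simp only [obstruction, ← Finset.smul_sum]
  rw [h3, h2, smul_zero]
  rfl

lemma sum_add_sum {W : Type*} [AddCommMonoid W] (f g : Fin 5 → Fin 5 → W) :
    ∑ a, ∑ b, (f a b + g a b) = ∑ a, ∑ b, f a b + ∑ a, ∑ b, g a b := by
  simp only [Finset.sum_add_distrib]

lemma sum_pair {W : Type*} [AddCommGroup W] [Module ℂ W] (f : Fin 5 → Fin 5 → W)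
    (hf : ∀ a b, f a b = f b a) (h0 : ∀ a, f a a = 0) :
    ∑ a, ∑ b, f a b = (2 : ℂ) • ∑ p : Pair, f p.1.1 p.1.2 := by
  have e : ∑ p : Pair, f p.1.1 p.1.2 = ∑ a, ∑ b, if a < b then f a b else 0 := by
    rw [← Finset.sum_product', Finset.univ_product_univ,
      ← Finset.sum_filter (fun p : Fin 5 × Fin 5 => p.1 < p.2) (fun p => f p.1 p.2)]
    exact (Finset.sum_subtype _ (by simp) (fun p : Fin 5 × Fin 5 => f p.1 p.2)).symm
  have e2 : ∑ p : Pair, f p.1.1 p.1.2 = ∑ a, ∑ b, if b < a then f a b else 0 := by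
    rw [e, Finset.sum_comm]
    exact Finset.sum_congr rfl fun a _ => Finset.sum_congr rfl fun b _ => by rw [hf b a]
  rw [two_smul]
  nth_rewrite 1 [e]
  rw [e2, ← Finset.sum_add_distrib]
  refine Finset.sum_congr rfl fun a _ => ?_
  rw [← Finset.sum_add_distrib]
  refine Finset.sum_congr rfl fun b _ => ?_
  rcases lt_trichotomy a b with h | rfl | h
  · rw [if_pos h, if_neg h.not_gt, add_zero]
  · simp [h0]
  · rw [if_neg h.not_gt, if_pos h, zero_add]

lemma mem_of_hwF_mem (N : LieSubmodule ℂ sl5 (F lam)) (h : hwF lam ∈ N) (v : F lam) : v ∈ N := by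
  have h1 : F lam ≤ N.map (F lam).incl := F_le ((LieSubmodule.mem_map _).mpr ⟨hwF lam, h, rfl⟩)
  obtain ⟨w, hw, e⟩ := (LieSubmodule.mem_map _).mp (h1 v.2)
  rwa [← show w = v from Subtype.ext e]

/-- The matrix of `[x_i d_jk + x_j d_ik, d_ab]`. -/
def zMatrix (i j k a b : Fin 5) : Matrix (Fin 5) (Fin 5) ℂ := Matrix.of (zMat i j k a b)

lemma sum_actDer_zMatrix (θ : Fin 5 → Fin 5 → P) (i j k : Fin 5) :
    ∑ a, ∑ b, actDer (zMatrix i j k a b) (θ a b) = obstruction θ i j k + obstruction θ j i k := by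
  simp only [obstruction, ← Finset.sum_add_distrib]
  refine Finset.sum_congr rfl fun a _ => Finset.sum_congr rfl fun b _ => ?_
  rw [actDer_eq_sum_single, Finset.sum_comm]
  refine Finset.sum_congr rfl fun q _ => ?_
  simp only [zMatrix, Matrix.of_apply, zMat, add_smul, ite_smul, zero_smul,
    Finset.sum_add_distrib, Finset.sum_ite_eq', Finset.mem_univ, if_true]

/-- Existence of the morphism associated with an equivariant family `θ`. -/
lemma exists_isAssociated (θ : Fin 5 → Fin 5 → F lam →ₗ[ℂ] F mu) (hs : ∀ a b, θ a b = - θ b a)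
    (he : ∀ (A : sl5) a b v, ⁅A, θ a b v⁆ +
      ∑ k, (A.mat a k • θ k b v + A.mat b k • θ a k v) = θ a b ⁅A, v⁆)
    (ho : ∀ i j k, ∑ a, ∑ b, actDer (zMatrix i j k a b) (θ a b (hwF lam) : P) = 0) :
    ∃ φ : M lam →ₗ[U] M mu, IsAssociated (fun p => θ p.1.1 p.1.2) φ ∧
      ∀ v, φ (vmk 1 v) = (1 / 2 : ℂ) • ∑ a, ∑ b, vmk (toU (dForm a b)) (θ a b v) := by
  have heven : ∀ x, IsEven x → x ∈ nonnegPart → ∀ v,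
      toU x • degOne θ v = degOne θ ⁅linPart x, v⁆ := by
    intro x hx hx0 v
    have h3 := sum_transpose_smul (linPart x).mat
      fun a b i j => vmk (toU (dForm a b)) (θ i j v)
    simp only [degOne_apply, Finset.smul_sum, isEven_smul_vmk_dForm hx hx0, ← he]
    rw [sum_add_sum, h3, ← sum_add_sum]
    refine Finset.sum_congr rfl fun a _ => Finset.sum_congr rfl fun b _ => ?_
    rw [← vmkL_apply, ← vmkL_apply, map_add, map_sum]
    simp only [map_add, map_smul, vmkL_apply]
  -- The odd elements of `L_{≥0}` are stable under `sl_5`, so the vectors whose image they kill form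
  -- a submodule. Only the highest weight vector has to be tested.
  let N : LieSubmodule ℂ sl5 (F lam) :=
    { carrier := {v | ∀ x, IsOdd x → x ∈ nonnegPart → toU x • degOne θ v = 0}
      zero_mem' := fun x _ _ => by rw [map_zero, smul_zero]
      add_mem' := fun {v w} hv hw x hx hx0 => by
        rw [map_add, smul_add, hv x hx hx0, hw x hx hx0, add_zero]
      smul_mem' := fun c v hv x hx hx0 => by
        rw [map_smul, smul_comm, hv x hx hx0, smul_zero]
      lie_mem := fun {A v} hv x hx hx0 => by
        have h1 := heven _ (isEven_linField A) (linField_mem A) v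
        have h2 := toU_mul_of_isEven (isEven_linField A) x
        have h3 : toU (bracket (linField A) x) • degOne θ v = 0 :=
          hv _ ((isEven_linField A).bracket_isOdd hx) (bracket_mem_nonnegPart (linField_mem A) hx0)
        rw [linPart_linField] at h1
        rw [← h1, smul_smul, ← sub_eq_of_eq_add h2, sub_smul, mul_smul, hv x hx hx0, smul_zero, h3,
          sub_zero] }
  have hodd : ∀ x, IsOdd x → x ∈ nonnegPart → ∀ v, toU x • degOne θ v = 0 := by
    intro x hx hx0 v
    refine mem_of_hwF_mem N (fun x hx hx0 => ?_) v x hx hx0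
    simp only [degOne_apply, Finset.smul_sum, isOdd_smul_vmk_dForm hx hx0]
    have h2 := congrArg (vmkL (1 : U)) (sum_lie_bracket_eq_zero
      (θ := fun a b => θ a b (hwF lam)) (fun p k l => by
        rw [← add_eq_zero_iff_eq_neg, ← sum_actDer_zMatrix, ho]) x)
    simpa only [map_sum, map_zero, vmkL_apply] using h2
  obtain ⟨φ, hφ⟩ := exists_verma_lift (degOne θ) fun x hx v => by
    have h2 := heven _ (isEven_evenPart x) (evenPart_mem hx) v
    have h3 := hodd _ (isOdd_oddPart x) (oddPart_mem hx) v
    rw [linPart_evenPart] at h2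
    conv_lhs => rw [← evenPart_add_oddPart x, map_add, add_smul, h2, h3, add_zero]
  have hφ' : ∀ v, ((1 / 2 : ℂ) • φ) (vmk 1 v) =
      (1 / 2 : ℂ) • ∑ a, ∑ b, vmk (toU (dForm a b)) (θ a b v) := fun v => by
    rw [LinearMap.smul_apply, hφ, degOne_apply]
  -- `degOne` sums over all ordered pairs, whereas `IsAssociated` sums over `i < j`.
  refine ⟨(1 / 2 : ℂ) • φ, fun v => ?_, hφ'⟩
  rw [hφ', sum_pair, smul_smul]
  · norm_num
  · intro a b
    rw [hs a b, dForm_skew a b]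
    simp only [← vmkL_apply, map_neg, LinearMap.neg_apply, neg_neg]
  · intro a
    have h2 : (2 : ℂ) • θ a a = 0 := by
      rw [two_smul]
      nth_rewrite 1 [hs a a]
      exact neg_add_cancel _
    have : θ a a = 0 := (smul_eq_zero.mp h2).resolve_left two_ne_zero
    rw [this, LinearMap.zero_apply, ← vmkL_apply, map_zero]

/-- Existence of the morphism associated with an equivariant family of operators on `P`. -/
lemma exists_morphism (θ : Fin 5 → Fin 5 → P →ₗ[ℂ] P) (hs : ∀ a b, θ a b = - θ b a)
    (he : ∀ (A : sl5) a b g, θ a b (actDer A.mat g) = actDer A.mat (θ a b g) +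
      ∑ k, (A.mat a k • θ k b g + A.mat b k • θ a k g))
    (hm : ∀ a b, θ a b (hw lam) ∈ F mu)
    (ho : ∀ i j k, ∑ a, ∑ b, actDer (zMatrix i j k a b) (θ a b (hw lam)) = 0) :
    ∃ (θ' : Fin 5 → Fin 5 → F lam →ₗ[ℂ] F mu) (φ : M lam →ₗ[U] M mu),
      (∀ a b v, (θ' a b v : P) = θ a b v) ∧ IsAssociated (fun p => θ' p.1.1 p.1.2) φ ∧
      ∀ v, φ (vmk 1 v) = (1 / 2 : ℂ) • ∑ a, ∑ b, vmk (toU (dForm a b)) (θ' a b v) := by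
  let N : LieSubmodule ℂ sl5 P :=
    { carrier := {g | ∀ a b, θ a b g ∈ F mu}
      zero_mem' := fun a b => by rw [map_zero]; exact zero_mem _
      add_mem' := fun {g h} hg hh a b => by rw [map_add]; exact add_mem (hg a b) (hh a b)
      smul_mem' := fun c g hg a b => by rw [map_smul]; exact (F mu).smul_mem c (hg a b)
      lie_mem := fun {A g} hg a b => by
        rw [lie_P, he]
        refine add_mem ((F mu).lie_mem (x := A) (hg a b)) (sum_mem fun k _ => ?_)
        exact add_mem ((F mu).smul_mem _ (hg k b)) ((F mu).smul_mem _ (hg a k)) }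
  have hN : ∀ a b, ∀ g ∈ F lam, θ a b g ∈ F mu := fun a b g hg => (F_le (N := N) hm) hg a b
  let θ' : Fin 5 → Fin 5 → F lam →ₗ[ℂ] F mu := fun a b => (θ a b).restrict (hN a b)
  have h1 : ∀ a b v, (θ' a b v : P) = θ a b v := fun a b v => rfl
  obtain ⟨φ, h2, h3⟩ := exists_isAssociated θ' (fun a b => LinearMap.ext fun v => Subtype.ext (by
      rw [h1, hs]; rfl)) (fun A a b v => Subtype.ext (by
      rw [h1, coe_lie_F, he, LieSubmodule.coe_add, coe_lie_F, AddSubmonoidClass.coe_finsetSum]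
      rfl)) ho
  exact ⟨θ', φ, h1, h2, h3⟩

end

/-! ### The morphisms `∇_A` and `∇_B` -/

lemma actDer_mu1 (p t : Fin 5) (g : P) : actDer (mu1 p t) g =
    MvPolynomial.X (Var.x p) * px t g + ∑ s, xx p s * pxx t s g - ∑ s, xxd t s * pxxd p s g -
      MvPolynomial.X (Var.xd t) * pxd p g := by
  have e : ∀ i k, mu1 p t i k = if p = i then (if t = k then 1 else 0) else 0 := fun i k => by
    simp only [mu1, Matrix.single_apply, ite_and]
  rw [actDer_eq_sum]
  simp only [e, ite_smul, one_smul, zero_smul, Finset.sum_ite_eq, Finset.mem_univ, if_true,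
    Finset.sum_ite_irrel, Finset.sum_const_zero]

/-! ### Derivatives of the highest weight vectors. -/

section

open MvPolynomial

variable (lam : Fin 4 → ℕ)

lemma derivation_pow (d : Derivation ℂ P P) (g : P) (r : ℂ) (h : d g = C r) (n : ℕ) :
    d (g ^ n) = (n * r) • g ^ (n - 1) := by
  rw [Derivation.leibniz_pow, h, smul_eq_mul, nsmul_eq_mul, smul_eq_C_mul, C_mul,
    show (C (n : ℂ) : P) = (n : P) from map_natCast C n]
  ring

/-- The truncated subtraction is harmless here and in the next three lemmas: the scalar vanishes
when the exponent is zero. -/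
lemma px_hw (t : Fin 5) : px t (hw lam) =
    (lam 0 * if t = 0 then 1 else 0 : ℂ) • hw ![lam 0 - 1, lam 1, lam 2, lam 3] := by
  have h := derivation_pow (px t) (X (Var.x 0)) (if t = 0 then 1 else 0) (by
    rw [px_x]; split_ifs <;> simp)
  simp only [hw, Derivation.leibniz, Derivation.leibniz_pow, px_xx, px_xxd, px_xd, smul_zero,
    zero_add, h, smul_eq_mul, mul_zero]
  simp only [smul_eq_C_mul]
  simp
  ring

lemma pxx_hw (a b : Fin 5) : pxx a b (hw lam) =
    (lam 1 * elem a b 0 1 : ℂ) • hw ![lam 0, lam 1 - 1, lam 2, lam 3] := by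
  have h := derivation_pow (pxx a b) (xx 0 1) _ (pxx_xx a b 0 1)
  simp only [hw, Derivation.leibniz, h, Derivation.leibniz_pow, pxx_x, pxx_xxd, pxx_xd, smul_zero,
    zero_add, add_zero, smul_eq_mul, mul_zero]
  simp only [smul_eq_C_mul]
  simp
  ring

lemma pxxd_hw (a b : Fin 5) : pxxd a b (hw lam) =
    (lam 2 * elem a b 3 4 : ℂ) • hw ![lam 0, lam 1, lam 2 - 1, lam 3] := by
  have h := derivation_pow (pxxd a b) (xxd 3 4) _ (pxxd_xxd a b 3 4)
  simp only [hw, Derivation.leibniz, h, Derivation.leibniz_pow, pxxd_x, pxxd_xx, pxxd_xd, smul_zero,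
    zero_add, add_zero, smul_eq_mul, mul_zero]
  simp only [smul_eq_C_mul]
  simp
  ring

lemma pxd_hw (t : Fin 5) : pxd t (hw lam) =
    (lam 3 * if t = 4 then 1 else 0 : ℂ) • hw ![lam 0, lam 1, lam 2, lam 3 - 1] := by
  have h := derivation_pow (pxd t) (X (Var.xd 4)) (if t = 4 then 1 else 0) (by
    rw [pxd_xd]; split_ifs <;> simp)
  simp only [hw, Derivation.leibniz, h, Derivation.leibniz_pow, pxd_xx, pxd_xxd, pxd_x, smul_zero,
    zero_add, add_zero, smul_eq_mul, mul_zero]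
  simp only [smul_eq_C_mul]
  simp
  ring

end

lemma sum_levi_smul_elem {W : Type*} [AddCommGroup W] [Module ℂ W] (k l c d : Fin 5) (r : ℂ)
    (f : Fin 5 → W) : ∑ a, ∑ b, ∑ t, (levi k l a b t : ℂ) • (r * elem a b c d) • f t =
      (2 * r) • ∑ t, (levi k l c d t : ℂ) • f t := by
  have h := sum_smul_elem (fun a b => ∑ t, (levi k l a b t : ℂ) • f t) (fun a b => by
    simp only [← Finset.sum_neg_distrib, ← neg_smul]
    refine Finset.sum_congr rfl fun t _ => ?_
    rw [levi_skew_right k l a b]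
    push_cast
    rfl) c d
  have e : ∀ a b c d, elem a b c d = elem c d a b := by
    intro a b c d
    simp only [elem, eq_comm]
    grind
  rw [mul_smul, smul_comm, ← h]
  simp only [Finset.smul_sum]
  refine Finset.sum_congr rfl fun a _ => Finset.sum_congr rfl fun b _ =>
    Finset.sum_congr rfl fun t _ => ?_
  rw [e a b]
  simp only [smul_smul]
  congr 1
  ring

/-- The obstruction vanishes identically. Only the pair `(0, 1)` contributes to the derivative of
the highest weight vector, so the symbol forces `t ∉ {0, 1}`, and such an `E_pt` kills a polynomial
in `x_0` and `x_01`. -/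
lemma exists_nablaA (m n : ℕ) {n' : ℕ} (hn : n' = n + 1) :
    ∃ (θ : Fin 5 → Fin 5 → F ![m, n', 0, 0] →ₗ[ℂ] F ![m, n, 0, 0])
    (α : M ![m, n', 0, 0] →ₗ[U] M ![m, n, 0, 0]), IsNablaA α ∧
      (∀ a b v, (θ a b v : P) = pxx a b (v : P)) ∧
      ∀ v, α (vmk 1 v) = (1 / 2 : ℂ) • ∑ a, ∑ b, vmk (toU (dForm a b)) (θ a b v) := by
  subst hn
  have h1 : ∀ a b, pxx a b (hw ![m, n + 1, 0, 0]) =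
      (((n : ℂ) + 1) * elem a b 0 1) • hw ![m, n, 0, 0] := fun a b => by
    simpa using pxx_hw ![m, n + 1, 0, 0] a b
  have h2 : ∀ p t : Fin 5, t ≠ 0 → t ≠ 1 → actDer (mu1 p t) (hw ![m, n, 0, 0]) = 0 := by
    intro p t h0 h1
    rw [actDer_mu1]
    simp [px_hw, pxx_hw, pxxd_hw, pxd_hw, h0, h1, Ne.symm h0, Ne.symm h1, elem]
  have h3 : ∀ p k l, obstruction (fun a b => pxx a b (hw ![m, n + 1, 0, 0])) p k l = 0 := by
    intro p k l
    simp only [obstruction, h1, Derivation.map_smul]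
    rw [sum_levi_smul_elem, Finset.sum_eq_zero, smul_zero]
    intro t _
    by_cases h0 : t = 0
    · rw [levi_eq_zero _ _ _ _ _ (by simp [h0]), Int.cast_zero, zero_smul]
    by_cases h4 : t = 1
    · rw [levi_eq_zero _ _ _ _ _ (by simp [h4]), Int.cast_zero, zero_smul]
    rw [h2 p t h0 h4, smul_zero]
  obtain ⟨θ, α, h4, h5, h6⟩ := exists_morphism (lam := ![m, n + 1, 0, 0]) (mu := ![m, n, 0, 0])
    (fun a b => (pxx a b : P →ₗ[ℂ] P)) (fun a b => by
      rw [pxx_skew]; rfl) (fun A a b g => pxx_actDer A.mat a b g)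
    (fun a b => by
      change pxx a b _ ∈ _
      rw [h1]
      exact (F _).smul_mem _ (hw_mem _))
    (fun i j k => by
      change ∑ a, ∑ b, actDer (zMatrix i j k a b) (pxx a b _) = 0
      rw [sum_actDer_zMatrix, h3, h3, add_zero])
  refine ⟨θ, α, ⟨m, n, rfl, rfl, _, fun p v => ?_, h5⟩, h4, h6⟩
  rw [h4, ← pxx_of_lt p.2]
  rfl

set_option maxRecDepth 100000 in
lemma levi_skew_one_four : ∀ i j k l t : Fin 5, levi i j k l t = - levi l j k i t := by decide

/-- The operators `x_a^* ∂/∂x_b - x_b^* ∂/∂x_a`. -/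
def thetaB (a b : Fin 5) : P →ₗ[ℂ] P :=
  ((MvPolynomial.X (Var.xd a) : P) • px b - (MvPolynomial.X (Var.xd b) : P) • px a :
    Derivation ℂ P P)

lemma thetaB_apply (a b : Fin 5) (g : P) : thetaB a b g =
    MvPolynomial.X (Var.xd a) * px b g - MvPolynomial.X (Var.xd b) * px a g := rfl

lemma thetaB_skew (a b : Fin 5) : thetaB a b = - thetaB b a := by
  refine LinearMap.ext fun g => ?_
  rw [LinearMap.neg_apply, thetaB_apply, thetaB_apply, neg_sub]

lemma thetaB_actDer (A : Matrix (Fin 5) (Fin 5) ℂ) (a b : Fin 5) (g : P) :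
    thetaB a b (actDer A g) = actDer A (thetaB a b g) +
      ∑ k, (A a k • thetaB k b g + A b k • thetaB a k g) := by
  simp only [thetaB_apply, px_actDer, map_sub, Derivation.leibniz, actDer_xd, smul_eq_mul, mul_add,
    Finset.mul_sum, smul_sub, Finset.sum_add_distrib, Finset.sum_sub_distrib, mul_neg,
    neg_mul, Finset.sum_mul, mul_smul_comm, smul_mul_assoc, mul_comm (px _ g)]
  abel

lemma thetaB_hw (m n : ℕ) (a b : Fin 5) : thetaB a b (hw ![m + 1, 0, 0, n]) =
    ((m : ℂ) + 1) • (((if b = 0 then 1 else 0 : ℂ) • MvPolynomial.X (Var.xd a) -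
      (if a = 0 then 1 else 0 : ℂ) • MvPolynomial.X (Var.xd b)) * hw ![m, 0, 0, n]) := by
  rw [thetaB_apply, px_hw, px_hw]
  simp only [MvPolynomial.smul_eq_C_mul, map_mul]
  split_ifs <;> simp <;> ring

/-- The operator `E_4b` replaces one factor `x_4^*` by a multiple of `x_b^*`; the condition `b ≠ 0`
prevents it from touching the power of `x_0`. -/
lemma xd_mul_hw_mem (m n : ℕ) {b : Fin 5} (hb : b ≠ 0) :
    MvPolynomial.X (Var.xd b) * hw ![m, 0, 0, n] ∈ F ![m, 0, 0, n + 1] := by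
  by_cases h4 : b = 4
  · have : MvPolynomial.X (Var.xd b) * hw ![m, 0, 0, n] = hw ![m, 0, 0, n + 1] := by
      subst h4
      simp [hw]
      ring
    rw [this]
    exact hw_mem _
  · have h1 : actDer (mu1 4 b) (hw ![m, 0, 0, n + 1]) =
        (-((n : ℂ) + 1)) • (MvPolynomial.X (Var.xd b) * hw ![m, 0, 0, n]) := by
      rw [actDer_mu1]
      simp [px_hw, pxx_hw, pxxd_hw, pxd_hw, hb]
      module
    have h2 := (F ![m, 0, 0, n + 1]).lie_mem (x := rootE 4 b (Ne.symm h4)) (hw_mem _)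
    have h3 : ⁅rootE 4 b (Ne.symm h4), hw ![m, 0, 0, n + 1]⁆ =
      (-((n : ℂ) + 1)) • (MvPolynomial.X (Var.xd b) * hw ![m, 0, 0, n]) := h1
    rw [h3] at h2
    exact (Submodule.smul_mem_iff _ (neg_ne_zero.mpr (Nat.cast_add_one_ne_zero n))).mp h2

/-- The terms in which `E_pt` hits the power of `x_4^*` are symmetric in `b`, `t` and cancel against
the symbol. What remains is skew in `p`, `k`, so it disappears in the symmetrised condition. -/
lemma obstruction_thetaB (m n : ℕ) (p k l : Fin 5) :
    obstruction (fun a b => thetaB a b (hw ![m + 1, 0, 0, n])) p k l =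
      (2 * ((m : ℂ) + 1)) • ∑ t, (levi k l 0 p t : ℂ) •
        (MvPolynomial.X (Var.xd t) * hw ![m, 0, 0, n]) := by
  set w := hw ![m, 0, 0, n] with hw0
  let E : Fin 5 → Fin 5 → P := fun b t => actDer (mu1 p t) (MvPolynomial.X (Var.xd b) * w)
  have h1 : ∀ a b t, (levi k l a b t : ℂ) • actDer (mu1 p t) (thetaB a b (hw ![m + 1, 0, 0, n])) =
      ((m : ℂ) + 1) • ((if b = 0 then (levi k l a b t : ℂ) • E a t else 0) -
        (if a = 0 then (levi k l a b t : ℂ) • E b t else 0)) := fun a b t => by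
    rw [thetaB_hw, Derivation.map_smul, smul_comm, sub_mul, map_sub, smul_mul_assoc, smul_mul_assoc,
      Derivation.map_smul, Derivation.map_smul]
    simp only [ite_smul, one_smul, zero_smul, smul_sub, smul_ite, smul_zero]
    rfl
  have h2 : ∀ b t, (levi k l 0 b t : ℂ) • E b t =
      - (if p = b then (levi k l 0 b t : ℂ) • (MvPolynomial.X (Var.xd t) * w) else 0) -
        (levi k l 0 b t : ℂ) • (MvPolynomial.X (Var.xd b) * MvPolynomial.X (Var.xd t) * pxd p w) := by
    intro b t
    by_cases ht : t = 0
    · have h0 : levi k l 0 b t = 0 := levi_eq_zero _ _ _ _ _ (by simp [ht])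
      simp [h0]
    have e1 : actDer (mu1 p t) w = - (MvPolynomial.X (Var.xd t) * pxd p w) := by
      rw [actDer_mu1, hw0]
      simp [px_hw, pxx_hw, pxxd_hw, ht]
    have e2 : actDer (mu1 p t) (MvPolynomial.X (Var.xd b)) =
        - (if p = b then MvPolynomial.X (Var.xd t) else 0) := by
      rw [actDer_mu1, px_xd, pxd_xd]
      simp only [pxx_xd, pxxd_xd]
      split_ifs <;> simp
    change (levi k l 0 b t : ℂ) • actDer (mu1 p t) (_ * w) = _
    rw [Derivation.leibniz, e1, e2]
    split_ifs
    · simp only [smul_eq_mul, MvPolynomial.smul_eq_C_mul]; ring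
    · simp only [smul_eq_mul, MvPolynomial.smul_eq_C_mul]; ring
  have h3 : ∑ b, ∑ t, (levi k l 0 b t : ℂ) •
      (MvPolynomial.X (Var.xd b) * MvPolynomial.X (Var.xd t) * pxd p w) = 0 := by
    have h4 : ∑ b, ∑ t, (levi k l 0 b t : ℂ) •
        (MvPolynomial.X (Var.xd b) * MvPolynomial.X (Var.xd t) * pxd p w) = - ∑ b, ∑ t,
        (levi k l 0 b t : ℂ) • (MvPolynomial.X (Var.xd b) * MvPolynomial.X (Var.xd t) * pxd p w) := by
      conv_lhs => rw [Finset.sum_comm]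
      simp only [← Finset.sum_neg_distrib]
      refine Finset.sum_congr rfl fun b _ => Finset.sum_congr rfl fun t _ => ?_
      rw [levi_skew_last, mul_comm (MvPolynomial.X (Var.xd t)), Int.cast_neg, neg_smul]
    exact self_eq_neg.mp h4
  have h5 : ∑ b, ∑ t, (levi k l 0 b t : ℂ) • E b t =
      - ∑ t, (levi k l 0 p t : ℂ) • (MvPolynomial.X (Var.xd t) * w) := by
    simp only [h2, Finset.sum_sub_distrib, h3, sub_zero, Finset.sum_neg_distrib]
    rw [Finset.sum_comm]
    simp only [Finset.sum_ite_eq, Finset.mem_univ, if_true]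
  have h6 : ∑ b, ∑ t, (levi k l b 0 t : ℂ) • E b t =
      ∑ t, (levi k l 0 p t : ℂ) • (MvPolynomial.X (Var.xd t) * w) := by
    rw [← neg_eq_iff_eq_neg.mpr h5, ← Finset.sum_neg_distrib]
    refine Finset.sum_congr rfl fun b _ => ?_
    rw [← Finset.sum_neg_distrib]
    refine Finset.sum_congr rfl fun t _ => ?_
    rw [levi_skew_right', Int.cast_neg, neg_smul]
  have h7 : ∑ a, ∑ b, ∑ t, (if b = 0 then (levi k l a b t : ℂ) • E a t else 0) =
      ∑ t, (levi k l 0 p t : ℂ) • (MvPolynomial.X (Var.xd t) * w) := by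
    rw [← h6]
    refine Finset.sum_congr rfl fun a _ => ?_
    rw [Finset.sum_comm]
    simp only [Finset.sum_ite_eq', Finset.mem_univ, if_true]
  have h8 : ∑ a, ∑ b, ∑ t, (if a = 0 then (levi k l a b t : ℂ) • E b t else 0) =
      - ∑ t, (levi k l 0 p t : ℂ) • (MvPolynomial.X (Var.xd t) * w) := by
    rw [← h5]
    simp only [Finset.sum_ite_irrel, Finset.sum_const_zero, Finset.sum_ite_eq', Finset.mem_univ,
      if_true]
  simp only [obstruction, h1, ← Finset.smul_sum, Finset.sum_sub_distrib, h7, h8]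
  rw [sub_neg_eq_add, ← two_smul ℂ, smul_smul, mul_comm]

lemma exists_nablaB (m n : ℕ) {m' n' : ℕ} (hm : m' = m + 1) (hn : n' = n + 1) :
    ∃ (θ : Fin 5 → Fin 5 → F ![m', 0, 0, n] →ₗ[ℂ] F ![m, 0, 0, n'])
    (β : M ![m', 0, 0, n] →ₗ[U] M ![m, 0, 0, n']), IsNablaB β ∧
      (∀ a b v, (θ a b v : P) = thetaB a b (v : P)) ∧
      ∀ v, β (vmk 1 v) = (1 / 2 : ℂ) • ∑ a, ∑ b, vmk (toU (dForm a b)) (θ a b v) := by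
  subst hm hn
  obtain ⟨θ, β, h4, h5, h6⟩ := exists_morphism (lam := ![m + 1, 0, 0, n])
    (mu := ![m, 0, 0, n + 1]) thetaB thetaB_skew
    (fun A a b g => thetaB_actDer A.mat a b g)
    (fun a b => by
      rw [thetaB_hw]
      refine (F ![m, 0, 0, n + 1]).smul_mem _ ?_
      by_cases ha : a = 0
      · by_cases hb : b = 0
        · rw [ha, hb, sub_self, zero_mul]; exact zero_mem _
        · rw [if_neg hb, if_pos ha, zero_smul, zero_sub, one_smul, neg_mul]
          exact neg_mem (xd_mul_hw_mem m n hb)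
      · rw [if_neg ha, zero_smul, sub_zero, smul_mul_assoc]
        exact (F ![m, 0, 0, n + 1]).smul_mem _ (xd_mul_hw_mem m n ha))
    (fun i j k => by
      rw [sum_actDer_zMatrix, obstruction_thetaB, obstruction_thetaB, ← smul_add,
        ← Finset.sum_add_distrib, Finset.sum_eq_zero, smul_zero]
      intro t _
      rw [levi_skew_one_four, ← add_smul]
      push_cast
      rw [neg_add_cancel, zero_smul])
  exact ⟨θ, β, ⟨m, n, rfl, rfl, _, fun p v => h4 _ _ _, h5⟩, h4, h6⟩

/-! ### The projection onto `F(λ)` and the morphism `∇_C` -/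

section

open MvPolynomial

instance : Finite Var := by
  let f : Var → (Fin 5 ⊕ Pair) ⊕ (Pair ⊕ Fin 5) := fun v => match v with
    | Var.x i => Sum.inl (Sum.inl i)
    | Var.xx p => Sum.inl (Sum.inr p)
    | Var.xxd p => Sum.inr (Sum.inl p)
    | Var.xd i => Sum.inr (Sum.inr i)
  refine Finite.of_injective f fun v w h => ?_
  cases v <;> cases w <;> simp_all [f]

lemma isHomogeneous_mul_pderiv {l g : P} {d : ℕ} (v : Var) (hl : l.IsHomogeneous 1)
    (hg : g.IsHomogeneous d) : (l * pderiv v g).IsHomogeneous d := by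
  rcases d.eq_zero_or_pos with rfl | hd
  · rw [← totalDegree_zero_iff_isHomogeneous, totalDegree_eq_zero_iff_eq_C] at hg
    rw [hg, pderiv_C, mul_zero]
    exact isHomogeneous_zero _ _ _
  · have h := hl.mul (hg.pderiv (i := v))
    rwa [Nat.add_sub_cancel' hd] at h

lemma isHomogeneous_xx (i j : Fin 5) : (xx i j).IsHomogeneous 1 := by
  unfold xx
  split_ifs
  · exact isHomogeneous_X _ _
  · exact (isHomogeneous_X _ _).neg
  · exact isHomogeneous_zero _ _ _

lemma isHomogeneous_xxd (i j : Fin 5) : (xxd i j).IsHomogeneous 1 := by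
  unfold xxd
  split_ifs
  · exact isHomogeneous_X _ _
  · exact (isHomogeneous_X _ _).neg
  · exact isHomogeneous_zero _ _ _

lemma isHomogeneous_actDer (A : Matrix (Fin 5) (Fin 5) ℂ) {g : P} {d : ℕ}
    (hg : g.IsHomogeneous d) : (actDer A g).IsHomogeneous d := by
  have h1 : ∀ i k s, (xx i s * pxx k s g).IsHomogeneous d := fun i k s => by
    unfold pxx
    split_ifs
    · exact isHomogeneous_mul_pderiv _ (isHomogeneous_xx i s) hg
    · rw [Derivation.neg_apply, mul_neg]
      exact (isHomogeneous_mul_pderiv _ (isHomogeneous_xx i s) hg).neg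
    · rw [Derivation.zero_apply, mul_zero]
      exact isHomogeneous_zero _ _ _
  have h2 : ∀ i k s, (xxd k s * pxxd i s g).IsHomogeneous d := fun i k s => by
    unfold pxxd
    split_ifs
    · exact isHomogeneous_mul_pderiv _ (isHomogeneous_xxd k s) hg
    · rw [Derivation.neg_apply, mul_neg]
      exact (isHomogeneous_mul_pderiv _ (isHomogeneous_xxd k s) hg).neg
    · rw [Derivation.zero_apply, mul_zero]
      exact isHomogeneous_zero _ _ _
  rw [actDer_eq_sum]
  refine IsHomogeneous.sum _ _ _ fun i _ => IsHomogeneous.sum _ _ _ fun k _ => ?_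
  refine (homogeneousSubmodule Var ℂ d).smul_mem _ ?_
  exact (((isHomogeneous_mul_pderiv _ (isHomogeneous_X _ _) hg).add
    (IsHomogeneous.sum _ _ _ fun s _ => h1 i k s)).sub
    (IsHomogeneous.sum _ _ _ fun s _ => h2 i k s)).sub
    (isHomogeneous_mul_pderiv _ (isHomogeneous_X _ _) hg)

lemma isHomogeneous_hw (lam : Fin 4 → ℕ) :
    (hw lam).IsHomogeneous (lam 0 + lam 1 + lam 2 + lam 3) := by
  have h := ((((isHomogeneous_X ℂ (Var.x 0)).pow (lam 0)).mul
    ((isHomogeneous_xx 0 1).pow (lam 1))).mul ((isHomogeneous_xxd 3 4).pow (lam 2))).mul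
    ((isHomogeneous_X ℂ (Var.xd 4)).pow (lam 3))
  unfold hw
  simpa only [one_mul] using h

/-- `gl_5` preserves the total degree, so `F(λ)` consists of homogeneous polynomials of one degree
in finitely many variables. -/
instance finiteDimensional_F (lam : Fin 4 → ℕ) : FiniteDimensional ℂ (F lam) := by
  let d := lam 0 + lam 1 + lam 2 + lam 3
  let N : LieSubmodule ℂ sl5 P :=
    { homogeneousSubmodule Var ℂ d with
      lie_mem := fun {A g} hg => isHomogeneous_actDer A.mat hg }
  have h1 : (F lam).toSubmodule ≤ homogeneousSubmodule Var ℂ d :=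
    F_le (N := N) (isHomogeneous_hw lam)
  have h2 : FiniteDimensional ℂ (homogeneousSubmodule Var ℂ d) :=
    Module.Finite.iff_fg.mpr (homogeneousSubmodule_fg Var ℂ d)
  exact Submodule.finiteDimensional_of_le h1

end

/-- The Fischer form as a map from `P` to the dual of `F(λ)`. -/
def fischerDual (lam : Fin 4 → ℕ) : P →ₗ[ℂ] Module.Dual ℂ (F lam) :=
  fischer.compl₂ (F lam).toSubmodule.subtype

lemma fischerDual_apply (lam : Fin 4 → ℕ) (y : P) (g : F lam) :
    fischerDual lam y g = fischer y g := rfl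

/-- `F(λ)` contains the conjugates of its elements, so positivity gives nondegeneracy of the
bilinear form on it. -/
lemma eq_zero_of_fischerDual {lam : Fin 4 → ℕ} {f : F lam} (h : fischerDual lam f = 0) : f = 0 := by
  refine Subtype.ext (eq_zero_of_fischer_conjP ?_)
  rw [fischer_comm]
  exact LinearMap.congr_fun h ⟨_, conjP_mem f.2⟩

/-- The isomorphism of `F(λ)` with its dual. -/
def dualEquiv (lam : Fin 4 → ℕ) : F lam ≃ₗ[ℂ] Module.Dual ℂ (F lam) :=
  LinearMap.linearEquivOfInjective (fischerDual lam ∘ₗ (F lam).toSubmodule.subtype)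
    (LinearMap.ker_eq_bot.mp (LinearMap.ker_eq_bot'.mpr fun _ h => eq_zero_of_fischerDual h))
    (Subspace.dual_finrank_eq).symm

/-- The orthogonal projection of `P` onto `F(λ)` with respect to the Fischer form. -/
def projL (lam : Fin 4 → ℕ) : P →ₗ[ℂ] F lam :=
  (dualEquiv lam).symm.toLinearMap ∘ₗ fischerDual lam

lemma fischer_projL (lam : Fin 4 → ℕ) (y : P) (g : F lam) :
    fischer (projL lam y : P) g = fischer y g :=
  LinearMap.congr_fun ((dualEquiv lam).apply_symm_apply (fischerDual lam y)) g

lemma projL_eq {lam : Fin 4 → ℕ} {y : P} {f : F lam} (h : ∀ g : F lam, fischer y g = fischer f g) :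
    projL lam y = f := by
  rw [← sub_eq_zero]
  refine eq_zero_of_fischerDual (LinearMap.ext fun g => ?_)
  rw [fischerDual_apply, LieSubmodule.coe_sub, map_sub, LinearMap.sub_apply, fischer_projL, h,
    sub_self, LinearMap.zero_apply]

/-- The equivariant projection of `P` onto `F(λ)`. -/
def proj (lam : Fin 4 → ℕ) : P →ₗ⁅ℂ, sl5⁆ F lam :=
  { projL lam with
    -- Equivariance follows from contravariance, since `F(λ)` is also stable under the transpose of
    -- `A`.
    map_lie' := fun {A y} => projL_eq fun g => by
      have h := fischer_projL lam y ⁅A.transpose, g⁆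
      rw [coe_lie_F] at h ⊢
      rw [lie_P, fischer_actDer, fischer_actDer]
      exact h.symm }

lemma proj_coe {lam : Fin 4 → ℕ} (v : F lam) : proj lam (v : P) = v := projL_eq fun _ => rfl

lemma proj_eq_zero {lam : Fin 4 → ℕ} {y : P} (h : ∀ g : F lam, fischer y g = 0) :
    proj lam y = 0 := projL_eq fun g => by
  rw [h, LieSubmodule.coe_zero, map_zero, LinearMap.zero_apply]

/-- The Plücker relations, as differential equations. -/
structure IsPlucker (g : P) : Prop where
  quadratic : ∀ a b t s,
    pxxd a b (pxxd t s g) + pxxd b t (pxxd a s g) + pxxd t a (pxxd b s g) = 0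
  mixed : ∀ a b t, pxxd a b (pxd t g) + pxxd b t (pxd a g) + pxxd t a (pxd b g) = 0

/-- Moving the two derivatives past `A` replaces one index at a time, which stays inside the family
of relations. -/
lemma IsPlucker.actDer {g : P} (h : IsPlucker g) (A : Matrix (Fin 5) (Fin 5) ℂ) :
    IsPlucker (actDer A g) := by
  constructor
  · intro a b t s
    have e : pxxd a b (pxxd t s (E510.actDer A g)) + pxxd b t (pxxd a s (E510.actDer A g)) +
        pxxd t a (pxxd b s (E510.actDer A g)) =
        E510.actDer A (pxxd a b (pxxd t s g) + pxxd b t (pxxd a s g) + pxxd t a (pxxd b s g)) -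
        ∑ k, (A k a • (pxxd k b (pxxd t s g) + pxxd b t (pxxd k s g) + pxxd t k (pxxd b s g)) +
          A k b • (pxxd a k (pxxd t s g) + pxxd k t (pxxd a s g) + pxxd t a (pxxd k s g)) +
          A k t • (pxxd a b (pxxd k s g) + pxxd b k (pxxd a s g) + pxxd k a (pxxd b s g)) +
          A k s • (pxxd a b (pxxd t k g) + pxxd b t (pxxd a k g) + pxxd t a (pxxd b k g))) := by
      simp only [pxxd_actDer, map_sub, map_sum, map_add, Derivation.map_smul, smul_add,
        Finset.sum_add_distrib]
      abel
    rw [e]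
    simp only [h.quadratic, map_zero, smul_zero, add_zero, Finset.sum_const_zero, sub_zero]
  · intro a b t
    have e : pxxd a b (pxd t (E510.actDer A g)) + pxxd b t (pxd a (E510.actDer A g)) +
        pxxd t a (pxd b (E510.actDer A g)) =
        E510.actDer A (pxxd a b (pxd t g) + pxxd b t (pxd a g) + pxxd t a (pxd b g)) -
        ∑ k, (A k a • (pxxd k b (pxd t g) + pxxd b t (pxd k g) + pxxd t k (pxd b g)) +
          A k b • (pxxd a k (pxd t g) + pxxd k t (pxd a g) + pxxd t a (pxd k g)) +
          A k t • (pxxd a b (pxd k g) + pxxd b k (pxd a g) + pxxd k a (pxd b g))) := by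
      simp only [pxxd_actDer, pxd_actDer, map_sub, map_sum, map_add, Derivation.map_smul, smul_add,
        Finset.sum_add_distrib]
      abel
    rw [e]
    simp only [h.mixed, map_zero, smul_zero, add_zero, Finset.sum_const_zero, sub_zero]

lemma elem_eq_mul (a b c d : Fin 5) : elem a b c d =
    (if c = a then 1 else 0) * (if d = b then 1 else 0) -
      (if c = b then 1 else 0) * (if d = a then 1 else 0) := by
  simp only [elem, ite_and, ite_mul, one_mul, zero_mul]

/-- The highest weight vector involves only the variables `x_34^*` and `x_4^*` of the dual types, so
the relations reduce to identities between products of Kronecker symbols: those of a decomposable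
bivector and of a vector on its plane. -/
lemma isPlucker_hw (lam : Fin 4 → ℕ) : IsPlucker (hw lam) := by
  constructor
  · intro a b t s
    simp only [pxxd_hw, Derivation.map_smul, smul_smul, ← add_smul]
    convert zero_smul ℂ _
    simp only [elem_eq_mul]
    ring
  · intro a b t
    simp only [pxxd_hw, pxd_hw, Derivation.map_smul, smul_smul, ← add_smul]
    convert zero_smul ℂ _
    simp only [elem_eq_mul, eq_comm]
    ring

lemma isPlucker_of_mem {lam : Fin 4 → ℕ} {g : P} (hg : g ∈ F lam) : IsPlucker g := by
  let N : LieSubmodule ℂ sl5 P :=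
    { carrier := {g | IsPlucker g}
      zero_mem' := ⟨by simp, by simp⟩
      add_mem' := fun {g h} hg hh => by
        constructor
        · intro a b t s
          simp only [map_add]
          linear_combination hg.quadratic a b t s + hh.quadratic a b t s
        · intro a b t
          simp only [map_add]
          linear_combination hg.mixed a b t + hh.mixed a b t
      smul_mem' := fun c g hg => by
        constructor
        · intro a b t s
          simp only [Derivation.map_smul, ← smul_add, hg.quadratic, smul_zero]
        · intro a b t
          simp only [Derivation.map_smul, ← smul_add, hg.mixed, smul_zero]
      lie_mem := fun {A g} hg => hg.actDer A.mat }
  exact F_le (N := N) (isPlucker_hw lam) hg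

/-- The symbol is invariant under rotation of its last three indices. -/
lemma sum_levi_smul_of_cyclic {W : Type*} [AddCommGroup W] [Module ℂ W] (k l : Fin 5)
    (G : Fin 5 → Fin 5 → Fin 5 → W) (hG : ∀ a b t, G a b t + G b t a + G t a b = 0) :
    ∑ a, ∑ b, ∑ t, (levi k l a b t : ℂ) • G a b t = 0 := by
  have e1 : ∑ a, ∑ b, ∑ t, (levi k l a b t : ℂ) • G b t a =
      ∑ a, ∑ b, ∑ t, (levi k l a b t : ℂ) • G a b t := by
    rw [← sum_rotate fun a b t => (levi k l a b t : ℂ) • G a b t]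
    refine Finset.sum_congr rfl fun a _ => Finset.sum_congr rfl fun b _ =>
      Finset.sum_congr rfl fun t _ => ?_
    rw [(levi_perms k l a b t).2.1]
  have e2 : ∑ a, ∑ b, ∑ t, (levi k l a b t : ℂ) • G t a b =
      ∑ a, ∑ b, ∑ t, (levi k l a b t : ℂ) • G a b t := by
    rw [← sum_rotate fun a b t => (levi k l a b t : ℂ) • G t a b]
    refine Finset.sum_congr rfl fun a _ => Finset.sum_congr rfl fun b _ =>
      Finset.sum_congr rfl fun t _ => ?_
    rw [(levi_perms k l a b t).2.1]
  have e3 : (3 : ℂ) • ∑ a, ∑ b, ∑ t, (levi k l a b t : ℂ) • G a b t =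
      ∑ a, ∑ b, ∑ t, (levi k l a b t : ℂ) • (G a b t + G b t a + G t a b) := by
    simp only [smul_add, Finset.sum_add_distrib]
    rw [e2, e1, show (3 : ℂ) = 1 + 1 + 1 by norm_num, add_smul, add_smul, one_smul]
  simp only [hG, smul_zero, Finset.sum_const_zero] at e3
  exact (smul_eq_zero.mp e3).resolve_left (by norm_num)

/-- Up to coefficients independent of `t`, the polynomial `E_pt v` is a combination of the `x_ts^*`
and `x_t^*`. Antisymmetrising its product with `x_ab^*` over `a`, `b`, `t` gives Plücker relations,
and by adjointness these are orthogonal to `F(μ)`. -/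
lemma proj_sum_levi_eq_zero {mu : Fin 4 → ℕ} (m n : ℕ) (p k l : Fin 5) :
    proj mu (∑ a, ∑ b, ∑ t, (levi k l a b t : ℂ) •
      (xxd a b * actDer (mu1 p t) (hw ![0, 0, m, n]))) = 0 := by
  refine proj_eq_zero fun g => ?_
  set v := hw ![0, 0, m, n] with hv
  have hg := isPlucker_of_mem g.2
  have h1 : ∀ t, actDer (mu1 p t) v =
      - ∑ s, xxd t s * pxxd p s v - MvPolynomial.X (Var.xd t) * pxd p v := fun t => by
    rw [actDer_mu1, hv]
    simp [px_hw, pxx_hw]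
  have h2 : ∀ a b t, fischer (xxd a b * actDer (mu1 p t) v) (g : P) =
      - ∑ s, fischer (pxxd p s v) (pxxd a b (pxxd t s (g : P))) -
        fischer (pxd p v) (pxxd a b (pxd t (g : P))) := fun a b t => by
    rw [h1, mul_sub, mul_neg, Finset.mul_sum, map_sub, map_neg, map_sum, LinearMap.sub_apply,
      LinearMap.neg_apply, LinearMap.sum_apply]
    simp only [mul_left_comm (xxd a b), fischer_X_mul, fischer_xxd_mul]
  have h3 : ∀ s, ∑ a, ∑ b, ∑ t, (levi k l a b t : ℂ) •
      fischer (pxxd p s v) (pxxd a b (pxxd t s (g : P))) = 0 := fun s =>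
    sum_levi_smul_of_cyclic k l (fun a b t => fischer (pxxd p s v) (pxxd a b (pxxd t s (g : P))))
      fun a b t => by rw [← map_add, ← map_add, hg.quadratic, map_zero]
  have h4 : ∑ a, ∑ b, ∑ t, (levi k l a b t : ℂ) •
      fischer (pxd p v) (pxxd a b (pxd t (g : P))) = 0 :=
    sum_levi_smul_of_cyclic k l (fun a b t => fischer (pxd p v) (pxxd a b (pxd t (g : P))))
      fun a b t => by rw [← map_add, ← map_add, hg.mixed, map_zero]
  have h5 : ∑ a, ∑ b, ∑ t, (levi k l a b t : ℂ) •
      ∑ s, fischer (pxxd p s v) (pxxd a b (pxxd t s (g : P))) = 0 := by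
    simp only [Finset.smul_sum]
    rw [← Finset.sum_const_zero (s := (Finset.univ : Finset (Fin 5)))]
    rw [← Finset.sum_congr rfl fun s _ => h3 s]
    symm
    rw [Finset.sum_comm]
    refine Finset.sum_congr rfl fun a _ => ?_
    rw [Finset.sum_comm]
    refine Finset.sum_congr rfl fun b _ => ?_
    rw [Finset.sum_comm]
  simp only [map_sum, map_smul, LinearMap.sum_apply, LinearMap.smul_apply, h2, smul_sub, smul_neg,
    Finset.sum_sub_distrib, Finset.sum_neg_distrib, h4, h5, neg_zero, sub_zero]

/-- By the Leibniz rule, `E_pt` hits either one of the two indices of `x_ab^*`, both contributing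
equally, or `v`. The first part is skew in `p`, `k`; the second is removed by the projection. -/
lemma obstruction_xxd (v : P) (p k l : Fin 5) : obstruction (fun a b => xxd a b * v) p k l =
    (-2 : ℂ) • (∑ b, ∑ t, (levi k l p b t : ℂ) • (xxd t b * v)) +
      ∑ a, ∑ b, ∑ t, (levi k l a b t : ℂ) • (xxd a b * actDer (mu1 p t) v) := by
  have e : ∀ i k t, mu1 p t i k = if p = i then (if t = k then 1 else 0) else 0 := fun i k t => by
    simp only [mu1, Matrix.single_apply, ite_and]
  have h1 : ∀ a b t, (levi k l a b t : ℂ) • actDer (mu1 p t) (xxd a b * v) =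
      (levi k l a b t : ℂ) • (xxd a b * actDer (mu1 p t) v) -
      (if p = a then (levi k l a b t : ℂ) • (xxd t b * v) else 0) -
      (if p = b then (levi k l a b t : ℂ) • (xxd a t * v) else 0) := fun a b t => by
    rw [Derivation.leibniz, actDer_xxd]
    simp only [e, ite_smul, one_smul, zero_smul, Finset.sum_add_distrib, Finset.sum_ite_eq,
      Finset.mem_univ, if_true, Finset.sum_ite_irrel, Finset.sum_const_zero, smul_eq_mul,
      smul_add]
    split_ifs <;> simp only [MvPolynomial.smul_eq_C_mul] <;> ring
  have h2 : ∑ a, ∑ b, ∑ t, (if p = a then (levi k l a b t : ℂ) • (xxd t b * v) else 0) =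
      ∑ b, ∑ t, (levi k l p b t : ℂ) • (xxd t b * v) := by
    simp only [Finset.sum_ite_irrel, Finset.sum_const_zero, Finset.sum_ite_eq, Finset.mem_univ,
      if_true]
  have h3 : ∑ a, ∑ b, ∑ t, (if p = b then (levi k l a b t : ℂ) • (xxd a t * v) else 0) =
      ∑ b, ∑ t, (levi k l p b t : ℂ) • (xxd t b * v) := by
    simp only [Finset.sum_ite_irrel, Finset.sum_const_zero, Finset.sum_ite_eq, Finset.mem_univ,
      if_true]
    refine Finset.sum_congr rfl fun a _ => Finset.sum_congr rfl fun t _ => ?_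
    rw [levi_skew_right', xxd_skew a t, neg_mul, smul_neg, Int.cast_neg, neg_smul, neg_neg]
  simp only [obstruction, h1, Finset.sum_sub_distrib, h2, h3]
  rw [neg_smul, two_smul]
  abel

set_option maxRecDepth 100000 in
lemma levi_skew_one_three : ∀ i j k l t : Fin 5, levi i j k l t = - levi k j i l t := by decide

/-- Multiplication by `x_ab^*` followed by the projection onto `F(μ)`. -/
def thetaC (mu : Fin 4 → ℕ) (a b : Fin 5) : P →ₗ[ℂ] P :=
  (F mu).toSubmodule.subtype ∘ₗ (proj mu : P →ₗ[ℂ] F mu) ∘ₗ LinearMap.mulLeft ℂ (xxd a b)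

lemma thetaC_apply (mu : Fin 4 → ℕ) (a b : Fin 5) (g : P) :
    thetaC mu a b g = (proj mu (xxd a b * g) : P) := rfl

lemma actDer_proj {mu : Fin 4 → ℕ} (A : sl5) (g : P) :
    actDer A.mat (proj mu g : P) = (proj mu (actDer A.mat g) : P) := by
  rw [← coe_lie_F, ← LieModuleHom.map_lie, lie_P]

lemma thetaC_actDer (mu : Fin 4 → ℕ) (A : sl5) (a b : Fin 5) (g : P) :
    thetaC mu a b (actDer A.mat g) = actDer A.mat (thetaC mu a b g) +
      ∑ k, (A.mat a k • thetaC mu k b g + A.mat b k • thetaC mu a k g) := by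
  have h : actDer A.mat (xxd a b * g) = xxd a b * actDer A.mat g -
      ∑ k, (A.mat a k • (xxd k b * g) + A.mat b k • (xxd a k * g)) := by
    rw [Derivation.leibniz, actDer_xxd, smul_neg, Finset.smul_sum, sub_eq_add_neg]
    simp only [smul_eq_mul, mul_comm g, add_mul, smul_mul_assoc]
  simp only [thetaC_apply]
  rw [actDer_proj, h, map_sub, map_sum]
  simp only [map_add, map_smul, LieSubmodule.coe_sub, AddSubmonoidClass.coe_finsetSum,
    LieSubmodule.coe_add, LieSubmodule.coe_smul]
  rw [sub_add_cancel]

lemma exists_nablaC (m n : ℕ) {m' : ℕ} (hm : m' = m + 1) :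
    ∃ (θ : Fin 5 → Fin 5 → F ![0, 0, m, n] →ₗ[ℂ] F ![0, 0, m', n])
    (γ : M ![0, 0, m, n] →ₗ[U] M ![0, 0, m', n]), IsNablaC γ ∧
      (∀ a b v, θ a b v = proj _ (xxd a b * (v : P))) ∧
      ∀ v, γ (vmk 1 v) = (1 / 2 : ℂ) • ∑ a, ∑ b, vmk (toU (dForm a b)) (θ a b v) := by
  subst hm
  obtain ⟨θ, γ, h4, h5, h6⟩ := exists_morphism (lam := ![0, 0, m, n])
    (mu := ![0, 0, m + 1, n]) (thetaC _) (fun a b => by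
      refine LinearMap.ext fun g => ?_
      rw [LinearMap.neg_apply, thetaC_apply, thetaC_apply, xxd_skew, neg_mul, map_neg]
      rfl)
    (thetaC_actDer _) (fun a b => Subtype.property _)
    (fun i j k => by
      have e : ∀ a b, zMatrix i j k a b = (zLin i j k a b).mat := fun a b => by
        ext p q
        rw [zLin_mat, zMatrix, Matrix.of_apply]
      simp only [thetaC_apply, e, actDer_proj]
      simp only [← e, ← AddSubmonoidClass.coe_finsetSum, ← map_sum]
      -- The terms with `E_pt v` vanish under the projection, and the remaining ones cancel after
      -- symmetrising in `i`, `j`.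
      rw [sum_actDer_zMatrix (fun a b => xxd a b * hw ![0, 0, m, n]), obstruction_xxd,
        obstruction_xxd, map_add, map_add, map_add, proj_sum_levi_eq_zero, proj_sum_levi_eq_zero,
        add_zero, add_zero, ← map_add, ← smul_add, ← Finset.sum_add_distrib, Finset.sum_eq_zero,
        smul_zero, map_zero]
      · rfl
      · intro b _
        rw [← Finset.sum_add_distrib]
        refine Finset.sum_eq_zero fun t _ => ?_
        rw [levi_skew_one_three, ← add_smul, Int.cast_neg, neg_add_cancel, zero_smul])
  have h7 : ∀ a b v, θ a b v = proj _ (xxd a b * (v : P)) := fun a b v => Subtype.ext (h4 a b v)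
  refine ⟨θ, γ, ⟨m, n, rfl, rfl, proj _, proj_coe, _, fun p v => ?_, h5⟩, h7, h6⟩
  rw [h7, xxd_of_lt p.2]

/-! ### Morphisms of degree two -/

section

variable {lam mu : Fin 4 → ℕ}

lemma comp_vmk_one {nu : Fin 4 → ℕ} {θ : Fin 5 → Fin 5 → F lam →ₗ[ℂ] F nu}
    {θ' : Fin 5 → Fin 5 → F nu →ₗ[ℂ] F mu} {β : M lam →ₗ[U] M nu} {γ : M nu →ₗ[U] M mu}
    (hβ : ∀ v, β (vmk 1 v) = (1 / 2 : ℂ) • ∑ a, ∑ b, vmk (toU (dForm a b)) (θ a b v))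
    (hγ : ∀ v, γ (vmk 1 v) = (1 / 2 : ℂ) • ∑ a, ∑ b, vmk (toU (dForm a b)) (θ' a b v))
    (hθ : ∀ a b, θ a b = - θ b a) (hθ' : ∀ a b, θ' a b = - θ' b a) (v : F lam) :
    ∃ w u, IsSkew w ∧ (γ ∘ₗ β) (vmk 1 v) = vec2 w u ∧
      ∀ a b c d, w a b c d = (1 / 8 : ℂ) • (θ' c d (θ a b v) - θ' a b (θ c d v)) := by
  have h1 : ∀ a b, γ (vmk (toU (dForm a b)) (θ a b v)) = (1 / 2 : ℂ) •
      ∑ c, ∑ d, vmk (toU (dForm a b) * toU (dForm c d)) (θ' c d (θ a b v)) := fun a b => by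
    rw [← mul_one (toU (dForm a b)), ← smul_vmk, map_smul, hγ, smul_comm]
    simp only [Finset.smul_sum, smul_vmk, mul_one]
  have h2 : (γ ∘ₗ β) (vmk 1 v) =
      vec2 (fun a b c d => (1 / 4 : ℂ) • θ' c d (θ a b v)) (fun _ => 0) := by
    rw [LinearMap.comp_apply, hβ, vec2]
    have h3 : γ ((1 / 2 : ℂ) • ∑ a, ∑ b, vmk (toU (dForm a b)) (θ a b v)) =
      (1 / 2 : ℂ) • γ (∑ a, ∑ b, vmk (toU (dForm a b)) (θ a b v)) :=
      (γ.restrictScalars ℂ).map_smul _ _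
    rw [h3]
    simp only [map_sum, h1, vmk_smul_right, ← Finset.smul_sum, smul_smul]
    simp only [← vmkL_apply, map_zero, Finset.sum_const_zero, add_zero]
    norm_num
  -- Two factors 1/2 come from the sums over ordered pairs and a third from skew-symmetrisation,
  -- whence 1/8.
  rw [exists_isSkew_vec2] at h2
  refine ⟨_, _, ⟨fun a b c d => ?_, fun a b c d => ?_⟩, h2, fun a b c d => ?_⟩
  · rw [hθ a b, hθ' a b]
    simp only [LinearMap.neg_apply, map_neg]
    module
  · module
  · module

/-- A morphism of degree two is determined by one coefficient, provided that the vanishing of this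
coefficient forces singular vectors to vanish. -/
lemma eq_smul_of_coeff {φ ψ : M lam →ₗ[U] M mu} (hdeg : HasDegree φ 2) {a b k d : Fin 5}
    (hz : ∀ c u, IsSingular lam mu c u → c a b k d = 0 →
      (∀ a b k d, c a b k d = 0) ∧ ∀ t, u t = 0)
    {w : Fin 5 → Fin 5 → Fin 5 → Fin 5 → F mu} {u : Fin 5 → F mu} (hw : IsSkew w)
    (hψ : ψ (vmk 1 (hwF lam)) = vec2 w u) (h0 : hwForm mu (w a b k d : P) ≠ 0) :
    ∃ r : ℂ, φ = r • ψ := by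
  obtain ⟨w', u', hw', h1⟩ := mem_vermaDeg_two (hdeg (hwF lam))
  -- The scalar is chosen so that the distinguished coefficient of `φ − r ψ` vanishes.
  set r := hwForm mu (w' a b k d : P) / hwForm mu (w a b k d : P) with hr
  refine ⟨r, ?_⟩
  have h2 : (φ + (-r) • ψ) (vmk 1 (hwF lam)) = vec2 (w' + (-r) • w) (u' + (-r) • u) := by
    rw [LinearMap.add_apply, LinearMap.smul_apply, h1, hψ, vec2_add, vec2_smul]
  have hs := hw'.add (hw.smul (-r))
  obtain ⟨h3, h4⟩ := hz _ _ (isSingular_hwForm _ hs h2) (by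
    simp only [Pi.add_apply, Pi.smul_apply, LieSubmodule.coe_add, LieSubmodule.coe_smul, map_add,
      map_smul, smul_eq_mul]
    rw [hr, neg_mul, div_mul_cancel₀ _ h0, add_neg_cancel])
  rw [eq_zero_of_hwForm _ hs h2 h3 h4] at h2
  have h5 := eq_zero_of_hwF _ h2
  refine LinearMap.ext fun z => ?_
  have h6 : φ z + (-r) • ψ z = 0 := LinearMap.congr_fun h5 z
  rw [LinearMap.smul_apply, eq_neg_of_add_eq_zero_left h6]
  module

lemma weights_of_hasDegree_two {φ : M lam →ₗ[U] M mu} (hφ : φ ≠ 0) (hdeg : HasDegree φ 2) :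
    (∃ n : ℕ, lam = ![1, 0, 0, n] ∧ mu = ![0, 0, 1, n + 1]) ∨
    (∃ n : ℕ, lam = ![n + 1, 1, 0, 0] ∧ mu = ![n, 0, 0, 1]) ∨
    (lam = ![0, 1, 0, 0] ∧ mu = ![0, 0, 1, 0]) := by
  obtain ⟨w, u, hw, h1⟩ := mem_vermaDeg_two (hdeg (hwF lam))
  refine (isSingular_hwForm φ hw h1).weights fun h2 => hφ ?_
  exact eq_zero_of_hwF φ (h1.trans (eq_zero_of_hwForm φ hw h1 h2.1 h2.2))

end

/-- The coefficient `(0, 4, 3, 4)` of the composite at the highest weight vector is −1/8 times the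
highest weight vector of the target: the product through `d_04` survives, while the family of `∇_B`
vanishes at `(3, 4)`. -/
lemma eq_comp_nablaC_nablaB (n : ℕ) (φ : M ![1, 0, 0, n] →ₗ[U] M ![0, 0, 1, n + 1])
    (hdeg : HasDegree φ 2) : ∃ (β : M ![1, 0, 0, n] →ₗ[U] M ![0, 0, 0, n + 1])
      (γ : M ![0, 0, 0, n + 1] →ₗ[U] M ![0, 0, 1, n + 1]) (k : ℂ),
      IsNablaB β ∧ IsNablaC γ ∧ φ = k • (γ ∘ₗ β) := by
  have hB := exists_nablaB 0 n (m' := 1) (n' := n + 1) rfl rfl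
  have hC := exists_nablaC 0 (n + 1) (m' := 1) rfl
  obtain ⟨θ, β, hβ, h1, h2⟩ := hB
  obtain ⟨θ', γ, hγ, h3, h4⟩ := hC
  obtain ⟨w, u, hs, h5, h6⟩ := comp_vmk_one h2 h4 (fun a b => LinearMap.ext fun v => Subtype.ext (by
      rw [h1, thetaB_skew, LinearMap.neg_apply, LinearMap.neg_apply, LieSubmodule.coe_neg, h1]))
    (fun a b => LinearMap.ext fun v => by
      rw [h3, LinearMap.neg_apply, h3, xxd_skew, neg_mul, map_neg]) (hwF ![1, 0, 0, n])
  have h7 : θ 0 4 (hwF ![1, 0, 0, n]) = - hwF ![0, 0, 0, n + 1] := Subtype.ext (by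
    rw [h1]
    refine (thetaB_hw 0 n 0 4).trans ?_
    simp [hwF, hw, pow_succ'])
  have h8 : θ 3 4 (hwF ![1, 0, 0, n]) = 0 := Subtype.ext (by
    rw [h1]
    refine (thetaB_hw 0 n 3 4).trans ?_
    simp)
  have h9 : θ' 3 4 (hwF ![0, 0, 0, n + 1]) = hwF ![0, 0, 1, n + 1] := by
    have e : xxd 3 4 * hw ![0, 0, 0, n + 1] = hw ![0, 0, 1, n + 1] := by simp [hw]
    rw [h3]
    exact (congrArg _ e).trans (proj_coe (hwF _))
  have h10 : w 0 4 3 4 = (-1 / 8 : ℂ) • hwF ![0, 0, 1, n + 1] := by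
    rw [h6, h7, h8, map_neg, h9, map_zero]
    module
  obtain ⟨k, hk⟩ := eq_smul_of_coeff hdeg (fun c u h h0 => h.eq_zero_of_weights_B_C rfl h0) hs h5 (by
    rw [h10, LieSubmodule.coe_smul, map_smul]
    exact smul_ne_zero (by norm_num) (hwForm_hw _))
  exact ⟨β, γ, k, hβ, hγ, hk⟩

/-- Here the coefficient `(0, 1, 0, 4)` equals `−(n + 1)/8` times the highest weight vector, the
factor `n + 1` coming from differentiating `x_0^(n+1)`. -/
lemma eq_comp_nablaB_nablaA (n : ℕ) (φ : M ![n + 1, 1, 0, 0] →ₗ[U] M ![n, 0, 0, 1])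
    (hdeg : HasDegree φ 2) : ∃ (α : M ![n + 1, 1, 0, 0] →ₗ[U] M ![n + 1, 0, 0, 0])
      (β : M ![n + 1, 0, 0, 0] →ₗ[U] M ![n, 0, 0, 1]) (k : ℂ),
      IsNablaA α ∧ IsNablaB β ∧ φ = k • (β ∘ₗ α) := by
  have hA := exists_nablaA (n + 1) 0 (n' := 1) rfl
  have hB := exists_nablaB n 0 (m' := n + 1) (n' := 1) rfl rfl
  obtain ⟨θ, α, hα, h1, h2⟩ := hA
  obtain ⟨θ', β, hβ, h3, h4⟩ := hB
  obtain ⟨w, u, hs, h5, h6⟩ := comp_vmk_one h2 h4 (fun a b => LinearMap.ext fun v => Subtype.ext (by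
      rw [h1, pxx_skew, Derivation.neg_apply, LinearMap.neg_apply, LieSubmodule.coe_neg, h1]))
    (fun a b => LinearMap.ext fun v => Subtype.ext (by
      rw [h3, thetaB_skew, LinearMap.neg_apply, LinearMap.neg_apply, LieSubmodule.coe_neg, h3]))
    (hwF ![n + 1, 1, 0, 0])
  have h7 : θ 0 1 (hwF ![n + 1, 1, 0, 0]) = hwF ![n + 1, 0, 0, 0] := Subtype.ext (by
    rw [h1]
    refine (pxx_hw ![n + 1, 1, 0, 0] 0 1).trans ?_
    simp [hwF, elem])
  have h8 : θ 0 4 (hwF ![n + 1, 1, 0, 0]) = 0 := Subtype.ext (by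
    rw [h1]
    refine (pxx_hw ![n + 1, 1, 0, 0] 0 4).trans ?_
    simp [elem])
  have h9 : θ' 0 4 (hwF ![n + 1, 0, 0, 0]) = (-((n : ℂ) + 1)) • hwF ![n, 0, 0, 1] :=
    Subtype.ext (by
      rw [h3]
      refine (thetaB_hw n 0 0 4).trans ?_
      rw [LieSubmodule.coe_smul, neg_smul, ← smul_neg]
      simp [hwF, hw, mul_comm])
  have h10 : w 0 1 0 4 = (-((n : ℂ) + 1) / 8 : ℂ) • hwF ![n, 0, 0, 1] := by
    rw [h6, h7, h8, h9, map_zero]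
    module
  obtain ⟨k, hk⟩ := eq_smul_of_coeff hdeg (fun c u h h0 => h.eq_zero_of_weights_A_B rfl h0) hs h5 (by
    rw [h10, LieSubmodule.coe_smul, map_smul]
    exact smul_ne_zero (div_ne_zero (neg_ne_zero.mpr (Nat.cast_add_one_ne_zero n)) (by norm_num))
      (hwForm_hw _))
  exact ⟨α, β, k, hα, hβ, hk⟩

/-- Here the coefficient `(0, 1, 3, 4)` equals 1/8 times the highest weight vector: only the
derivative along `x_01` contributes. -/
lemma eq_comp_nablaC_nablaA (φ : M ![0, 1, 0, 0] →ₗ[U] M ![0, 0, 1, 0])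
    (hdeg : HasDegree φ 2) : ∃ (α : M ![0, 1, 0, 0] →ₗ[U] M ![0, 0, 0, 0])
      (γ : M ![0, 0, 0, 0] →ₗ[U] M ![0, 0, 1, 0]) (k : ℂ),
      IsNablaA α ∧ IsNablaC γ ∧ φ = k • (γ ∘ₗ α) := by
  have hA := exists_nablaA 0 0 (n' := 1) rfl
  have hC := exists_nablaC 0 0 (m' := 1) rfl
  obtain ⟨θ, α, hα, h1, h2⟩ := hA
  obtain ⟨θ', γ, hγ, h3, h4⟩ := hC
  obtain ⟨w, u, hs, h5, h6⟩ := comp_vmk_one h2 h4 (fun a b => LinearMap.ext fun v => Subtype.ext (by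
      rw [h1, pxx_skew, Derivation.neg_apply, LinearMap.neg_apply, LieSubmodule.coe_neg, h1]))
    (fun a b => LinearMap.ext fun v => by
      rw [h3, LinearMap.neg_apply, h3, xxd_skew, neg_mul, map_neg]) (hwF ![0, 1, 0, 0])
  have h7 : θ 0 1 (hwF ![0, 1, 0, 0]) = hwF ![0, 0, 0, 0] := Subtype.ext (by
    rw [h1]
    refine (pxx_hw ![0, 1, 0, 0] 0 1).trans ?_
    simp [hwF, elem])
  have h8 : θ 3 4 (hwF ![0, 1, 0, 0]) = 0 := Subtype.ext (by
    rw [h1]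
    refine (pxx_hw ![0, 1, 0, 0] 3 4).trans ?_
    simp [elem])
  have h9 : θ' 3 4 (hwF ![0, 0, 0, 0]) = hwF ![0, 0, 1, 0] := by
    have e : xxd 3 4 * hw ![0, 0, 0, 0] = hw ![0, 0, 1, 0] := by simp [hw]
    rw [h3]
    exact (congrArg _ e).trans (proj_coe (hwF _))
  have h10 : w 0 1 3 4 = (1 / 8 : ℂ) • hwF ![0, 0, 1, 0] := by
    rw [h6, h7, h8, h9, map_zero, sub_zero]
  obtain ⟨k, hk⟩ := eq_smul_of_coeff hdeg (fun c u h h0 => h.eq_zero_of_weights_A_C rfl h0) hs h5 (by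
    rw [h10, LieSubmodule.coe_smul, map_smul]
    exact smul_ne_zero (by norm_num) (hwForm_hw _))
  exact ⟨α, γ, k, hα, hγ, hk⟩

end E510

end

theorem mainTheorem2 (lam mu : Fin 4 → ℕ) (φ : E510.M lam →ₗ[E510.U] E510.M mu)
    (hφ : φ ≠ 0) (hdeg : E510.HasDegree φ 2) :
    (∃ n : ℕ, lam = ![1, 0, 0, n] ∧ mu = ![0, 0, 1, n + 1] ∧
      ∃ (β : E510.M lam →ₗ[E510.U] E510.M ![0, 0, 0, n + 1])
        (γ : E510.M ![0, 0, 0, n + 1] →ₗ[E510.U] E510.M mu) (k : ℂ),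
        E510.IsNablaB β ∧ E510.IsNablaC γ ∧ φ = k • (γ ∘ₗ β)) ∨
    (∃ n : ℕ, lam = ![n + 1, 1, 0, 0] ∧ mu = ![n, 0, 0, 1] ∧
      ∃ (α : E510.M lam →ₗ[E510.U] E510.M ![n + 1, 0, 0, 0])
        (β : E510.M ![n + 1, 0, 0, 0] →ₗ[E510.U] E510.M mu) (k : ℂ),
        E510.IsNablaA α ∧ E510.IsNablaB β ∧ φ = k • (β ∘ₗ α)) ∨
    (lam = ![0, 1, 0, 0] ∧ mu = ![0, 0, 1, 0] ∧
      ∃ (α : E510.M lam →ₗ[E510.U] E510.M ![0, 0, 0, 0])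
        (γ : E510.M ![0, 0, 0, 0] →ₗ[E510.U] E510.M mu) (k : ℂ),
        E510.IsNablaA α ∧ E510.IsNablaC γ ∧ φ = k • (γ ∘ₗ α)) := by
  rcases E510.weights_of_hasDegree_two hφ hdeg with ⟨n, rfl, rfl⟩ | ⟨n, rfl, rfl⟩ | ⟨rfl, rfl⟩
  · exact Or.inl ⟨n, rfl, rfl, E510.eq_comp_nablaC_nablaB n φ hdeg⟩
  · exact Or.inr (Or.inl ⟨n, rfl, rfl, E510.eq_comp_nablaB_nablaA n φ hdeg⟩)
  · exact Or.inr (Or.inr ⟨rfl, rfl, E510.eq_comp_nablaC_nablaA φ hdeg⟩)
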